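/- Let $\Bbbk$ be a field and let $\mathcal{C}$ be a $\Bbbk$-linear abelian category in which every object has finite length, with a set of representatives $L_\lambda$ ($\lambda\in\Lambda$) of the isomorphism classes of simple objects indexed by a poset $(\Lambda,\leq)$ such that $\{\mu\mid\mu\leq\lambda\}$ is finite for every $\lambda$. For an order ideal $\Gamma\subseteq\Lambda$ let $\mathcal{C}_\Gamma$ be the Serre subcategory generated by the $L_\lambda$ with $\lambda\in\Gamma$, and $\mathcal{C}_{\leq\lambda}=\mathcal{C}_{\{\mu\mid\mu\leq\lambda\}}$. Assume that $\mathcal{C}$ is a highest weight category: each $L_\lambda$ has a projective cover $\Delta_\lambda\to L_\lambda$ and an injective hull $L_\lambda\to\nabla_\lambda$ in $\mathcal{C}_{\leq\lambda}$, $\mathrm{Hom}_{\mathcal{C}}(\Delta_\lambda,\nabla_\lambda)\cong\Bbbk$, and $\mathrm{Ext}^1_{\mathcal{C}}(\Delta_\lambda,\nabla_\mu)=\mathrm{Ext}^2_{\mathcal{C}}(\Delta_\lambda,\nabla_\mu)=0$ for all $\lambda,\mu\in\Lambda$. An object is tilting if it has a finite filtration with subquotients of the form $\Delta_\lambda$ and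 a finite filtration with subquotients of the form $\nabla_\lambda$. Let $T_\lambda$ be the indecomposable tilting object in $\mathcal{C}_{\leq\lambda}$ with $[T_\lambda:L_\lambda]=1$ (unique up to isomorphism), and write $[M:N]_\oplus$ for the multiplicity of an indecomposable object $N$ in a Krull--Schmidt decomposition of $M$. A minimal tilting complex $C_{\min}(M)$ of an object $M$ is a bounded complex of tilting objects, all of whose differentials lie in the radical of the category $\mathrm{Tilt}(\mathcal{C})$ of tilting objects, that is isomorphic to $M$ (in degree $0$) in $D^b(\mathcal{C})$; it is unique up to isomorphism of complexes. For a finite order ideal $\Gamma$, put $T=\bigoplus_{\lambda\in\Gamma}T_\lambda$ and $A=\mathrm{End}_{\mathcal{C}_\Gamma}(T)^{\mathrm{op}}$. The Ringel dual $\mathcal{C}'_\Gamma$ of $\mathcal{C}_\Gamma$ is the category of finite-dimensional left $A$-modules. For $\nu\in\Gamma$ put $\Delta'_\nu=\mathrm{Hom}_{\mathcal{C}_\Gamma}(T,\nabla_\nu)$, $\nabla'_\nu=\mathrm{Hom}_{\mathcal{C}_\Gamma}(\Delta_\nu,T)^*$ and $L'_\nu=\mathrm{head}\,\Delta'_\nu$.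 Let $\Gamma\subseteq\Lambda$ be a finite order ideal and let $\lambda,\mu\in\Gamma$. For $\nu\in\Gamma$ consider \[ p_{\nu,\lambda}=\sum_{i\geq0}\dim\mathrm{Ext}^i_{\mathcal{C}}(L_\lambda,\nabla_\nu)\,v^i,\qquad p'_{\nu,\mu}=\sum_{i\geq0}\dim\mathrm{Ext}^i_{\mathcal{C}'_\Gamma}(L'_\mu,\nabla'_\nu)\,v^i . \] Suppose that there is a function $\ell\colon\Gamma\to\mathbb{Z}$ such that \[ p_{\nu,\lambda}\in v^{\ell(\lambda)-\ell(\nu)}\,\mathbb{Z}[v^{\pm2}]\qquad\text{and}\qquad p'_{\nu,\mu}\in v^{\ell(\mu)-\ell(\nu)}\,\mathbb{Z}[v^{\pm2}]\qquad\text{for all }\nu\in\Gamma . \] Then all the $\mathrm{Ext}$-spaces above are finite-dimensional and for each $\nu \in \Gamma$ only finitely many are non-zero (so that $p_{\nu,\lambda}$ and $p'_{\nu,\mu}$ are indeed polynomials), a minimal tilting complex $C_{\min}(L_\lambda)$ exists, and for every minimal tilting complex of $L_\lambda$, \[ \sum_{i\in\mathbb{Z}}\big[C_{\min}(L_\lambda)_i:T_\mu\big]_\oplus\,v^i=\sum_{\nu\leq\lambda}\overline{p_{\nu,\lambda}}\cdot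 p'_{\nu,\mu}, \] where $\overline{\phantom{A}}\colon\mathbb{Z}[v^{\pm1}]\to\mathbb{Z}[v^{\pm1}]$ is the ring homomorphism with $v\mapsto v^{-1}$. -/

import Mathlib

open CategoryTheory CategoryTheory.Limits
open scoped LaurentPolynomial ZeroObject

universe w v u

namespace HighestWeight

noncomputable section

attribute [local instance] Abelian.hasFiniteBiproducts

/-! ### Ext groups, derived categories, Laurent polynomials -/

section Homological

variable {C : Type u} [Category.{v} C] [Abelian C]

/-- `Ext^n(X, Y)`, i.e. `Hom(X, Y[n])` in the derived category of the abelian category `C`. -/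
abbrev ExtGroup (X Y : C) (n : ℕ) : Type (max u v) :=
  haveI := HasExt.standard C
  Abelian.Ext.{max u v} X Y n

/-- The complex `K` is isomorphic to the object `M`, placed in degree zero, in the derived
category of `C`. -/
def IsoInDerivedCategory (K : CochainComplex C ℤ) (M : C) : Prop :=
  letI := HasDerivedCategory.standard C
  Nonempty (DerivedCategory.Q.obj K ≅ (DerivedCategory.singleFunctor C 0).obj M)

variable (𝕜 : Type v) [Field 𝕜] [Linear 𝕜 C]

/-- `dim Ext^n(X, Y)`. -/
def extDim (X Y : C) (n : ℕ) : ℕ :=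
  haveI := HasExt.standard C
  Module.finrank 𝕜 (ExtGroup X Y n)

/-- All the spaces `Ext^n(X, Y)` are finite-dimensional and only finitely many of them are
non-zero, i.e. the sum `∑ dim Ext^n(X, Y) v^n` is a polynomial. -/
def ExtFinite (X Y : C) : Prop :=
  haveI := HasExt.standard C
  (∀ n, Module.Finite 𝕜 (ExtGroup X Y n)) ∧ {n | Nontrivial (ExtGroup X Y n)}.Finite

/-- The polynomial `∑ dim Ext^n(X, Y) v^n`, as a Laurent polynomial in `v = T 1`. -/
def extPoly (X Y : C) : ℤ[T;T⁻¹] :=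
  ∑ᶠ n : ℕ, (extDim 𝕜 X Y n : ℤ) • LaurentPolynomial.T (n : ℤ)

end Homological

/-- The subring `ℤ[v², v⁻²]` of `ℤ[v, v⁻¹]`. -/
def evenSubring : Subring ℤ[T;T⁻¹] :=
  Subring.closure {LaurentPolynomial.T 2, LaurentPolynomial.T (-2)}

/-- `p ∈ v^n ℤ[v², v⁻²]`. -/
def HasParity (p : ℤ[T;T⁻¹]) (n : ℤ) : Prop :=
  ∃ q ∈ evenSubring, p = LaurentPolynomial.T n * q

/-! ### Filtrations and truncations -/

section Filtration

variable {C : Type u} [Category.{v} C] [Abelian C] {Λ : Type w}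

/-- `HasFiltration F X l` means that there is a chain `0 = X₀ ⊆ X₁ ⊆ ⋯ ⊆ Xᵣ = X` of
subobjects such that the successive quotients `Xᵣ / Xᵣ₋₁, …, X₁ / X₀` are isomorphic to the
objects `F i` for the indices `i` in the list `l`, in this order. -/
inductive HasFiltration (F : Λ → C) : C → List Λ → Prop
  | zero {X : C} (hX : IsZero X) : HasFiltration F X []
  | step (S : ShortComplex C) (hS : S.ShortExact) {i : Λ} {l : List Λ}
      (h₁ : HasFiltration F S.X₁ l) (h₃ : Nonempty (S.X₃ ≅ F i)) :
      HasFiltration F S.X₂ (i :: l)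

instance isClosedUnderFiniteProducts_of_isSerreClass (P : ObjectProperty C) [P.IsSerreClass] :
    P.IsClosedUnderFiniteProducts := by
  have : P.IsClosedUnderLimitsOfShape (Discrete.{0} PEmpty) := inferInstance
  have : P.IsClosedUnderBinaryProducts := by
    refine .mk' ?_
    rintro X ⟨F, hF⟩
    have e : F ≅ pair (F.obj ⟨WalkingPair.left⟩) (F.obj ⟨WalkingPair.right⟩) := diagramIsoPair F
    refine P.prop_of_iso (biprod.isoProd _ _ ≪≫ (HasLimit.isoOfNatIso e).symm)
      (P.prop_biprod (hF _) (hF _))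
  exact ObjectProperty.IsClosedUnderFiniteProducts.mk'

/-- The Serre subcategory generated by the objects `L i` for `i ∈ Γ`: the smallest Serre class
containing these objects. -/
def trunc (L : Λ → C) (Γ : Set Λ) : ObjectProperty C := fun X =>
  ∀ P : ObjectProperty C, P.IsSerreClass → (∀ i ∈ Γ, P (L i)) → P X

lemma trunc_gen (L : Λ → C) (Γ : Set Λ) {i : Λ} (hi : i ∈ Γ) : trunc L Γ (L i) :=
  fun _ _ h => h i hi

lemma trunc_mono (L : Λ → C) {Γ Γ' : Set Λ} (h : Γ ⊆ Γ') {X : C} (hX : trunc L Γ X) :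
    trunc L Γ' X :=
  fun P hP hL => hX P hP fun i hi => hL i (h hi)

instance isSerreClass_trunc (L : Λ → C) (Γ : Set Λ) : (trunc L Γ).IsSerreClass where
  exists_zero := ⟨0, isZero_zero C, fun P _ _ => P.prop_of_isZero (isZero_zero C)⟩
  prop_of_mono f _ h := fun P hP hL => P.prop_of_mono f (h P hP hL)
  prop_of_epi f _ h := fun P hP hL => P.prop_of_epi f (h P hP hL)
  prop_X₂_of_shortExact hS h₁ h₃ := fun P hP hL =>
    P.prop_X₂_of_shortExact hS (h₁ P hP hL) (h₃ P hP hL)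

end Filtration

/-! ### Highest weight categories -/

section Covers

variable {D : Type u} [Category.{v} D]

/-- `p : P ⟶ X` is a projective cover of `X`. -/
structure IsProjectiveCover {P X : D} (p : P ⟶ X) : Prop where
  projective : Projective P
  epi : Epi p
  superfluous : ∀ {Q : D} (f : Q ⟶ P), Epi (f ≫ p) → Epi f

/-- `j : X ⟶ I` is an injective hull of `X`. -/
structure IsInjectiveHull {X I : D} (j : X ⟶ I) : Prop where
  injective : Injective I
  mono : Mono j
  essential : ∀ {Q : D} (f : I ⟶ Q), Mono (j ≫ f) → Mono f

end Covers

/-- The structure of a highest weight category with weight poset `Λ` on a `𝕜`-linear abelian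
category `C`. -/
structure HighestWeightCategory (𝕜 : Type v) [Field 𝕜] (C : Type u) [Category.{v} C]
    [Abelian C] [Linear 𝕜 C] (Λ : Type w) [PartialOrder Λ] where
  /-- The weight poset is lower finite. -/
  lowerFinite : ∀ l : Λ, (Set.Iic l).Finite
  /-- The simple objects. -/
  L : Λ → C
  simple : ∀ l, Simple (L l)
  eq_of_iso : ∀ l m, Nonempty (L l ≅ L m) → l = m
  exists_iso : ∀ X : C, Simple X → ∃ l, Nonempty (X ≅ L l)
  /-- Every object has a finite composition series. -/
  finiteLength : ∀ X : C, ∃ s, HasFiltration L X s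
  /-- The standard objects. -/
  Δ : Λ → C
  /-- The costandard objects. -/
  nabla : Λ → C
  Δ_mem : ∀ l, trunc L (Set.Iic l) (Δ l)
  nabla_mem : ∀ l, trunc L (Set.Iic l) (nabla l)
  /-- The projective cover `Δ l ⟶ L l` in the truncated category at `{m | m ≤ l}`. -/
  π : ∀ l, Δ l ⟶ L l
  isProjectiveCover : ∀ l, IsProjectiveCover (D := (trunc L (Set.Iic l)).FullSubcategory)
    (P := ⟨Δ l, Δ_mem l⟩) (X := ⟨L l, trunc_gen L _ le_rfl⟩) (ObjectProperty.homMk (π l))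
  /-- The injective hull `L l ⟶ nabla l` in the truncated category at `{m | m ≤ l}`. -/
  ι : ∀ l, L l ⟶ nabla l
  isInjectiveHull : ∀ l, IsInjectiveHull (D := (trunc L (Set.Iic l)).FullSubcategory)
    (X := ⟨L l, trunc_gen L _ le_rfl⟩) (I := ⟨nabla l, nabla_mem l⟩) (ObjectProperty.homMk (ι l))
  hom_Δ_nabla : ∀ l, Nonempty ((Δ l ⟶ nabla l) ≃ₗ[𝕜] 𝕜)
  ext_one : ∀ l m, Subsingleton (ExtGroup (Δ l) (nabla m) 1)
  ext_two : ∀ l m, Subsingleton (ExtGroup (Δ l) (nabla m) 2)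

/-! ### Minimal complexes and multiplicities -/

section Additive

/-- The radical of a preadditive category. -/
def categoryRadical {A : Type u} [Category.{v} A] [Preadditive A] (X Y : A) : Set (X ⟶ Y) :=
  {f | ∀ (Z : A) (a : Z ⟶ X) (b : Y ⟶ Z),
    (show End Z from a ≫ f ≫ b) ∈ Ring.jacobson (End Z)}

/-- A cochain complex all of whose differentials belong to the radical. -/
def IsMinimalComplex {A : Type u} [Category.{v} A] [Preadditive A]
    (K : CochainComplex A ℤ) : Prop :=
  ∀ i, K.d i (i + 1) ∈ categoryRadical (K.X i) (K.X (i + 1))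

def IsBoundedComplex {A : Type u} [Category.{v} A] [Preadditive A]
    (K : CochainComplex A ℤ) : Prop :=
  ∃ a b : ℤ, ∀ i, (i < a ∨ b < i) → IsZero (K.X i)

variable {C : Type u} [Category.{v} C] [Abelian C]

/-- A decomposition of `M` as a finite direct sum of indecomposable objects. -/
structure KrullSchmidtDecomposition (M : C) where
  r : ℕ
  X : Fin r → C
  indecomposable : ∀ i, Indecomposable (X i)
  iso : M ≅ ⨁ X

open Classical in
/-- `[M : N]_⊕`: the number of summands isomorphic to `N` in a decomposition of `M` into
indecomposable objects (with value zero if `M` has no such decomposition). In a finite length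
abelian category every object has a decomposition and the number does not depend on it. -/
def multiplicity (M N : C) : ℕ :=
  if h : Nonempty (KrullSchmidtDecomposition M) then
    Nat.card {i : Fin h.some.r // Nonempty (h.some.X i ≅ N)}
  else 0

end Additive

/-! ### Tilting objects -/

namespace HighestWeightCategory

variable {𝕜 : Type v} [Field 𝕜] {C : Type u} [Category.{v} C] [Abelian C] [Linear 𝕜 C]
  {Λ : Type w} [PartialOrder Λ] (H : HighestWeightCategory 𝕜 C Λ)

/-- Tilting objects: objects with a filtration by standard objects and a filtration by
costandard objects. -/
def tilting : ObjectProperty C := fun X =>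
  (∃ s, HasFiltration H.Δ X s) ∧ (∃ s, HasFiltration H.nabla X s)

open Classical in
/-- `T` is the indecomposable tilting object of highest weight `l`: an indecomposable tilting
object in the truncated category at `{m | m ≤ l}` with `[T : L l] = 1`. -/
structure IsIndecomposableTilting (l : Λ) (T : C) : Prop where
  tilting : H.tilting T
  indecomposable : Indecomposable T
  mem : trunc H.L (Set.Iic l) T
  compositionMultiplicity : ∃ s, HasFiltration H.L T s ∧ s.count l = 1

/-- The category `Tilt(C)` of tilting objects. -/
abbrev Tilt : Type u := H.tilting.FullSubcategory

/-- A complex of tilting objects, viewed as a complex in `C`. -/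
abbrev complexOfTilt (K : CochainComplex H.Tilt ℤ) : CochainComplex C ℤ :=
  (H.tilting.ι.mapHomologicalComplex (ComplexShape.up ℤ)).obj K

/-- `K` is a minimal tilting complex of `M`: a minimal bounded complex in `Tilt(C)` that is
isomorphic to `M` in the derived category. -/
structure IsMinimalTiltingComplex (M : C) (K : CochainComplex H.Tilt ℤ) : Prop where
  bounded : IsBoundedComplex K
  minimal : IsMinimalComplex K
  iso : IsoInDerivedCategory (H.complexOfTilt K) M

end HighestWeightCategory

/-! ### Ringel duality -/

section FDModules

open scoped ModuleCat

variable (𝕜 : Type v) [Field 𝕜] (A : Type v) [Ring A] [Algebra 𝕜 A]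

/-- The finite-dimensional left `A`-modules. -/
def fdModules : ObjectProperty (ModuleCat.{v} A) := fun M => Module.Finite 𝕜 M

variable {𝕜 A}

lemma fdModules_of_injective {M N : ModuleCat.{v} A} (f : M ⟶ N) (hf : Function.Injective f)
    (hN : fdModules 𝕜 A N) : fdModules 𝕜 A M := by
  have : Module.Finite 𝕜 N := hN
  exact Module.Finite.of_injective (f.hom.restrictScalars 𝕜) hf

lemma fdModules_of_surjective {M N : ModuleCat.{v} A} (f : M ⟶ N) (hf : Function.Surjective f)
    (hM : fdModules 𝕜 A M) : fdModules 𝕜 A N := by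
  have : Module.Finite 𝕜 M := hM
  exact Module.Finite.of_surjective (f.hom.restrictScalars 𝕜) hf

lemma fdModules_of_addMonoidHom {M V : Type v} [AddCommGroup M] [Module A M] [AddCommGroup V]
    [Module 𝕜 V] [Module.Finite 𝕜 V] (e : V →+ M) (he : Function.Surjective e)
    (h : ∀ (r : 𝕜) (x : V), e (r • x) = algebraMap 𝕜 A r • e x) :
    fdModules 𝕜 A (ModuleCat.of A M) :=
  letI : Module 𝕜 M := Module.restrictScalars 𝕜 A M
  let f : V →ₗ[𝕜] M := { toFun := e, map_add' := e.map_add, map_smul' := h }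
  show Module.Finite 𝕜 M from Module.Finite.of_surjective f he

instance : (fdModules 𝕜 A).IsSerreClass where
  exists_zero := ⟨ModuleCat.of A PUnit, ModuleCat.isZero_of_subsingleton _, by
    have : Finite (ModuleCat.of A PUnit.{v + 1}) := inferInstanceAs (Finite PUnit.{v + 1})
    exact Module.Finite.of_finite⟩
  prop_of_mono f _ h := fdModules_of_injective f ((ModuleCat.mono_iff_injective f).1 ‹_›) h
  prop_of_epi f _ h := fdModules_of_surjective f ((ModuleCat.epi_iff_surjective f).1 ‹_›) h
  prop_X₂_of_shortExact {S} hS h₁ h₃ := by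
    have : Module.Finite 𝕜 S.X₁ := h₁
    have : Module.Finite 𝕜 S.X₃ := h₃
    have : IsNoetherian 𝕜 S.X₂ := isNoetherian_of_range_eq_ker
      (S.f.hom.restrictScalars 𝕜) (S.g.hom.restrictScalars 𝕜) (by
        ext x
        exact ((ShortComplex.ShortExact.moduleCat_exact_iff_function_exact S).1 hS.exact x).symm)
    change Module.Finite 𝕜 S.X₂
    infer_instance

instance : Abelian (fdModules 𝕜 A).FullSubcategory := inferInstance

/-- The head of a finite-dimensional module: the quotient by the intersection of all maximal
submodules. -/
def head (M : (fdModules 𝕜 A).FullSubcategory) : (fdModules 𝕜 A).FullSubcategory where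
  obj := ModuleCat.of A (M.obj ⧸ Module.jacobson A M.obj)
  property := fdModules_of_surjective (ModuleCat.ofHom (Module.jacobson A M.obj).mkQ)
    (Submodule.mkQ_surjective _) M.property

end FDModules

section RingelDual

variable (𝕜 : Type v) [Field 𝕜] {D : Type u} [Category.{v} D] [Preadditive D]
  [HasFiniteBiproducts D] [Linear 𝕜 D] {J : Type w} [Finite J] (T : J → D)

/-- The algebra `A = End(⨁ T)ᵒᵖ`. Multiplication in `End` is composition of maps,
`f * g = f ∘ g`. -/
abbrev ringelAlgebra : Type v := (End (⨁ T))ᵐᵒᵖ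

/-- The Ringel dual: finite-dimensional left `A`-modules. -/
abbrev RingelDual : Type (v + 1) := (fdModules 𝕜 (ringelAlgebra T)).FullSubcategory

/-- The left `A`-module structure on the dual space `Hom(X, ⨁ T)^*`: `(a φ)(g) = φ(a ∘ g)`. -/
abbrev dualHomModule (X : D) : Module (ringelAlgebra T) (Module.Dual 𝕜 (X ⟶ ⨁ T)) where
  smul a φ := φ.comp (Linear.rightComp 𝕜 X a.unop)
  one_smul φ := LinearMap.ext fun g => congrArg φ (Category.comp_id g)
  mul_smul a b φ := LinearMap.ext fun g => congrArg φ (Category.assoc g a.unop b.unop).symm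
  smul_zero _ := rfl
  smul_add _ _ _ := rfl
  add_smul a b φ := LinearMap.ext fun g =>
    (congrArg φ (Preadditive.comp_add _ _ _ g a.unop b.unop)).trans (map_add φ _ _)
  zero_smul φ := LinearMap.ext fun g =>
    (congrArg φ (comp_zero : g ≫ (0 : ⨁ T ⟶ ⨁ T) = 0)).trans (map_zero φ)

variable {𝕜 T} (hfin : ∀ X Y : D, Module.Finite 𝕜 (X ⟶ Y))

/-- `Hom(⨁ T, X)`, a left `A`-module by precomposition. -/
def ringelΔ (X : D) : RingelDual 𝕜 T where
  obj := ModuleCat.of (ringelAlgebra T) (⨁ T ⟶ X)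
  property := by
    have := hfin (⨁ T) X
    exact fdModules_of_addMonoidHom (V := (⨁ T ⟶ X)) (AddMonoidHom.id _)
      Function.surjective_id fun r g => by
        change r • g = (r • 𝟙 (⨁ T)) ≫ g
        simp

/-- `Hom(X, ⨁ T)^*`. -/
def ringelNabla (X : D) : RingelDual 𝕜 T where
  obj :=
    letI := dualHomModule 𝕜 T X
    ModuleCat.of (ringelAlgebra T) (Module.Dual 𝕜 (X ⟶ ⨁ T))
  property := by
    have := hfin X (⨁ T)
    let _ := dualHomModule 𝕜 T X
    exact fdModules_of_addMonoidHom (V := Module.Dual 𝕜 (X ⟶ ⨁ T)) (AddMonoidHom.id _)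
      Function.surjective_id fun r φ => LinearMap.ext fun g => by
        change r • φ g = φ (g ≫ (r • 𝟙 (⨁ T)))
        simp

end RingelDual

namespace HighestWeightCategory

variable {𝕜 : Type v} [Field 𝕜] {C : Type u} [Category.{v} C] [Abelian C] [Linear 𝕜 C]
  {Λ : Type w} [PartialOrder Λ] (H : HighestWeightCategory 𝕜 C Λ)

lemma finite_hom_of_shortExact_right (X : C) {S : ShortComplex C} (hS : S.ShortExact)
    (h₁ : Module.Finite 𝕜 (X ⟶ S.X₁)) (h₃ : Module.Finite 𝕜 (X ⟶ S.X₃)) :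
    Module.Finite 𝕜 (X ⟶ S.X₂) := by
  have := hS.mono_f
  have : IsNoetherian 𝕜 (X ⟶ S.X₂) := isNoetherian_of_range_eq_ker
    (Linear.rightComp 𝕜 X S.f) (Linear.rightComp 𝕜 X S.g) (by
      ext g
      constructor
      · rintro ⟨a, rfl⟩
        simp
      · intro hg
        exact ⟨hS.exact.lift g hg, hS.exact.lift_f g hg⟩)
  infer_instance

lemma finite_hom_of_shortExact_left (X : C) {S : ShortComplex C} (hS : S.ShortExact)
    (h₁ : Module.Finite 𝕜 (S.X₁ ⟶ X)) (h₃ : Module.Finite 𝕜 (S.X₃ ⟶ X)) :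
    Module.Finite 𝕜 (S.X₂ ⟶ X) := by
  have := hS.epi_g
  have : IsNoetherian 𝕜 (S.X₂ ⟶ X) := isNoetherian_of_range_eq_ker
    (Linear.leftComp 𝕜 X S.g) (Linear.leftComp 𝕜 X S.f) (by
      ext g
      constructor
      · rintro ⟨a, rfl⟩
        simp
      · intro hg
        exact ⟨hS.exact.desc g hg, hS.exact.g_desc g hg⟩)
  infer_instance

lemma finite_hom_simple (l m : Λ) : Module.Finite 𝕜 (H.L l ⟶ H.L m) := by
  have := H.simple l
  have := H.simple m
  by_cases h : l = m
  · subst h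
    obtain ⟨e⟩ := H.hom_Δ_nabla l
    have : Module.Finite 𝕜 (H.Δ l ⟶ H.nabla l) := Module.Finite.equiv e.symm
    let f : (H.L l ⟶ H.L l) →ₗ[𝕜] (H.Δ l ⟶ H.nabla l) :=
      (Linear.rightComp 𝕜 _ (H.ι l)).comp (Linear.leftComp 𝕜 _ (H.π l))
    refine Module.Finite.of_injective f fun a b hab => ?_
    let Q := trunc H.L (Set.Iic l)
    let X : Q.FullSubcategory := ⟨H.Δ l, H.Δ_mem l⟩
    let Y : Q.FullSubcategory := ⟨H.L l, trunc_gen H.L _ le_rfl⟩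
    let Z : Q.FullSubcategory := ⟨H.nabla l, H.nabla_mem l⟩
    let p : X ⟶ Y := ObjectProperty.homMk (H.π l)
    let i : Y ⟶ Z := ObjectProperty.homMk (H.ι l)
    let a' : Y ⟶ Y := ObjectProperty.homMk a
    let b' : Y ⟶ Y := ObjectProperty.homMk b
    have hp : Epi p := (H.isProjectiveCover l).epi
    have hi : Mono i := (H.isInjectiveHull l).mono
    have h₁ : p ≫ a' ≫ i = p ≫ b' ≫ i := ObjectProperty.hom_ext _ <| by
      have h₀ : H.π l ≫ a ≫ H.ι l = H.π l ≫ b ≫ H.ι l := by simpa [f] using hab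
      exact h₀
    have h₂ : a' = b' := (cancel_mono i).1 ((cancel_epi p).1 h₁)
    exact congrArg (fun k => k.hom) h₂
  · have : Subsingleton (H.L l ⟶ H.L m) := by
      refine ⟨fun f g => ?_⟩
      have key : ∀ k : H.L l ⟶ H.L m, k = 0 := fun k => by
        by_contra hk
        have := isIso_of_hom_simple hk
        exact h (H.eq_of_iso _ _ ⟨asIso k⟩)
      rw [key f, key g]
    infer_instance

lemma finite_hom (H : HighestWeightCategory 𝕜 C Λ) (X Y : C) : Module.Finite 𝕜 (X ⟶ Y) := by
  obtain ⟨s, hX⟩ := H.finiteLength X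
  obtain ⟨t, hY⟩ := H.finiteLength Y
  induction hX with
  | zero hX =>
    have : Subsingleton (_ ⟶ Y) := ⟨fun f g => hX.eq_of_src f g⟩
    infer_instance
  | step S hS h₁ h₃ ih =>
    rename_i l _
    refine finite_hom_of_shortExact_left Y hS ih ?_
    obtain ⟨e⟩ := h₃
    suffices h : Module.Finite 𝕜 (H.L l ⟶ Y) from
      Module.Finite.equiv (Linear.homCongr 𝕜 e.symm (Iso.refl Y))
    clear ih h₁ hS
    induction hY with
    | zero hY =>
      have : Subsingleton (H.L l ⟶ _) := ⟨fun f g => hY.eq_of_tgt f g⟩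
      infer_instance
    | step S' hS' h₁' h₃' ih' =>
      refine finite_hom_of_shortExact_right _ hS' ih' ?_
      obtain ⟨e'⟩ := h₃'
      have := H.finite_hom_simple
      exact Module.Finite.equiv (Linear.homCongr 𝕜 (Iso.refl _) e'.symm)

/-- The truncated category at an order ideal. -/
abbrev Truncated (Γ : LowerSet Λ) : Type u := (trunc H.L (Γ : Set Λ)).FullSubcategory

lemma finite_hom_truncated (Γ : LowerSet Λ) (X Y : H.Truncated Γ) :
    Module.Finite 𝕜 (X ⟶ Y) := by
  have := H.finite_hom X.obj Y.obj
  let e : (X.obj ⟶ Y.obj) →ₗ[𝕜] (X ⟶ Y) :=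
    { toFun := fun f => ObjectProperty.homMk f
      map_add' := fun _ _ => rfl
      map_smul' := fun _ _ => rfl }
  exact Module.Finite.of_surjective e fun f => ⟨f.hom, rfl⟩

/-- An object of the truncated category at `{m | m ≤ l}`, as an object of the truncated category
at an order ideal containing `l`. -/
def toTruncated {Γ : LowerSet Λ} (l : Γ) {X : C} (hX : trunc H.L (Set.Iic (l : Λ)) X) :
    H.Truncated Γ where
  obj := X
  property := trunc_mono H.L (fun _ hm => Γ.lower hm l.2) hX

variable {H} {T : Λ → C} (hT : ∀ l, H.IsIndecomposableTilting l (T l)) (Γ : LowerSet Λ)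
  [Finite Γ]

/-- The indecomposable tilting objects `T l` of the truncated category. -/
abbrev tiltingTruncated (l : Γ) : H.Truncated Γ := H.toTruncated l (hT l).mem

/-- The Ringel dual of the truncated category at the finite order ideal `Γ`. -/
abbrev TruncatedRingelDual : Type (v + 1) := RingelDual 𝕜 (tiltingTruncated hT Γ)

variable {Γ}

/-- The standard object of the Ringel dual: the image of the costandard object. -/
def dualΔ (l : Γ) : TruncatedRingelDual hT Γ :=
  ringelΔ (H.finite_hom_truncated Γ) (H.toTruncated l (H.nabla_mem l))

/-- The costandard object of the Ringel dual: the image of the standard object. -/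
def dualNabla (l : Γ) : TruncatedRingelDual hT Γ :=
  ringelNabla (H.finite_hom_truncated Γ) (H.toTruncated l (H.Δ_mem l))

/-- The simple object of the Ringel dual: the head of the standard object. -/
def dualL (l : Γ) : TruncatedRingelDual hT Γ := head (dualΔ hT l)

end HighestWeightCategory

end

end HighestWeight

open HighestWeight

namespace HighestWeight

noncomputable section

attribute [local instance] Abelian.hasFiniteBiproducts HasExt.standard HasDerivedCategory.standard

open Abelian

/-! ### Vanishing and effaceability of Ext groups -/

section ExtVanishing

variable {C : Type u} [Category.{v} C] [Abelian C]

lemma shortExact_cokernel {X Y : C} (f : X ⟶ Y) [Mono f] :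
    (ShortComplex.mk f (cokernel.π f) (cokernel.condition f)).ShortExact where
  exact := ShortComplex.exact_of_g_is_cokernel _ (cokernelIsCokernel f)
  mono_f := inferInstance
  epi_g := inferInstance

lemma shortExact_kernel {X Y : C} (f : X ⟶ Y) [Epi f] :
    (ShortComplex.mk (kernel.ι f) f (kernel.condition f)).ShortExact where
  exact := ShortComplex.exact_of_f_is_kernel _ (kernelIsKernel f)
  mono_f := inferInstance
  epi_g := inferInstance

section

variable {S : ShortComplex C} (hS : S.ShortExact)
include hS

lemma subsingleton_ext_X₂_left {Y : C} {n : ℕ} (h₁ : Subsingleton (ExtGroup S.X₁ Y n))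
    (h₃ : Subsingleton (ExtGroup S.X₃ Y n)) : Subsingleton (ExtGroup S.X₂ Y n) :=
  subsingleton_of_forall_eq 0 fun x => by
    obtain ⟨y, rfl⟩ := Ext.contravariant_sequence_exact₂ hS Y x (Subsingleton.elim _ _)
    rw [Subsingleton.elim y 0, Ext.comp_zero]

lemma subsingleton_ext_X₂_right {X : C} {n : ℕ} (h₁ : Subsingleton (ExtGroup X S.X₁ n))
    (h₃ : Subsingleton (ExtGroup X S.X₃ n)) : Subsingleton (ExtGroup X S.X₂ n) :=
  subsingleton_of_forall_eq 0 fun x => by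
    obtain ⟨y, rfl⟩ := Ext.covariant_sequence_exact₂ X hS x (Subsingleton.elim _ _)
    rw [Subsingleton.elim y 0, Ext.zero_comp]

lemma exists_extension {Y : C} (h : Subsingleton (ExtGroup S.X₃ Y 1)) (f : S.X₁ ⟶ Y) :
    ∃ g : S.X₂ ⟶ Y, S.f ≫ g = f := by
  obtain ⟨x, hx⟩ := Ext.contravariant_sequence_exact₁ hS Y (Ext.mk₀ f) (add_zero 1)
    (Subsingleton.elim _ _)
  obtain ⟨g, rfl⟩ := (Ext.mk₀_bijective _ _).2 x
  exact ⟨g, (Ext.mk₀_bijective _ _).1 (by rw [← hx, Ext.mk₀_comp_mk₀])⟩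

lemma exists_lifting {X : C} (h : Subsingleton (ExtGroup X S.X₁ 1)) (f : X ⟶ S.X₃) :
    ∃ g : X ⟶ S.X₂, g ≫ S.g = f := by
  obtain ⟨x, hx⟩ := Ext.covariant_sequence_exact₃ X hS (Ext.mk₀ f) (zero_add 1)
    (Subsingleton.elim _ _)
  obtain ⟨g, rfl⟩ := (Ext.mk₀_bijective _ _).2 x
  exact ⟨g, (Ext.mk₀_bijective _ _).1 (by rw [← hx, Ext.mk₀_comp_mk₀])⟩

/-- `Ext¹(X, S.X₁)` vanishes if `Ext¹(X, S.X₂)` does and maps to `S.X₃` lift to `S.X₂`. -/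
lemma subsingleton_ext_X₁_of_lifting {X : C} (h₂ : Subsingleton (ExtGroup X S.X₂ 1))
    (h : ∀ f : X ⟶ S.X₃, ∃ g : X ⟶ S.X₂, g ≫ S.g = f) :
    Subsingleton (ExtGroup X S.X₁ 1) :=
  subsingleton_of_forall_eq 0 fun x => by
    obtain ⟨y, rfl⟩ := Ext.covariant_sequence_exact₁ X hS x (Subsingleton.elim _ _) (zero_add 1)
    obtain ⟨f, rfl⟩ := (Ext.mk₀_bijective _ _).2 y
    obtain ⟨g, rfl⟩ := h f
    rw [← Ext.mk₀_comp_mk₀, Ext.comp_assoc_of_second_deg_zero, hS.comp_extClass, Ext.comp_zero]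

/-- `Ext¹(S.X₃, Y)` vanishes if `Ext¹(S.X₂, Y)` does and maps on `S.X₁` extend to `S.X₂`. -/
lemma subsingleton_ext_X₃_of_extension {Y : C} (h₂ : Subsingleton (ExtGroup S.X₂ Y 1))
    (h : ∀ f : S.X₁ ⟶ Y, ∃ g : S.X₂ ⟶ Y, S.f ≫ g = f) :
    Subsingleton (ExtGroup S.X₃ Y 1) :=
  subsingleton_of_forall_eq 0 fun x => by
    obtain ⟨y, rfl⟩ := Ext.contravariant_sequence_exact₃ hS Y x (Subsingleton.elim _ _)
      (add_zero 1)
    obtain ⟨f, rfl⟩ := (Ext.mk₀_bijective _ _).2 y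
    obtain ⟨g, rfl⟩ := h f
    rw [← Ext.mk₀_comp_mk₀, hS.extClass_comp_assoc]

end

lemma subsingleton_ext_of_retract_left {X X' Y : C} {n : ℕ} (e : Retract X X')
    (h : Subsingleton (ExtGroup X' Y n)) : Subsingleton (ExtGroup X Y n) :=
  subsingleton_of_forall_eq 0 fun x => by
    rw [← Ext.mk₀_id_comp x, ← e.retract, ← Ext.mk₀_comp_mk₀_assoc,
      Subsingleton.elim ((Ext.mk₀ e.r).comp x _) 0, Ext.comp_zero]

lemma subsingleton_ext_of_retract_right {X Y Y' : C} {n : ℕ} (e : Retract Y Y')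
    (h : Subsingleton (ExtGroup X Y' n)) : Subsingleton (ExtGroup X Y n) :=
  subsingleton_of_forall_eq 0 fun x => by
    rw [← Ext.comp_mk₀_id x, ← e.retract, ← Ext.mk₀_comp_mk₀,
      ← Ext.comp_assoc_of_third_deg_zero, Subsingleton.elim (x.comp (Ext.mk₀ e.i) _) 0,
      Ext.zero_comp]

lemma subsingleton_ext_of_isZero_left {X Y : C} (hX : IsZero X) (n : ℕ) :
    Subsingleton (ExtGroup X Y n) :=
  subsingleton_of_forall_eq 0 fun x => by
    rw [← Ext.mk₀_id_comp x, hX.eq_of_src (𝟙 X) 0, Ext.mk₀_zero, Ext.zero_comp]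

lemma subsingleton_ext_of_isZero_right {X Y : C} (hY : IsZero Y) (n : ℕ) :
    Subsingleton (ExtGroup X Y n) :=
  subsingleton_of_forall_eq 0 fun x => by
    rw [← Ext.comp_mk₀_id x, hY.eq_of_src (𝟙 Y) 0, Ext.mk₀_zero, Ext.comp_zero]

lemma subsingleton_ext_of_iso_left {X X' Y : C} (e : X ≅ X') {n : ℕ}
    (h : Subsingleton (ExtGroup X' Y n)) : Subsingleton (ExtGroup X Y n) :=
  subsingleton_ext_of_retract_left (.ofIso e) h

lemma subsingleton_ext_of_iso_right {X Y Y' : C} (e : Y ≅ Y') {n : ℕ}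
    (h : Subsingleton (ExtGroup X Y' n)) : Subsingleton (ExtGroup X Y n) :=
  subsingleton_ext_of_retract_right (.ofIso e) h

/-- The complex with the object in degree `j`. -/
abbrev sg (C : Type u) [Category.{v} C] [Abelian C] (j : ℤ) : C ⥤ CochainComplex C ℤ :=
  HomologicalComplex.single C (ComplexShape.up ℤ) j

open DerivedCategory in
/-- `Ext`-groups are spaces of morphisms between single complexes in the derived category. -/
def extEquiv (R : Type*) [Ring R] [Linear R C] (X Y : C) (n : ℕ) (m : ℤ) (h : n + m = 0) :
    ExtGroup X Y n ≃ₗ[R] (Q.obj ((sg C 0).obj X) ⟶ Q.obj ((sg C m).obj Y)) :=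
  (Ext.homLinearEquiv (R := R)).trans
    (Linear.homCongr R (Iso.refl ((singleFunctor C 0).obj X))
      (((singleFunctors C).shiftIso n m 0 h).app Y))

open DerivedCategory in
lemma extEquiv_mk₀_comp (R : Type*) [Ring R] [Linear R C] {X X' Y : C} {n : ℕ} {m : ℤ}
    (h : n + m = 0) (p : X' ⟶ X) (x : ExtGroup X Y n) :
    extEquiv R X' Y n m h ((Ext.mk₀ p).comp x (zero_add _)) =
      Q.map ((sg C 0).map p) ≫ extEquiv R X Y n m h x := by
  change (𝟙 _ ≫ Ext.hom _) ≫ ((singleFunctors C).shiftIso n m 0 h).hom.app Y =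
    (singleFunctor C 0).map p ≫ ((𝟙 _ ≫ Ext.hom _) ≫ ((singleFunctors C).shiftIso n m 0 h).hom.app Y)
  rw [Ext.comp_hom, Ext.mk₀_hom, ShiftedHom.mk₀_comp, Category.id_comp, Category.id_comp,
    Category.assoc]

open DerivedCategory in
/-- Elements of `Ext`-groups in positive degrees are effaceable. -/
lemma exists_epi_comp_eq_zero {X Y : C} {n : ℕ} (x : ExtGroup X Y (n + 1)) :
    ∃ (X' : C) (p : X' ⟶ X) (_ : Epi p), (Ext.mk₀ p).comp x (zero_add _) = 0 := by
  let E := fun Z => extEquiv ℤ Z Y (n + 1) (-(n + 1)) (by lia)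
  -- The class is a roof with denominator `s`. Its restriction to the degree-zero cycles of `X'`
  -- vanishes, because `g` takes values in a complex concentrated in the negative degree -(n + 1).
  obtain ⟨X', s, hs, g, hφ⟩ := right_fac (E X x)
  rw [isIso_Q_map_iff_quasiIso] at hs
  let K := (sg C 0).obj X
  let u : (sg C 0).obj (X'.cycles 0) ⟶ X' :=
    HomologicalComplex.mkHomFromSingle (X'.iCycles 0) (by simp)
  let p : X'.cycles 0 ⟶ X := X'.iCycles 0 ≫ s.f 0 ≫ (HomologicalComplex.singleObjXSelf _ 0 X).hom
  have hus : u ≫ s = (sg C 0).map p := by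
    apply HomologicalComplex.from_single_hom_ext
    rw [HomologicalComplex.single_map_f_self]
    simp [u, p]
  have hug : u ≫ g = 0 := by
    apply HomologicalComplex.from_single_hom_ext
    apply (HomologicalComplex.isZero_single_obj_X _ _ _ _ _).eq_of_tgt
    lia
  refine ⟨_, p, ?_, (E _).injective ?_⟩
  · have h : p = HomologicalComplex.cyclesMap s 0 ≫
        (HomologicalComplex.singleObjCyclesSelfIso _ 0 X).hom := by
      simp [p, HomologicalComplex.singleObjCyclesSelfIso]
    -- Up to an isomorphism, `p` is the projection from cycles to homology followed by H⁰(s), and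
    -- H⁰(s) is invertible. Hence `p` is an epimorphism.
    have h₁ : p = X'.homologyπ 0 ≫ HomologicalComplex.homologyMap s 0 ≫
        (HomologicalComplex.singleObjHomologySelfIso _ 0 X).hom := by
      rw [h, ← HomologicalComplex.homologyπ_singleObjHomologySelfIso_hom,
        HomologicalComplex.homologyπ_naturality_assoc]
    rw [h₁]
    infer_instance
  · change E _ ((Ext.mk₀ p).comp x (zero_add _)) = _
    rw [extEquiv_mk₀_comp, hφ, ← hus, map_zero, Q.map_comp, Category.assoc,
      IsIso.hom_inv_id_assoc, ← Q.map_comp, hug, Q.map_zero]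

/-- Elements of `Ext`-groups in positive degrees come from extension classes. -/
lemma exists_extClass_comp {X Y : C} {n : ℕ} (x : ExtGroup X Y (n + 1)) :
    ∃ (N X' : C) (i : N ⟶ X') (p : X' ⟶ X) (w : i ≫ p = 0)
      (hS : (ShortComplex.mk i p w).ShortExact) (y : ExtGroup N Y n),
      hS.extClass.comp y (add_comm 1 n) = x := by
  obtain ⟨X', p, hp, h⟩ := exists_epi_comp_eq_zero x
  obtain ⟨y, hy⟩ := Ext.contravariant_sequence_exact₃ (shortExact_kernel p) Y x h (add_comm 1 n)
  exact ⟨_, _, _, _, _, shortExact_kernel p, y, hy⟩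

end ExtVanishing

/-! ### Filtered objects and Serre classes -/

section Filtration

variable {C : Type u} [Category.{v} C] [Abelian C]

/-- The kernels of two epimorphisms and of their composition form a short exact sequence. -/
lemma shortExact_kernel_comp {X Y Z : C} (f : X ⟶ Y) (g : Y ⟶ Z) [Epi f] :
    (ShortComplex.mk (kernel.lift (f ≫ g) (kernel.ι f) (by simp) : kernel f ⟶ kernel (f ≫ g))
      (kernel.lift g (kernel.ι (f ≫ g) ≫ f) (by simp))
      (by rw [← cancel_mono (kernel.ι g)]; simp)).ShortExact where
  mono_f := mono_of_mono_fac (kernel.lift_ι _ _ _)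
  epi_g := by
    rw [epi_iff_surjective_up_to_refinements]
    intro A y
    obtain ⟨A', p, hp, x, hx⟩ := surjective_up_to_refinements_of_epi f (y ≫ kernel.ι g)
    refine ⟨A', p, hp, kernel.lift _ x ?_, ?_⟩
    · rw [← Category.assoc, ← hx]
      simp
    · rw [← cancel_mono (kernel.ι g)]
      simpa using hx
  exact := by
    rw [ShortComplex.exact_iff_exact_up_to_refinements]
    intro A x hx
    refine ⟨A, 𝟙 A, inferInstance, kernel.lift f (x ≫ kernel.ι _) ?_, ?_⟩
    · have := hx =≫ kernel.ι g
      simpa using this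
    · rw [← cancel_mono (kernel.ι (f ≫ g))]
      simp

/-- The cokernels of two monomorphisms and of their composition form a short exact sequence. -/
lemma shortExact_cokernel_comp {X Y Z : C} (f : X ⟶ Y) (g : Y ⟶ Z) [Mono g] :
    (ShortComplex.mk
      (cokernel.desc f (g ≫ cokernel.π (f ≫ g)) (by
        rw [← Category.assoc, cokernel.condition]) : cokernel f ⟶ cokernel (f ≫ g))
      (cokernel.desc (f ≫ g) (cokernel.π g) (by simp))
      (by rw [← cancel_epi (cokernel.π f)]; simp)).ShortExact where
  epi_g := epi_of_epi_fac (cokernel.π_desc _ _ _)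
  mono_f := by
    refine Preadditive.mono_of_cancel_zero _ fun {A} x hx => ?_
    obtain ⟨A', p, hp, y, hy⟩ := surjective_up_to_refinements_of_epi (cokernel.π f) x
    have h : (y ≫ g) ≫ cokernel.π (f ≫ g) = 0 := by
      have := congrArg (fun t => p ≫ t) hx
      simp only [← Category.assoc, comp_zero] at this
      rw [hy] at this
      simpa using this
    obtain ⟨A'', p', hp', z, hz⟩ := (ShortComplex.exact_cokernel (f ≫ g)).exact_up_to_refinements _ h
    have hz' : p' ≫ y = z ≫ f := by
      rw [← cancel_mono g]
      simpa using hz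
    rw [← cancel_epi p, ← cancel_epi p', hy, reassoc_of% hz']
    simp
  exact := by
    refine ShortComplex.exact_of_g_is_cokernel _ (CokernelCofork.IsColimit.ofπ _ _
      (fun k hk => cokernel.desc g (cokernel.π (f ≫ g) ≫ k) ?_) (fun k hk => ?_) fun k hk m hm => ?_)
    · have := congrArg (fun t => cokernel.π f ≫ t) hk
      simpa using this
    · rw [← cancel_epi (cokernel.π (f ≫ g))]
      simp
    · rw [← cancel_epi (cokernel.π g)]
      simp [← hm]

lemma kernelIso_of_shortExact {S : ShortComplex C} (hS : S.ShortExact) :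
    Nonempty (S.X₁ ≅ kernel S.g) :=
  ⟨hS.fIsKernel.conePointUniqueUpToIso (limit.isLimit _)⟩

lemma cokernelIso_of_shortExact {S : ShortComplex C} (hS : S.ShortExact) :
    Nonempty (S.X₃ ≅ cokernel S.f) :=
  ⟨hS.gIsCokernel.coconePointUniqueUpToIso (colimit.isColimit _)⟩

/-- Transport of a short exact sequence along isomorphisms. -/
lemma shortExact_of_isos {X₁ X₂ X₃ : C} {S : ShortComplex C} (hS : S.ShortExact)
    (e₁ : S.X₁ ≅ X₁) (e₂ : S.X₂ ≅ X₂) (e₃ : S.X₃ ≅ X₃) :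
    (ShortComplex.mk (e₁.inv ≫ S.f ≫ e₂.hom) (e₂.inv ≫ S.g ≫ e₃.hom) (by simp)).ShortExact :=
  ShortComplex.shortExact_of_iso (ShortComplex.isoMk e₁ e₂ e₃ (by simp) (by simp)) hS

variable {Λ : Type w} {F : Λ → C}

lemma hasFiltration_of_iso {X Y : C} (e : X ≅ Y) {s : List Λ} (h : HasFiltration F X s) :
    HasFiltration F Y s := by
  cases h with
  | zero hX => exact .zero (hX.of_iso e.symm)
  | step S hS h₁ h₃ => exact .step _ (shortExact_of_isos hS (Iso.refl _) e (Iso.refl _)) h₁ h₃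

/-- Induction on the filtration of the quotient `B`: the preimage in `E` of its last proper step is
the kernel of `E` → `B` → top factor, and this kernel is again an extension by `A`. -/
lemma hasFiltration_extension {B : C} {t : List Λ} (hB : HasFiltration F B t) :
    ∀ {A E : C} (f : A ⟶ E) (g : E ⟶ B) (w : f ≫ g = 0) (_ : (ShortComplex.mk f g w).ShortExact)
      {s : List Λ} (_ : HasFiltration F A s), HasFiltration F E (t ++ s) := by
  induction hB with
  | zero hB =>
    intro A E f g w hS s hA
    have : IsIso f := (hS.isIso_f_iff).2 hB
    exact hasFiltration_of_iso (asIso f) hA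
  | step S hS' h₁ h₃ ih =>
    intro A E f g w hS s hA
    have := hS.epi_g
    have := hS'.epi_g
    obtain ⟨a⟩ := kernelIso_of_shortExact hS
    obtain ⟨b⟩ := kernelIso_of_shortExact hS'
    exact .step _ (shortExact_kernel (g ≫ S.g)) (ih _ _ _
      (shortExact_of_isos (shortExact_kernel_comp g S.g) a.symm (Iso.refl _) b.symm) hA) h₃

/-- Objects with a filtration whose subquotients are of the form `F i` with `i ∈ S`. -/
def filtered (F : Λ → C) (S : Set Λ) : ObjectProperty C := fun X =>
  ∃ s, HasFiltration F X s ∧ ∀ i ∈ s, i ∈ S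

lemma filtered_of_iso {S : Set Λ} {X Y : C} (e : X ≅ Y) (h : filtered F S X) : filtered F S Y := by
  obtain ⟨s, hs, hs'⟩ := h
  exact ⟨s, hasFiltration_of_iso e hs, hs'⟩

lemma filtered_mono {S S' : Set Λ} (hS : S ⊆ S') {X : C} (h : filtered F S X) :
    filtered F S' X := by
  obtain ⟨s, hs, hs'⟩ := h
  exact ⟨s, hs, fun i hi => hS (hs' i hi)⟩

lemma filtered_of_isZero (S : Set Λ) {X : C} (h : IsZero X) : filtered F S X :=
  ⟨[], .zero h, by simp⟩

lemma hasFiltration_singleton {X : C} {i : Λ} (e : X ≅ F i) : HasFiltration F X [i] :=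
  .step (ShortComplex.mk (0 : (0 : C) ⟶ X) (𝟙 X) (by simp))
    { exact := (ShortComplex.exact_iff_mono _ rfl).2 (by dsimp; infer_instance)
      mono_f := by dsimp; infer_instance
      epi_g := by dsimp; infer_instance } (.zero (isZero_zero C)) ⟨e⟩

lemma filtered_single {S : Set Λ} {i : Λ} (hi : i ∈ S) : filtered F S (F i) :=
  ⟨[i], hasFiltration_singleton (Iso.refl _), by simpa using hi⟩

lemma filtered_extension {S : Set Λ} {T : ShortComplex C} (hT : T.ShortExact)
    (h₁ : filtered F S T.X₁) (h₃ : filtered F S T.X₃) : filtered F S T.X₂ := by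
  obtain ⟨s, hs, hs'⟩ := h₁
  obtain ⟨t, ht, ht'⟩ := h₃
  refine ⟨t ++ s, hasFiltration_extension ht _ _ _ hT hs, fun i hi => ?_⟩
  rcases List.mem_append.1 hi with h | h
  exacts [ht' i h, hs' i h]

lemma shortExact_biprod (X Y : C) :
    (ShortComplex.mk (biprod.inl : X ⟶ X ⊞ Y) biprod.snd (by simp)).ShortExact :=
  (ShortComplex.Splitting.ofHasBinaryBiproduct X Y).shortExact

lemma filtered_biprod {S : Set Λ} {X Y : C} (hX : filtered F S X) (hY : filtered F S Y) :
    filtered F S (X ⊞ Y) :=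
  filtered_extension (shortExact_biprod X Y) hX hY

/-- An induction principle for filtered objects: a property that holds for zero objects and for
the `F i`, and is stable under extensions, holds for all filtered objects. -/
lemma filtered_induction {S : Set Λ} {P : C → Prop} (h₀ : ∀ X, IsZero X → P X)
    (hext : ∀ (T : ShortComplex C), T.ShortExact → filtered F S T.X₁ → filtered F S T.X₃ →
      P T.X₁ → P T.X₃ → P T.X₂)
    (hF : ∀ i ∈ S, ∀ X, (X ≅ F i) → P X) {X : C} (h : filtered F S X) : P X := by
  obtain ⟨s, hs, hs'⟩ := h
  induction hs with
  | zero hX => exact h₀ _ hX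
  | step T hT h₁ h₃ ih =>
    obtain ⟨e⟩ := h₃
    have hi := hs' _ List.mem_cons_self
    have hl : ∀ i ∈ _, i ∈ S := fun i h => hs' i (List.mem_cons_of_mem _ h)
    exact hext T hT ⟨_, h₁, hl⟩ (filtered_of_iso e.symm (filtered_single hi)) (ih hl)
      (hF _ hi _ e)

lemma filtered_induction_of_iso {S : Set Λ} {P : C → Prop} (h₀ : ∀ X, IsZero X → P X)
    (hiso : ∀ X Y, (X ≅ Y) → P X → P Y)
    (hext : ∀ (T : ShortComplex C), T.ShortExact → filtered F S T.X₁ → filtered F S T.X₃ →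
      P T.X₁ → P T.X₃ → P T.X₂)
    (hF : ∀ i ∈ S, P (F i)) {X : C} (h : filtered F S X) : P X :=
  filtered_induction h₀ hext (fun i hi _ e => hiso _ _ e.symm (hF i hi)) h

lemma subsingleton_ext_filtered_left {S : Set Λ} {X Y : C} {n : ℕ} (hX : filtered F S X)
    (h : ∀ i ∈ S, Subsingleton (ExtGroup (F i) Y n)) : Subsingleton (ExtGroup X Y n) :=
  filtered_induction (P := fun X => Subsingleton (ExtGroup X Y n))
    (fun _ hX => subsingleton_ext_of_isZero_left hX n)
    (fun _ hT _ _ h₁ h₃ => subsingleton_ext_X₂_left hT h₁ h₃)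
    (fun i hi _ e => subsingleton_ext_of_iso_left e (h i hi)) hX

lemma subsingleton_ext_filtered_right {S : Set Λ} {X Y : C} {n : ℕ} (hY : filtered F S Y)
    (h : ∀ i ∈ S, Subsingleton (ExtGroup X (F i) n)) : Subsingleton (ExtGroup X Y n) :=
  filtered_induction (P := fun Y => Subsingleton (ExtGroup X Y n))
    (fun _ hX => subsingleton_ext_of_isZero_right hX n)
    (fun _ hT _ _ h₁ h₃ => subsingleton_ext_X₂_right hT h₁ h₃)
    (fun i hi _ e => subsingleton_ext_of_iso_right e (h i hi)) hY

lemma prop_of_filtered {S : Set Λ} (P : ObjectProperty C) [P.IsSerreClass] {X : C}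
    (hX : filtered F S X) (h : ∀ i ∈ S, P (F i)) : P X :=
  filtered_induction (P := P) (fun _ hX => P.prop_of_isZero hX)
    (fun _ hT _ _ h₁ h₃ => P.prop_X₂_of_shortExact hT h₁ h₃)
    (fun i hi _ e => P.prop_of_iso e.symm (h i hi)) hX

lemma prop_of_hasFiltration (P : ObjectProperty C) [P.IsSerreClass] {X : C} {s : List Λ}
    (hX : HasFiltration F X s) (h : P X) : ∀ i ∈ s, P (F i) := by
  induction hX with
  | zero hX => simp
  | step S hS h₁ h₃ ih =>
    obtain ⟨e⟩ := h₃
    have := hS.mono_f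
    have := hS.epi_g
    intro i hi
    rcases List.mem_cons.1 hi with rfl | hi
    · exact P.prop_of_iso e (P.prop_of_epi S.g h)
    · exact ih (P.prop_of_mono S.f h) i hi

/-- The objects without subquotients that map nontrivially to `L`. -/
def noFactor (L : C) : ObjectProperty C := fun X =>
  ∀ (Z : C) (m : Z ⟶ X) (p : Z ⟶ L), Mono m → p = 0

/-- For `L = H.L i` this Serre class contains every other simple object but not `H.L i` itself, so
it detects whether `H.L i` lies in a truncation. -/
instance isSerreClass_noFactor (L : C) : (noFactor L).IsSerreClass where
  exists_zero := ⟨0, isZero_zero C, fun Z m p _ =>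
    (IsZero.of_mono m (isZero_zero C)).eq_of_src _ _⟩
  prop_of_mono f _ h := fun Z m p _ => h Z (m ≫ f) p inferInstance
  prop_of_epi f _ h := fun Z m p _ => by
    rw [← cancel_epi (pullback.snd f m), h _ (pullback.fst f m) (pullback.snd f m ≫ p) inferInstance,
      comp_zero]
  prop_X₂_of_shortExact {S} hS h₁ h₃ := fun Z m p _ => by
    have := hS.mono_f
    -- The kernel of `e` is the part of `Z` inside `S.X₁`; `p` vanishes on it and descends to the
    -- image of `Z` in `S.X₃`, where it vanishes too.
    let e := factorThruImage (m ≫ S.g)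
    have h : (kernel.ι e ≫ m) ≫ S.g = 0 := by
      have h₀ : e ≫ Limits.image.ι (m ≫ S.g) = m ≫ S.g := Limits.image.fac _
      rw [Category.assoc]
      exact (congrArg (kernel.ι e ≫ ·) h₀.symm).trans (by simp)
    have : Mono (hS.exact.lift _ h) := mono_of_mono_fac (hS.exact.lift_f _ h)
    have h' : kernel.ι e ≫ p = 0 := h₁ _ (hS.exact.lift _ h) _ inferInstance
    have := (shortExact_kernel e).epi_g
    have h'' := (shortExact_kernel e).exact.g_desc p h'
    rw [h₃ _ (Limits.image.ι (m ≫ S.g)) ((shortExact_kernel e).exact.desc p h') inferInstance,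
      comp_zero] at h''
    exact h''.symm

end Filtration

namespace HighestWeightCategory

variable {𝕜 : Type v} [Field 𝕜] {C : Type u} [Category.{v} C] [Abelian C] [Linear 𝕜 C]
  {Λ : Type w} [PartialOrder Λ] (H : HighestWeightCategory 𝕜 C Λ)

lemma noFactor_simple {i j : Λ} (h : i ≠ j) : noFactor (H.L i) (H.L j) := fun Z m p _ => by
  have := H.simple i
  have := H.simple j
  by_contra hp
  have hm : m ≠ 0 := by
    rintro rfl
    exact hp ((IsZero.of_mono_zero Z (H.L j)).eq_of_src _ _)
  have := isIso_of_mono_of_nonzero hm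
  have h₁ : inv m ≫ p ≠ 0 := fun h₀ => hp (by rw [← cancel_epi (inv m), h₀, comp_zero])
  have := isIso_of_hom_simple h₁
  exact h (H.eq_of_iso _ _ ⟨(asIso (inv m ≫ p)).symm⟩)

lemma mem_of_trunc_simple {Γ : Set Λ} {i : Λ} (h : trunc H.L Γ (H.L i)) : i ∈ Γ := by
  by_contra hi
  have := H.simple i
  have := h (noFactor (H.L i)) inferInstance
    (fun j hj => H.noFactor_simple (by rintro rfl; exact hi hj)) (H.L i) (𝟙 _) (𝟙 _) inferInstance
  exact id_nonzero _ this

lemma trunc_iff {Γ : Set Λ} {X : C} : trunc H.L Γ X ↔ filtered H.L Γ X := by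
  constructor
  · intro h
    obtain ⟨s, hs⟩ := H.finiteLength X
    exact ⟨s, hs, fun i hi => H.mem_of_trunc_simple (prop_of_hasFiltration _ hs h i hi)⟩
  · intro h
    exact prop_of_filtered _ h fun i hi => trunc_gen _ _ hi

end HighestWeightCategory

/-! ### Dimensions of Hom spaces along filtrations -/

section Dimension

variable {𝕜 : Type v} [Field 𝕜]

lemma finrank_of_exact {U V W : Type*} [AddCommGroup U] [AddCommGroup V] [AddCommGroup W]
    [Module 𝕜 U] [Module 𝕜 V] [Module 𝕜 W] [Module.Finite 𝕜 V] (f : U →ₗ[𝕜] V) (g : V →ₗ[𝕜] W)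
    (hf : Function.Injective f) (hg : Function.Surjective g) (h : Function.Exact f g) :
    Module.finrank 𝕜 V = Module.finrank 𝕜 U + Module.finrank 𝕜 W := by
  rw [← LinearMap.finrank_range_add_finrank_ker g, LinearMap.range_eq_top.2 hg,
    finrank_top, LinearMap.exact_iff.1 h, LinearMap.finrank_range_of_inj hf, add_comm]

variable {C : Type u} [Category.{v} C] [Abelian C] [Linear 𝕜 C] {Λ : Type w} {F : Λ → C}

lemma finrank_hom_of_shortExact_right {Y : C} {S : ShortComplex C} (hS : S.ShortExact)
    (h : Subsingleton (ExtGroup Y S.X₁ 1)) [Module.Finite 𝕜 (Y ⟶ S.X₂)] :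
    Module.finrank 𝕜 (Y ⟶ S.X₂) = Module.finrank 𝕜 (Y ⟶ S.X₁) + Module.finrank 𝕜 (Y ⟶ S.X₃) := by
  have := hS.mono_f
  refine finrank_of_exact (Linear.rightComp 𝕜 Y S.f) (Linear.rightComp 𝕜 Y S.g)
    (fun a b hab => (cancel_mono S.f).1 hab) (exists_lifting hS h) fun g => ⟨fun hg => ?_, ?_⟩
  · exact ⟨hS.exact.lift g hg, hS.exact.lift_f g hg⟩
  · rintro ⟨a, rfl⟩
    simp

lemma finrank_hom_of_shortExact_left {Y : C} {S : ShortComplex C} (hS : S.ShortExact)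
    (h : Subsingleton (ExtGroup S.X₃ Y 1)) [Module.Finite 𝕜 (S.X₂ ⟶ Y)] :
    Module.finrank 𝕜 (S.X₂ ⟶ Y) = Module.finrank 𝕜 (S.X₁ ⟶ Y) + Module.finrank 𝕜 (S.X₃ ⟶ Y) := by
  have := hS.epi_g
  rw [add_comm]
  refine finrank_of_exact (Linear.leftComp 𝕜 Y S.g) (Linear.leftComp 𝕜 Y S.f)
    (fun a b hab => (cancel_epi S.g).1 hab) (exists_extension hS h) fun g => ⟨fun hg => ?_, ?_⟩
  · exact ⟨hS.exact.desc g hg, hS.exact.g_desc g hg⟩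
  · rintro ⟨a, rfl⟩
    simp

lemma finrank_hom_filtration_right (hfin : ∀ X Y : C, Module.Finite 𝕜 (X ⟶ Y)) {X Y : C}
    {l : List Λ} (hX : HasFiltration F X l) (h : ∀ i ∈ l, Subsingleton (ExtGroup Y (F i) 1)) :
    Module.finrank 𝕜 (Y ⟶ X) = (l.map fun i => Module.finrank 𝕜 (Y ⟶ F i)).sum := by
  induction hX with
  | zero hX =>
    have : Subsingleton (Y ⟶ _) := ⟨fun f g => hX.eq_of_tgt f g⟩
    simpa using Module.finrank_zero_of_subsingleton
  | step S hS h₁ h₃ ih =>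
    rename_i i l
    have hl : ∀ i ∈ l, Subsingleton (ExtGroup Y (F i) 1) :=
      fun i hi => h i (List.mem_cons_of_mem _ hi)
    obtain ⟨e⟩ := h₃
    have := hfin Y S.X₂
    rw [finrank_hom_of_shortExact_right hS (subsingleton_ext_filtered_right (S := {i | i ∈ l})
      ⟨_, h₁, fun _ hi => hi⟩ hl), ih hl, List.map_cons, List.sum_cons, add_comm,
      (Linear.homCongr 𝕜 (Iso.refl Y) e).finrank_eq]

lemma finrank_hom_filtration_left (hfin : ∀ X Y : C, Module.Finite 𝕜 (X ⟶ Y)) {X Y : C}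
    {l : List Λ} (hX : HasFiltration F X l) (h : ∀ i ∈ l, Subsingleton (ExtGroup (F i) Y 1)) :
    Module.finrank 𝕜 (X ⟶ Y) = (l.map fun i => Module.finrank 𝕜 (F i ⟶ Y)).sum := by
  induction hX with
  | zero hX =>
    have : Subsingleton (_ ⟶ Y) := ⟨fun f g => hX.eq_of_src f g⟩
    simpa using Module.finrank_zero_of_subsingleton
  | step S hS h₁ h₃ ih =>
    obtain ⟨e⟩ := h₃
    have := hfin S.X₂ Y
    rw [finrank_hom_of_shortExact_left hS (subsingleton_ext_of_iso_left e
      (h _ List.mem_cons_self)), ih fun i hi => h i (List.mem_cons_of_mem _ hi), List.map_cons,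
      List.sum_cons, add_comm, (Linear.homCongr 𝕜 e (Iso.refl Y)).finrank_eq]

lemma hom_eq_zero_of_filtered_right {S : Set Λ} {X Y : C} (hX : filtered F S X)
    (h : ∀ i ∈ S, ∀ f : Y ⟶ F i, f = 0) (f : Y ⟶ X) : f = 0 := by
  revert f
  refine filtered_induction (P := fun X => ∀ f : Y ⟶ X, f = 0)
    (fun X hX f => hX.eq_of_tgt _ _) (fun T hT _ _ h₁ h₃ f => ?_)
    (fun i hi X e f => by rw [← cancel_mono e.hom, h i hi (f ≫ e.hom), zero_comp]) hX
  have := hT.mono_f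
  rw [← hT.exact.lift_f f (h₃ _), h₁ (hT.exact.lift f _), zero_comp]

lemma hom_eq_zero_of_filtered_left {S : Set Λ} {X Y : C} (hX : filtered F S X)
    (h : ∀ i ∈ S, ∀ f : F i ⟶ Y, f = 0) (f : X ⟶ Y) : f = 0 := by
  revert f
  refine filtered_induction (P := fun X => ∀ f : X ⟶ Y, f = 0)
    (fun X hX f => hX.eq_of_src _ _) (fun T hT _ _ h₁ h₃ f => ?_)
    (fun i hi X e f => by rw [← cancel_epi e.inv, h i hi (e.inv ≫ f), comp_zero]) hX
  have := hT.epi_g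
  rw [← hT.exact.g_desc f (h₁ _), h₃ (hT.exact.desc f _), comp_zero]

end Dimension

/-! ### Monomorphisms and epimorphisms in Serre subcategories -/

section FullSubcategory

variable {C : Type u} [Category.{v} C] [Abelian C] (P : ObjectProperty C) [P.IsSerreClass]

lemma epi_of_epi_fullSubcategory {X Y : P.FullSubcategory} (f : X ⟶ Y) [Epi f] : Epi f.hom := by
  let Z : P.FullSubcategory := ⟨cokernel f.hom, P.prop_of_epi (cokernel.π _) Y.property⟩
  let k : Y ⟶ Z := ObjectProperty.homMk (cokernel.π f.hom)
  have h : k = 0 := by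
    rw [← cancel_epi f, comp_zero]
    exact ObjectProperty.hom_ext _ (cokernel.condition f.hom)
  exact Preadditive.epi_of_cokernel_zero (congrArg (fun k => k.hom) h)

lemma mono_of_mono_fullSubcategory {X Y : P.FullSubcategory} (f : X ⟶ Y) [Mono f] :
    Mono f.hom := by
  let Z : P.FullSubcategory := ⟨kernel f.hom, P.prop_of_mono (kernel.ι _) X.property⟩
  let k : Z ⟶ X := ObjectProperty.homMk (kernel.ι f.hom)
  have h : k = 0 := by
    rw [← cancel_mono f, zero_comp]
    exact ObjectProperty.hom_ext _ (kernel.condition f.hom)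
  exact Preadditive.mono_of_kernel_zero (congrArg (fun k => k.hom) h)

end FullSubcategory

/-! ### Maps and extensions between standard, costandard and simple objects -/

namespace HighestWeightCategory

variable {𝕜 : Type v} [Field 𝕜] {C : Type u} [Category.{v} C] [Abelian C] [Linear 𝕜 C]
  {Λ : Type w} [PartialOrder Λ] (H : HighestWeightCategory 𝕜 C Λ)

instance (l : Λ) : Simple (H.L l) := H.simple l

instance epi_π (l : Λ) : Epi (H.π l) := by
  have := (H.isProjectiveCover l).epi
  exact epi_of_epi_fullSubcategory _ (ObjectProperty.homMk (P := trunc H.L (Set.Iic l))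
    (X := ⟨H.Δ l, H.Δ_mem l⟩) (Y := ⟨H.L l, trunc_gen H.L _ le_rfl⟩) (H.π l))

instance mono_ι (l : Λ) : Mono (H.ι l) := by
  have := (H.isInjectiveHull l).mono
  exact mono_of_mono_fullSubcategory _ (ObjectProperty.homMk (P := trunc H.L (Set.Iic l))
    (X := ⟨H.L l, trunc_gen H.L _ le_rfl⟩) (Y := ⟨H.nabla l, H.nabla_mem l⟩) (H.ι l))

lemma Δ_lift {l : Λ} {X Y : C} (hX : trunc H.L (Set.Iic l) X) (g : X ⟶ Y) [Epi g]
    (f : H.Δ l ⟶ Y) : ∃ h : H.Δ l ⟶ X, h ≫ g = f := by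
  have := (H.isProjectiveCover l).projective
  let P := trunc H.L (Set.Iic l)
  let X' : P.FullSubcategory := ⟨X, hX⟩
  let Y' : P.FullSubcategory := ⟨Y, P.prop_of_epi g hX⟩
  let D : P.FullSubcategory := ⟨H.Δ l, H.Δ_mem l⟩
  let g' : X' ⟶ Y' := ObjectProperty.homMk g
  let f' : D ⟶ Y' := ObjectProperty.homMk f
  have : Epi g' := P.ι.epi_of_epi_map (show Epi g from inferInstance)
  exact ⟨(Projective.factorThru f' g').hom,
    congrArg (fun k => k.hom) (Projective.factorThru_comp f' g')⟩

lemma nabla_ext {l : Λ} {X Y : C} (hX : trunc H.L (Set.Iic l) X) (g : Y ⟶ X) [Mono g]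
    (f : Y ⟶ H.nabla l) : ∃ h : X ⟶ H.nabla l, g ≫ h = f := by
  have := (H.isInjectiveHull l).injective
  let P := trunc H.L (Set.Iic l)
  let X' : P.FullSubcategory := ⟨X, hX⟩
  let Y' : P.FullSubcategory := ⟨Y, P.prop_of_mono g hX⟩
  let D : P.FullSubcategory := ⟨H.nabla l, H.nabla_mem l⟩
  let g' : Y' ⟶ X' := ObjectProperty.homMk g
  let f' : Y' ⟶ D := ObjectProperty.homMk f
  have : Mono g' := P.ι.mono_of_mono_map (show Mono g from inferInstance)
  exact ⟨(Injective.factorThru f' g').hom,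
    congrArg (fun k => k.hom) (Injective.comp_factorThru f' g')⟩

lemma epi_of_comp_π {l : Λ} {X : C} (hX : trunc H.L (Set.Iic l) X) (f : X ⟶ H.Δ l)
    (h : f ≫ H.π l ≠ 0) : Epi f := by
  let P := trunc H.L (Set.Iic l)
  let X' : P.FullSubcategory := ⟨X, hX⟩
  let Y' : P.FullSubcategory := ⟨H.L l, trunc_gen H.L _ le_rfl⟩
  let D : P.FullSubcategory := ⟨H.Δ l, H.Δ_mem l⟩
  let f' : X' ⟶ D := ObjectProperty.homMk f
  have := epi_of_nonzero_to_simple h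
  have := (H.isProjectiveCover l).superfluous f' (P.ι.epi_of_epi_map
    (show Epi (f ≫ H.π l) from inferInstance))
  exact epi_of_epi_fullSubcategory P f'

lemma mono_of_ι_comp {l : Λ} {X : C} (hX : trunc H.L (Set.Iic l) X) (f : H.nabla l ⟶ X)
    (h : H.ι l ≫ f ≠ 0) : Mono f := by
  let P := trunc H.L (Set.Iic l)
  let X' : P.FullSubcategory := ⟨X, hX⟩
  let Y' : P.FullSubcategory := ⟨H.L l, trunc_gen H.L _ le_rfl⟩
  let D : P.FullSubcategory := ⟨H.nabla l, H.nabla_mem l⟩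
  let f' : D ⟶ X' := ObjectProperty.homMk f
  have := mono_of_nonzero_from_simple h
  have := (H.isInjectiveHull l).essential f' (P.ι.mono_of_mono_map
    (show Mono (H.ι l ≫ f) from inferInstance))
  exact mono_of_mono_fullSubcategory P f'

/-- Every nonzero quotient of `Δ l` has `L l` as a quotient. -/
lemma π_factors {l : Λ} {X : C} (f : H.Δ l ⟶ X) (hf : f ≠ 0) [Epi f] :
    ∃ g : X ⟶ H.L l, f ≫ g = H.π l := by
  have h : kernel.ι f ≫ H.π l = 0 := by
    by_contra h
    have := H.epi_of_comp_π ((trunc H.L _).prop_of_mono (kernel.ι f) (H.Δ_mem l)) _ h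
    exact hf (by rw [← cancel_epi (kernel.ι f), kernel.condition, comp_zero])
  have := (shortExact_kernel f).epi_g
  exact ⟨(shortExact_kernel f).exact.desc _ h, (shortExact_kernel f).exact.g_desc _ h⟩

lemma ι_factors {l : Λ} {X : C} (f : X ⟶ H.nabla l) (hf : f ≠ 0) [Mono f] :
    ∃ g : H.L l ⟶ X, g ≫ f = H.ι l := by
  have h : H.ι l ≫ cokernel.π f = 0 := by
    by_contra h
    have := H.mono_of_ι_comp ((trunc H.L _).prop_of_epi (cokernel.π f) (H.nabla_mem l)) _ h
    exact hf (by rw [← cancel_mono (cokernel.π f), cokernel.condition, zero_comp])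
  have := (shortExact_cokernel f).mono_f
  exact ⟨(shortExact_cokernel f).exact.lift _ h, (shortExact_cokernel f).exact.lift_f _ h⟩

lemma π_ne_zero (l : Λ) : H.π l ≠ 0 := fun h =>
  id_nonzero (H.L l) (by rw [← cancel_epi (H.π l), h, zero_comp, zero_comp])

lemma π_ι_ne_zero (l : Λ) : H.π l ≫ H.ι l ≠ 0 := fun h =>
  H.π_ne_zero l (by rw [← cancel_mono (H.ι l), h, zero_comp])

lemma hom_L_eq_zero {i j : Λ} (h : i ≠ j) (f : H.L i ⟶ H.L j) : f = 0 := by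
  by_contra hf
  have := isIso_of_hom_simple hf
  exact h (H.eq_of_iso _ _ ⟨asIso f⟩)

lemma hom_Δ_L_eq_zero {i j : Λ} (h : i ≠ j) (f : H.Δ i ⟶ H.L j) : f = 0 := by
  by_contra hf
  have := epi_of_nonzero_to_simple hf
  obtain ⟨g, hg⟩ := H.π_factors f hf
  exact H.π_ne_zero i (by rw [← hg, H.hom_L_eq_zero h.symm g, comp_zero])

lemma hom_L_nabla_eq_zero {i j : Λ} (h : i ≠ j) (f : H.L i ⟶ H.nabla j) : f = 0 := by
  by_contra hf
  have := mono_of_nonzero_from_simple hf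
  obtain ⟨g, hg⟩ := H.ι_factors f hf
  exact H.π_ι_ne_zero j (by rw [← hg, H.hom_L_eq_zero h.symm g, zero_comp, comp_zero])

lemma hom_Δ_eq_zero {i : Λ} {Γ : Set Λ} {X : C} (hX : trunc H.L Γ X) (hi : i ∉ Γ)
    (f : H.Δ i ⟶ X) : f = 0 :=
  hom_eq_zero_of_filtered_right (H.trunc_iff.1 hX)
    (fun j hj f => H.hom_Δ_L_eq_zero (by rintro rfl; exact hi hj) f) f

lemma hom_nabla_eq_zero {i : Λ} {Γ : Set Λ} {X : C} (hX : trunc H.L Γ X) (hi : i ∉ Γ)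
    (f : X ⟶ H.nabla i) : f = 0 :=
  hom_eq_zero_of_filtered_left (H.trunc_iff.1 hX)
    (fun j hj f => H.hom_L_nabla_eq_zero (by rintro rfl; exact hi hj) f) f

lemma hom_Δ_nabla_eq_zero {i j : Λ} (h : i ≠ j) (f : H.Δ i ⟶ H.nabla j) : f = 0 := by
  by_cases hij : i ≤ j
  · exact H.hom_nabla_eq_zero (H.Δ_mem i) (fun hji => h (hij.antisymm hji)) f
  · exact H.hom_Δ_eq_zero (H.nabla_mem j) hij f

lemma hom_Δ_nabla_eq_smul {l : Λ} (f : H.Δ l ⟶ H.nabla l) : ∃ r : 𝕜, f = r • (H.π l ≫ H.ι l) := by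
  obtain ⟨e⟩ := H.hom_Δ_nabla l
  have h : e (H.π l ≫ H.ι l) ≠ 0 := fun h => H.π_ι_ne_zero l (e.injective (by simpa using h))
  refine ⟨e f / e (H.π l ≫ H.ι l), e.injective ?_⟩
  rw [map_smul, smul_eq_mul, div_mul_cancel₀ _ h]

lemma hom_Δ_L_eq_smul {l : Λ} (f : H.Δ l ⟶ H.L l) : ∃ r : 𝕜, f = r • H.π l := by
  obtain ⟨r, hr⟩ := H.hom_Δ_nabla_eq_smul (f ≫ H.ι l)
  exact ⟨r, by rw [← cancel_mono (H.ι l), hr, Linear.smul_comp]⟩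

lemma hom_L_nabla_eq_smul {l : Λ} (f : H.L l ⟶ H.nabla l) : ∃ r : 𝕜, f = r • H.ι l := by
  obtain ⟨r, hr⟩ := H.hom_Δ_nabla_eq_smul (H.π l ≫ f)
  exact ⟨r, by rw [← cancel_epi (H.π l), hr, Linear.comp_smul]⟩

/-- Embed `L j` in `nabla j` and use Ext¹(Δ i, nabla j) = 0: it remains to lift maps from `Δ i` to
the cokernel. For `i = j` this is projectivity in the truncation at `j`; otherwise `i` is not at
most `j` and there are no nonzero maps. -/
lemma subsingleton_ext_Δ_L {i j : Λ} (h : ¬ i < j) : Subsingleton (ExtGroup (H.Δ i) (H.L j) 1) := by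
  refine subsingleton_ext_X₁_of_lifting (shortExact_cokernel (H.ι j)) (H.ext_one i j) fun f => ?_
  rcases eq_or_ne i j with rfl | hij
  · exact H.Δ_lift (H.nabla_mem i) _ f
  · refine ⟨0, ?_⟩
    rw [zero_comp, H.hom_Δ_eq_zero ((trunc H.L _).prop_of_epi (cokernel.π (H.ι j)) (H.nabla_mem j))
      (fun hi => h (lt_of_le_of_ne hi hij)) f]

lemma subsingleton_ext_L_nabla {i j : Λ} (h : ¬ i < j) :
    Subsingleton (ExtGroup (H.L j) (H.nabla i) 1) := by
  refine subsingleton_ext_X₃_of_extension (shortExact_kernel (H.π j)) (H.ext_one j i) fun f => ?_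
  rcases eq_or_ne i j with rfl | hij
  · exact H.nabla_ext (H.Δ_mem i) _ f
  · refine ⟨0, ?_⟩
    rw [comp_zero, H.hom_nabla_eq_zero ((trunc H.L _).prop_of_mono (kernel.ι (H.π j)) (H.Δ_mem j))
      (fun hi => h (lt_of_le_of_ne hi hij)) f]

variable {l : Λ} {X : C}

lemma subsingleton_ext_Δ (hX : trunc H.L {k | ¬ l < k} X) :
    Subsingleton (ExtGroup (H.Δ l) X 1) :=
  subsingleton_ext_filtered_right (H.trunc_iff.1 hX) fun _ => H.subsingleton_ext_Δ_L

lemma subsingleton_ext_nabla (hX : trunc H.L {k | ¬ l < k} X) :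
    Subsingleton (ExtGroup X (H.nabla l) 1) :=
  subsingleton_ext_filtered_left (H.trunc_iff.1 hX) fun _ => H.subsingleton_ext_L_nabla

/-- If no weight of `X` is bigger than `l`, then the composition pairing between `Hom(Δ l, X)` and
`Hom(X, nabla l)` is nondegenerate. -/
lemma exists_to_nabla (hX : trunc H.L {k | ¬ l < k} X) (f : H.Δ l ⟶ X) (hf : f ≠ 0) :
    ∃ g : X ⟶ H.nabla l, f ≫ g = H.π l ≫ H.ι l := by
  have hf' : factorThruImage f ≠ 0 := fun h =>
    hf (by rw [← Limits.image.fac f, h, zero_comp])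
  -- The image of `f` is a nonzero quotient of `Δ l`, so it maps onto `L l`. The composite to `nabla
  -- l` extends to `X`, since the cokernel of the image has no Ext¹ into `nabla l`.
  obtain ⟨p, hp⟩ := H.π_factors _ hf'
  obtain ⟨g, hg⟩ := exists_extension (shortExact_cokernel (Limits.image.ι f))
    (H.subsingleton_ext_nabla ((trunc H.L _).prop_of_epi (cokernel.π _) hX)) (p ≫ H.ι l)
  refine ⟨g, ?_⟩
  dsimp at hg
  rw [← Limits.image.fac f, Category.assoc, hg, reassoc_of% hp]

lemma exists_from_Δ (hX : trunc H.L {k | ¬ l < k} X) (g : X ⟶ H.nabla l) (hg : g ≠ 0) :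
    ∃ f : H.Δ l ⟶ X, f ≫ g = H.π l ≫ H.ι l := by
  have hg' : Limits.image.ι g ≠ 0 := fun h =>
    hg (by rw [← Limits.image.fac g, h, comp_zero])
  obtain ⟨p, hp⟩ := H.ι_factors _ hg'
  obtain ⟨f, hf⟩ := exists_lifting (shortExact_kernel (factorThruImage g))
    (H.subsingleton_ext_Δ ((trunc H.L _).prop_of_mono (kernel.ι _) hX)) (H.π l ≫ p)
  refine ⟨f, ?_⟩
  dsimp at hf
  rw [← Limits.image.fac g, ← Category.assoc, hf, Category.assoc, hp]

end HighestWeightCategory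

/-! ### Fitting's lemma and retracts -/

section Fitting

/-- A non-nilpotent element of a finite-dimensional algebra divides a nonzero idempotent. -/
lemma isNilpotent_or_exists_idempotent (𝕜 : Type*) [Field 𝕜] {E : Type*} [Ring E] [Algebra 𝕜 E]
    [Module.Finite 𝕜 E] (c : E) :
    IsNilpotent c ∨ ∃ e p : E, e ≠ 0 ∧ e * e = e ∧ c * p = e ∧ p * c = e := by
  -- The algebra generated by `c` is commutative and Artinian, so powers stabilise: x^n = x^(n+1) y
  -- for some n and y. Then (xy)^(n+1) is an idempotent multiple of `x`, and if it is zero then x^n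
  -- = 0.
  let S := Algebra.adjoin 𝕜 {c}
  let x : S := ⟨c, Algebra.subset_adjoin rfl⟩
  have : IsMulCommutative S := Algebra.isMulCommutative_adjoin 𝕜 (by
    rintro a rfl b rfl
    rfl)
  let _ : CommRing S := inferInstance
  have : Module.Finite 𝕜 S := inferInstanceAs (Module.Finite 𝕜 (Subalgebra.toSubmodule S))
  have : IsArtinianRing S := isArtinian_of_tower 𝕜 inferInstance
  obtain ⟨n, y, hy⟩ := IsArtinian.exists_pow_succ_smul_dvd x (1 : S)
  have h₁ : x ^ n * (x * y) = x ^ n := by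
    simp only [smul_eq_mul, mul_one] at hy
    rw [← mul_assoc, ← pow_succ]
    exact hy
  have h₂ : ∀ m, x ^ n * (x * y) ^ m = x ^ n := fun m => by
    induction m with
    | zero => simp
    | succ m ih => rw [pow_succ, ← mul_assoc, ih, h₁]
  let e := (x * y) ^ (n + 1)
  by_cases he : e = 0
  · left
    have h₃ := h₂ (n + 1)
    rw [show (x * y) ^ (n + 1) = 0 from he, mul_zero] at h₃
    exact ⟨n, by simpa using (congrArg Subtype.val h₃).symm⟩
  · right
    have hee : e * e = e := by
      have : e = y ^ (n + 1) * x * x ^ n := by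
        simp only [e]
        ring
      nth_rw 1 [this]
      rw [mul_assoc, h₂]
      exact this.symm
    have hep : x * (y * (x * y) ^ n) = e := by
      simp only [e]
      ring
    have hpe : (y * (x * y) ^ n) * x = e := by
      rw [mul_comm, hep]
    exact ⟨e, (y * (x * y) ^ n : S), fun h => he (Subtype.ext h), congrArg Subtype.val hee,
      congrArg Subtype.val hep, congrArg Subtype.val hpe⟩

variable {C : Type u} [Category.{v} C] [Abelian C]

lemma retractIsoBiprod {W X : C} (h : Retract W X) : Nonempty (X ≅ kernel h.r ⊞ W) :=
  ⟨(ShortComplex.Splitting.ofExactOfSection (.mk _ _ (kernel.condition h.r))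
    (shortExact_kernel h.r).exact h.i h.retract inferInstance).isoBinaryBiproduct⟩

lemma isIso_of_retract {W X : C} (h : Retract W X) (hX : Indecomposable X) (hW : ¬ IsZero W) :
    IsIso h.r := by
  obtain ⟨e⟩ := retractIsoBiprod h
  have h₀ : IsZero (kernel h.r) := (hX.2 _ _ e).resolve_right hW
  have : Mono h.r := Preadditive.mono_of_isZero_kernel _ h₀
  exact isIso_of_mono_of_epi _

/-- The retract given by an idempotent. -/
def retractOfIdempotent {X : C} (e : X ⟶ X) (h : e ≫ e = e) : Retract (Limits.image e) X where
  i := Limits.image.ι e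
  r := factorThruImage e
  retract := by
    rw [← cancel_mono (Limits.image.ι e), ← cancel_epi (factorThruImage e)]
    simp [h]

variable {𝕜 : Type v} [Field 𝕜] [Linear 𝕜 C]

lemma not_isZero_image {X Y : C} {f : X ⟶ Y} (hf : f ≠ 0) : ¬ IsZero (Limits.image f) :=
  fun h => hf (by rw [← Limits.image.fac f, h.eq_of_src (Limits.image.ι f) 0, comp_zero])

/-- Fitting's lemma. -/
lemma isNilpotent_or_isIso (𝕜 : Type v) [Field 𝕜] [Linear 𝕜 C] {X : C} [Module.Finite 𝕜 (X ⟶ X)]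
    (hX : Indecomposable X) (c : End X) : IsNilpotent c ∨ IsIso (c : X ⟶ X) := by
  have : Module.Finite 𝕜 (End X) := inferInstanceAs (Module.Finite 𝕜 (X ⟶ X))
  refine (isNilpotent_or_exists_idempotent 𝕜 c).imp_right ?_
  rintro ⟨e, p, he, hee, hcp, hpc⟩
  let e' : X ⟶ X := e
  let c' : X ⟶ X := c
  let p' : X ⟶ X := p
  have : IsIso (factorThruImage e') :=
    isIso_of_retract (retractOfIdempotent e' hee) hX (not_isZero_image he)
  have h₁ : e' = 𝟙 X := by
    have : IsIso (Limits.image.ι e') := by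
      have h := (retractOfIdempotent e' hee).retract
      change Limits.image.ι e' ≫ factorThruImage e' = 𝟙 _ at h
      rw [← IsIso.eq_comp_inv, Category.id_comp] at h
      rw [h]
      infer_instance
    have : IsIso e' := by
      rw [← Limits.image.fac e']
      infer_instance
    rw [← cancel_mono e', Category.id_comp]
    exact hee
  exact ⟨p', (show c' ≫ p' = e' from hpc).trans h₁, (show p' ≫ c' = e' from hcp).trans h₁⟩

end Fitting

lemma sum_map_ite_eq_count {Λ : Type*} (s : List Λ) (l : Λ) [DecidableEq Λ] :
    (s.map fun i => if i = l then 1 else 0).sum = s.count l := by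
  induction s with
  | nil => rfl
  | cons a s ih => rw [List.map_cons, List.sum_cons, ih, List.count_cons, add_comm]; simp

section ShortExact

variable {C : Type u} [Category.{v} C] [Abelian C] {S : ShortComplex C} (hS : S.ShortExact)
include hS

/-- Up to the isomorphism `f ≫ S.g`, the map `f` is a section of `S.g`, so `S.X₁` is a complement of
its image. -/
lemma isIso_comp_cokernel_π {X : C} (f : X ⟶ S.X₂) [IsIso (f ≫ S.g)] :
    IsIso (S.f ≫ cokernel.π f) := by
  have := hS.mono_f
  have : Mono f := mono_of_mono f S.g
  have : Mono (S.f ≫ cokernel.π f) := Preadditive.mono_of_cancel_zero _ fun {A} x hx => by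
    obtain ⟨y, hy⟩ : ∃ y, y ≫ f = x ≫ S.f := ⟨_, (shortExact_cokernel f).exact.lift_f _
      (by simpa using hx)⟩
    have : y = 0 := by
      rw [← cancel_mono (f ≫ S.g), reassoc_of% hy, S.zero, comp_zero, zero_comp]
    rw [← cancel_mono S.f, ← hy, this, zero_comp, zero_comp]
  have : Epi (S.f ≫ cokernel.π f) := Preadditive.epi_of_cancel_zero _ fun {A} t ht => by
    have := hS.epi_g
    obtain ⟨t', ht'⟩ : ∃ t', S.g ≫ t' = cokernel.π f ≫ t :=
      ⟨_, hS.exact.g_desc _ (by simpa using ht)⟩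
    have : t' = 0 := by
      rw [← cancel_epi (f ≫ S.g), Category.assoc, ht', cokernel.condition_assoc, zero_comp,
        comp_zero]
    rw [← cancel_epi (cokernel.π f), ← ht', this, comp_zero, comp_zero]
  exact isIso_of_mono_of_epi _

lemma shortExact_kernel_of_epi {Y : C} (g : S.X₂ ⟶ Y) [Epi (S.f ≫ g)] :
    (ShortComplex.mk (kernel.lift g (kernel.ι (S.f ≫ g) ≫ S.f) (by simp))
      (kernel.ι g ≫ S.g) (by simp)).ShortExact where
  mono_f := by
    have := hS.mono_f
    exact mono_of_mono_fac (kernel.lift_ι _ _ _)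
  epi_g := by
    rw [epi_iff_surjective_up_to_refinements]
    intro A y
    have := hS.epi_g
    obtain ⟨A', p, hp, x, hx⟩ := surjective_up_to_refinements_of_epi S.g y
    obtain ⟨A'', p', hp', z, hz⟩ := surjective_up_to_refinements_of_epi (S.f ≫ g) (x ≫ g)
    refine ⟨A'', p' ≫ p, inferInstance, kernel.lift g (p' ≫ x - z ≫ S.f) ?_, ?_⟩
    · simp [hz]
    · simp [hx]
  exact := by
    rw [ShortComplex.exact_iff_exact_up_to_refinements]
    intro A x hx
    have := hS.mono_f
    have h : (x ≫ kernel.ι g) ≫ S.g = 0 := by simpa using hx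
    refine ⟨A, 𝟙 A, inferInstance, kernel.lift _ (hS.exact.lift _ h) ?_, ?_⟩
    · have := hS.exact.lift_f _ h
      rw [reassoc_of% this]
      simp
    · rw [← cancel_mono (kernel.ι g)]
      simp

end ShortExact

/-! ### Standard and costandard filtrations at a maximal weight -/

namespace HighestWeightCategory

variable {𝕜 : Type v} [Field 𝕜] {C : Type u} [Category.{v} C] [Abelian C] [Linear 𝕜 C]
  {Λ : Type w} [PartialOrder Λ] (H : HighestWeightCategory 𝕜 C Λ)

lemma mem_of_trunc_Δ {Γ : Set Λ} {l : Λ} (h : trunc H.L Γ (H.Δ l)) : l ∈ Γ :=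
  H.mem_of_trunc_simple ((trunc H.L Γ).prop_of_epi (H.π l) h)

lemma mem_of_trunc_nabla {Γ : Set Λ} {l : Λ} (h : trunc H.L Γ (H.nabla l)) : l ∈ Γ :=
  H.mem_of_trunc_simple ((trunc H.L Γ).prop_of_mono (H.ι l) h)

lemma Iic_subset_notGT {l k : Λ} (h : ¬ l < k) : Set.Iic k ⊆ {m | ¬ l < m} :=
  fun _ hm hlm => h (hlm.trans_le hm)

lemma trunc_of_filtered_Δ {Γ : Set Λ} {Γ' : Set Λ} {X : C} (h : ∀ i ∈ Γ, Set.Iic i ⊆ Γ')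
    (hX : filtered H.Δ Γ X) : trunc H.L Γ' X :=
  prop_of_filtered _ hX fun i hi => trunc_mono H.L (h i hi) (H.Δ_mem i)

lemma mem_of_hasFiltration_Δ {Γ : Set Λ} {X : C} {s : List Λ} (hs : HasFiltration H.Δ X s)
    (hX : trunc H.L Γ X) {i : Λ} (hi : i ∈ s) : i ∈ Γ :=
  H.mem_of_trunc_Δ (prop_of_hasFiltration _ hs hX i hi)

lemma mem_of_hasFiltration_nabla {Γ : Set Λ} {X : C} {s : List Λ} (hs : HasFiltration H.nabla X s)
    (hX : trunc H.L Γ X) {i : Λ} (hi : i ∈ s) : i ∈ Γ :=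
  H.mem_of_trunc_nabla (prop_of_hasFiltration _ hs hX i hi)

/-- Subtract the scalar by which `f` acts on the head. A nonzero difference could be continued to
`nabla l` with nonzero composite, but all maps `Δ l ⟶ nabla l` factor through the head, where the
difference vanishes. -/
lemma hom_Δ_Δ_eq_smul {l : Λ} (f : H.Δ l ⟶ H.Δ l) : ∃ r : 𝕜, f = r • 𝟙 _ := by
  obtain ⟨r, hr⟩ := H.hom_Δ_L_eq_smul (f ≫ H.π l)
  refine ⟨r, sub_eq_zero.1 ?_⟩
  by_contra h
  obtain ⟨g, hg⟩ := H.exists_to_nabla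
    (trunc_mono H.L (Iic_subset_notGT (lt_irrefl l)) (H.Δ_mem l)) _ h
  obtain ⟨s, rfl⟩ := H.hom_Δ_nabla_eq_smul g
  refine H.π_ι_ne_zero l ?_
  rw [← hg]
  simp [reassoc_of% hr]

lemma hom_nabla_nabla_eq_smul {l : Λ} (f : H.nabla l ⟶ H.nabla l) : ∃ r : 𝕜, f = r • 𝟙 _ := by
  obtain ⟨r, hr⟩ := H.hom_L_nabla_eq_smul (H.ι l ≫ f)
  refine ⟨r, sub_eq_zero.1 ?_⟩
  by_contra h
  obtain ⟨g, hg⟩ := H.exists_from_Δ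
    (trunc_mono H.L (Iic_subset_notGT (lt_irrefl l)) (H.nabla_mem l)) _ h
  obtain ⟨s, rfl⟩ := H.hom_Δ_nabla_eq_smul g
  refine H.π_ι_ne_zero l ?_
  rw [← hg]
  simp [hr, smul_comm r s]

lemma hom_Δ_Δ {l k : Λ} (h : ¬ l < k) (f : H.Δ l ⟶ H.Δ k) (hf : f ≠ 0) : l = k ∧ IsIso f := by
  by_cases hlk : l ≤ k
  · obtain rfl : l = k := by
      by_contra hne
      exact h (lt_of_le_of_ne hlk hne)
    obtain ⟨r, rfl⟩ := H.hom_Δ_Δ_eq_smul f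
    have hr : r ≠ 0 := by
      rintro rfl
      simp at hf
    exact ⟨rfl, ⟨r⁻¹ • 𝟙 _, by simp [smul_smul, hr], by simp [smul_smul, hr]⟩⟩
  · exact (hf (H.hom_Δ_eq_zero (H.Δ_mem k) hlk f)).elim

lemma hom_nabla_nabla {l k : Λ} (h : ¬ l < k) (f : H.nabla k ⟶ H.nabla l) (hf : f ≠ 0) :
    l = k ∧ IsIso f := by
  by_cases hlk : l ≤ k
  · obtain rfl : l = k := by
      by_contra hne
      exact h (lt_of_le_of_ne hlk hne)
    obtain ⟨r, rfl⟩ := H.hom_nabla_nabla_eq_smul f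
    have hr : r ≠ 0 := by
      rintro rfl
      simp at hf
    exact ⟨rfl, ⟨r⁻¹ • 𝟙 _, by simp [smul_smul, hr], by simp [smul_smul, hr]⟩⟩
  · exact (hf (H.hom_nabla_eq_zero (H.nabla_mem k) hlk f)).elim

/-- A nonzero map from `Δ l` to an object with a standard filtration none of whose weights is
bigger than `l` embeds `Δ l` as a step of a filtration. -/
lemma mono_of_hom_Δ {l : Λ} {X : C} {s : List Λ} (hX : HasFiltration H.Δ X s)
    (hs : ∀ i ∈ s, ¬ l < i) (f : H.Δ l ⟶ X) (hf : f ≠ 0) :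
    Mono f ∧ ∃ t, HasFiltration H.Δ (cokernel f) t ∧ s.Perm (l :: t) := by
  induction hX with
  | zero hX => exact (hf (hX.eq_of_tgt _ _)).elim
  | step S hS h₁ h₃ ih =>
    rename_i i s
    obtain ⟨e⟩ := h₃
    have := hS.mono_f
    -- Either `f` lands in the subobject, where induction applies, or it is nonzero on the top
    -- factor. In the latter case maximality of `l` makes it an isomorphism onto that factor, and
    -- the cokernel of `f` is the subobject.
    by_cases h : f ≫ S.g = 0
    · obtain ⟨f', rfl⟩ : ∃ f', f' ≫ S.f = f := ⟨_, hS.exact.lift_f f h⟩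
      obtain ⟨_, t, ht, hp⟩ := ih (fun k hk => hs k (List.mem_cons_of_mem _ hk)) f' (by
        rintro rfl
        simp at hf)
      obtain ⟨e'⟩ := cokernelIso_of_shortExact hS
      exact ⟨inferInstance, i :: t, .step _ (shortExact_cokernel_comp f' S.f) ht ⟨e'.symm ≪≫ e⟩,
        (hp.cons i).trans (List.Perm.swap _ _ _)⟩
    · obtain ⟨rfl, hi⟩ := H.hom_Δ_Δ (hs i List.mem_cons_self) ((f ≫ S.g) ≫ e.hom)
        (fun h' => h (by rw [← cancel_mono e.hom, h', zero_comp]))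
      have : IsIso (f ≫ S.g) := IsIso.of_isIso_comp_right _ e.hom
      have := isIso_comp_cokernel_π hS f
      exact ⟨mono_of_mono f S.g, s, hasFiltration_of_iso (asIso (S.f ≫ cokernel.π f)) h₁, .refl _⟩

lemma epi_of_hom_nabla {l : Λ} {X : C} {s : List Λ} (hX : HasFiltration H.nabla X s)
    (hs : ∀ i ∈ s, ¬ l < i) (g : X ⟶ H.nabla l) (hg : g ≠ 0) :
    Epi g ∧ ∃ t, HasFiltration H.nabla (kernel g) t ∧ s.Perm (l :: t) := by
  induction hX with
  | zero hX => exact (hg (hX.eq_of_src _ _)).elim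
  | step S hS h₁ h₃ ih =>
    rename_i i s
    obtain ⟨e⟩ := h₃
    have := hS.epi_g
    -- If `g` kills the subobject, it identifies the top factor with `nabla l` and its kernel is the
    -- subobject. Otherwise its kernel is an extension of the top factor by the kernel of the
    -- restriction.
    by_cases h : S.f ≫ g = 0
    · obtain ⟨g', rfl⟩ : ∃ g', S.g ≫ g' = g := ⟨_, hS.exact.g_desc g h⟩
      obtain ⟨rfl, hi⟩ := H.hom_nabla_nabla (hs i List.mem_cons_self) (e.inv ≫ g') (by
        intro h'
        obtain rfl : g' = 0 := by rw [← cancel_epi e.inv, h', comp_zero]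
        simp at hg)
      have : IsIso g' := IsIso.of_isIso_comp_left e.inv _
      obtain ⟨e'⟩ := kernelIso_of_shortExact hS
      exact ⟨inferInstance, s, hasFiltration_of_iso (e' ≪≫ (kernelCompMono S.g g').symm) h₁,
        .refl _⟩
    · obtain ⟨_, t, ht, hp⟩ := ih (fun k hk => hs k (List.mem_cons_of_mem _ hk)) (S.f ≫ g) h
      exact ⟨epi_of_epi S.f g, i :: t, .step _ (shortExact_kernel_of_epi hS g) ht ⟨e⟩,
        (hp.cons i).trans (List.Perm.swap _ _ _)⟩

lemma finrank_hom_Δ_L (l i : Λ) [Decidable (i = l)] :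
    Module.finrank 𝕜 (H.Δ l ⟶ H.L i) = if i = l then 1 else 0 := by
  split_ifs with h
  · subst h
    exact (finrank_eq_one_iff_of_nonzero' _ (H.π_ne_zero i)).2 fun f =>
      (H.hom_Δ_L_eq_smul f).imp fun _ => Eq.symm
  · have : Subsingleton (H.Δ l ⟶ H.L i) :=
      subsingleton_of_forall_eq 0 (H.hom_Δ_L_eq_zero (Ne.symm h))
    exact Module.finrank_zero_of_subsingleton

lemma finrank_hom_L_nabla (l i : Λ) [Decidable (i = l)] :
    Module.finrank 𝕜 (H.L i ⟶ H.nabla l) = if i = l then 1 else 0 := by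
  split_ifs with h
  · subst h
    exact (finrank_eq_one_iff_of_nonzero' (H.ι i) (fun h => H.π_ι_ne_zero i (by simp [h]))).2
      fun f => (H.hom_L_nabla_eq_smul f).imp fun _ => Eq.symm
  · have : Subsingleton (H.L i ⟶ H.nabla l) :=
      subsingleton_of_forall_eq 0 (H.hom_L_nabla_eq_zero h)
    exact Module.finrank_zero_of_subsingleton

/-- No composition factor lies above `l`, so Hom(Δ l, -) is exact along the filtration and sees only
the factors `L l`. -/
lemma finrank_hom_Δ [DecidableEq Λ] {l : Λ} {X : C} {s : List Λ} (hX : HasFiltration H.L X s)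
    (hs : ∀ i ∈ s, ¬ l < i) : Module.finrank 𝕜 (H.Δ l ⟶ X) = s.count l := by
  rw [finrank_hom_filtration_right H.finite_hom hX fun i hi => H.subsingleton_ext_Δ_L (hs i hi),
    ← sum_map_ite_eq_count]
  simp_rw [H.finrank_hom_Δ_L]

lemma finrank_hom_nabla [DecidableEq Λ] {l : Λ} {X : C} {s : List Λ} (hX : HasFiltration H.L X s)
    (hs : ∀ i ∈ s, ¬ l < i) : Module.finrank 𝕜 (X ⟶ H.nabla l) = s.count l := by
  rw [finrank_hom_filtration_left H.finite_hom hX fun i hi => H.subsingleton_ext_L_nabla (hs i hi),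
    ← sum_map_ite_eq_count]
  simp_rw [H.finrank_hom_L_nabla]

end HighestWeightCategory

/-! ### Decompositions into indecomposable objects -/

section KrullSchmidt

variable {C : Type u} [Category.{v} C] [Abelian C]

/-- A biproduct of two biproducts is a biproduct over the sum of the index sets. -/
def biproductSumIso {I J : Type} [Finite I] [Finite J] (h : I ⊕ J → C) :
    (⨁ fun i => h (Sum.inl i)) ⊞ (⨁ fun j => h (Sum.inr j)) ≅ ⨁ h where
  hom := biprod.desc (biproduct.desc fun i => biproduct.ι h (Sum.inl i))
    (biproduct.desc fun j => biproduct.ι h (Sum.inr j))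
  inv := biproduct.desc (fun
    | Sum.inl i => biproduct.ι (fun i => h (Sum.inl i)) i ≫ biprod.inl
    | Sum.inr j => biproduct.ι (fun j => h (Sum.inr j)) j ≫ biprod.inr)
  hom_inv_id := by
    apply biprod.hom_ext' <;> apply biproduct.hom_ext' <;> intro j <;> simp
  inv_hom_id := by
    apply biproduct.hom_ext'
    rintro (i | j) <;> simp

lemma nonempty_krullSchmidtDecomposition_of_finite {I : Type} [Finite I] {X : C} (f : I → C)
    (hf : ∀ i, Indecomposable (f i)) (e : X ≅ ⨁ f) : Nonempty (KrullSchmidtDecomposition X) := by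
  obtain ⟨r, ⟨a⟩⟩ := Finite.exists_equiv_fin I
  exact ⟨r, fun i => f (a.symm i), fun i => hf _, e ≪≫ biproduct.whiskerEquiv a
    fun j => eqToIso (by simp)⟩

variable {𝕜 : Type v} [Field 𝕜] [Linear 𝕜 C]

/-- Diagonal endomorphisms embed. The dimension of End thus measures size, both for the induction on
direct sum decompositions and for making complexes minimal. -/
lemma finrank_end_add_le (hfin : ∀ X Y : C, Module.Finite 𝕜 (X ⟶ Y)) {X Y Z : C} (e : X ≅ Y ⊞ Z) :
    Module.finrank 𝕜 (Y ⟶ Y) + Module.finrank 𝕜 (Z ⟶ Z) ≤ Module.finrank 𝕜 (X ⟶ X) := by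
  have := hfin X X
  have := hfin Y Y
  have := hfin Z Z
  rw [← Module.finrank_prod]
  let f : ((Y ⟶ Y) × (Z ⟶ Z)) →ₗ[𝕜] (X ⟶ X) :=
    { toFun := fun a => e.hom ≫ biprod.map a.1 a.2 ≫ e.inv
      map_add' := fun a b => by
        rw [← Preadditive.comp_add, ← Preadditive.add_comp]
        congr 2
        apply biprod.hom_ext' <;> simp
      map_smul' := fun r a => by
        rw [RingHom.id_apply, ← Linear.comp_smul, ← Linear.smul_comp]
        congr 2
        apply biprod.hom_ext' <;> simp }
  refine LinearMap.finrank_le_finrank_of_injective (f := f) fun a b hab => ?_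
  have h : biprod.map a.1 a.2 = biprod.map b.1 b.2 := by
    rw [← cancel_epi e.hom, ← cancel_mono e.inv, Category.assoc, Category.assoc]
    exact hab
  refine Prod.ext ?_ ?_
  · simpa using congrArg (fun t => biprod.inl ≫ t ≫ biprod.fst) h
  · simpa using congrArg (fun t => biprod.inr ≫ t ≫ biprod.snd) h

lemma finrank_end_pos (hfin : ∀ X Y : C, Module.Finite 𝕜 (X ⟶ Y)) {X : C} (hX : ¬ IsZero X) :
    0 < Module.finrank 𝕜 (X ⟶ X) := by
  have := hfin X X
  have : Nontrivial (X ⟶ X) := ⟨𝟙 X, 0, fun h => hX ((IsZero.iff_id_eq_zero X).2 h)⟩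
  exact Module.finrank_pos

/-- A property that holds for indecomposable objects and is stable under finite direct sums holds
for all objects. -/
lemma indecomposable_induction (hfin : ∀ X Y : C, Module.Finite 𝕜 (X ⟶ Y)) {P : C → Prop}
    (h₀ : ∀ X, IsZero X → P X) (h₁ : ∀ X, Indecomposable X → P X)
    (h₂ : ∀ X Y Z, (X ≅ Y ⊞ Z) → P Y → P Z → P X) (X : C) : P X := by
  induction h : Module.finrank 𝕜 (X ⟶ X) using Nat.strong_induction_on generalizing X with
  | _ n ih =>
  by_cases hX : IsZero X
  · exact h₀ X hX
  by_cases hX' : Indecomposable X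
  · exact h₁ X hX'
  simp only [Indecomposable, hX, not_false_eq_true, true_and, not_forall, not_or] at hX'
  obtain ⟨Y, Z, e, hY, hZ⟩ := hX'
  have := finrank_end_add_le hfin e
  have := finrank_end_pos hfin hY
  have := finrank_end_pos hfin hZ
  exact h₂ X Y Z e (ih _ (by lia) Y rfl) (ih _ (by lia) Z rfl)

lemma nonempty_krullSchmidtDecomposition (hfin : ∀ X Y : C, Module.Finite 𝕜 (X ⟶ Y)) (X : C) :
    Nonempty (KrullSchmidtDecomposition X) := by
  refine indecomposable_induction (P := fun X => Nonempty (KrullSchmidtDecomposition X)) hfin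
    (fun X hX => ?_) (fun X hX => ?_) (fun X Y Z e hY hZ => ?_) X
  · exact nonempty_krullSchmidtDecomposition_of_finite (I := Empty) (fun i => i.elim)
      (fun i => i.elim) (hX.iso ((IsZero.iff_id_eq_zero _).2
        (biproduct.hom_ext _ _ fun i => i.elim)))
  · exact nonempty_krullSchmidtDecomposition_of_finite (I := Unit) (fun _ => X) (fun _ => hX)
      (biproductUniqueIso fun _ => X).symm
  · obtain ⟨r, f, hf, a⟩ := hY
    obtain ⟨s, g, hg, b⟩ := hZ
    exact nonempty_krullSchmidtDecomposition_of_finite (Sum.elim f g)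
      (by rintro (i | j); exacts [hf i, hg j]) (e ≪≫ biprod.mapIso a b ≪≫ biproductSumIso (Sum.elim f g))

lemma not_mem_of_sum_eq_one {Λ : Type*} {l : Λ} {s t : List Λ} (f : Λ → ℕ) (hs : (s.map f).sum = 1)
    (hp : s.Perm (l :: t)) (hl : 0 < f l) : l ∉ t := fun h => by
  have h₁ := (hp.map f).sum_eq
  have h₂ := List.single_le_sum (l := t.map f) (by simp) _ (List.mem_map_of_mem h)
  rw [hs, List.map_cons, List.sum_cons] at h₁
  lia

end KrullSchmidt

/-! ### Indecomposable tilting objects -/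

namespace HighestWeightCategory

variable {𝕜 : Type v} [Field 𝕜] {C : Type u} [Category.{v} C] [Abelian C] [Linear 𝕜 C]
  {Λ : Type w} [PartialOrder Λ] (H : HighestWeightCategory 𝕜 C Λ)

/-- The maps between an indecomposable tilting object and the corresponding standard and
costandard objects. -/
structure TiltingMaps (l : Λ) (T : C) where
  j : H.Δ l ⟶ T
  q : T ⟶ H.nabla l
  j_q : j ≫ q = H.π l ≫ H.ι l
  eq_smul_j : ∀ f : H.Δ l ⟶ T, ∃ r : 𝕜, f = r • j
  eq_smul_q : ∀ f : T ⟶ H.nabla l, ∃ r : 𝕜, f = r • q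
  mono_j : Mono j
  epi_q : Epi q
  cokernel_j : filtered H.Δ (Set.Iio l) (cokernel j)
  kernel_q : filtered H.nabla (Set.Iio l) (kernel q)

variable {H} {l : Λ} {T : C}

/-- As `l` is maximal in `T` with multiplicity one, Hom(Δ l, T) and Hom(T, nabla l) are lines that
pair nontrivially. Then `Δ l` is a first step of a standard filtration, and a second factor `Δ l` is
impossible because it would increase the dimension of Hom(Δ l, T). Dually for `nabla l`. -/
lemma IsIndecomposableTilting.nonempty_tiltingMaps (hT : H.IsIndecomposableTilting l T) :
    Nonempty (H.TiltingMaps l T) := by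
  classical
  have hmem := trunc_mono H.L (Iic_subset_notGT (lt_irrefl l)) hT.mem
  obtain ⟨s, hs, hc⟩ := hT.compositionMultiplicity
  have hs' : ∀ i ∈ s, ¬ l < i := fun i hi => H.mem_of_trunc_simple
    (prop_of_hasFiltration _ hs hmem i hi)
  have h₁ := H.finrank_hom_Δ hs hs'
  have h₂ := H.finrank_hom_nabla hs hs'
  rw [hc] at h₁ h₂
  obtain ⟨j, hj, hj'⟩ := finrank_eq_one_iff'.1 h₁
  obtain ⟨q, hq⟩ := H.exists_to_nabla hmem j hj
  have hq₀ : q ≠ 0 := fun h => H.π_ι_ne_zero l (by rw [← hq, h, comp_zero])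
  have hq' := (finrank_eq_one_iff_of_nonzero' q hq₀).1 h₂
  obtain ⟨⟨a, ha⟩, ⟨b, hb⟩⟩ := hT.tilting
  have ha' : ∀ i ∈ a, ¬ l < i := fun i => H.mem_of_hasFiltration_Δ ha hmem
  have hb' : ∀ i ∈ b, ¬ l < i := fun i => H.mem_of_hasFiltration_nabla hb hmem
  obtain ⟨hm, a', h₃, hp₃⟩ := H.mono_of_hom_Δ ha ha' j hj
  obtain ⟨he, b', h₄, hp₄⟩ := H.epi_of_hom_nabla hb hb' q hq₀
  refine ⟨⟨j, q, hq, fun f => (hj' f).imp fun _ => Eq.symm, fun f => (hq' f).imp fun _ => Eq.symm,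
    hm, he, ⟨a', h₃, fun i hi => lt_of_le_of_ne ?_ ?_⟩, ⟨b', h₄, fun i hi => lt_of_le_of_ne ?_ ?_⟩⟩⟩
  · exact H.mem_of_hasFiltration_Δ ha hT.mem (hp₃.mem_iff.2 (List.mem_cons_of_mem _ hi))
  · rintro rfl
    rw [finrank_hom_filtration_right H.finite_hom ha fun k hk =>
      H.subsingleton_ext_Δ (trunc_mono H.L (Iic_subset_notGT (ha' k hk)) (H.Δ_mem k))] at h₁
    refine not_mem_of_sum_eq_one _ h₁ hp₃ (finrank_end_pos H.finite_hom fun h => ?_) hi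
    exact H.π_ne_zero i (h.eq_of_src _ _)
  · exact H.mem_of_hasFiltration_nabla hb hT.mem (hp₄.mem_iff.2 (List.mem_cons_of_mem _ hi))
  · rintro rfl
    rw [finrank_hom_filtration_left H.finite_hom hb fun k hk =>
      H.subsingleton_ext_nabla (trunc_mono H.L (Iic_subset_notGT (hb' k hk)) (H.nabla_mem k))] at h₂
    refine not_mem_of_sum_eq_one _ h₂ hp₄ (finrank_end_pos H.finite_hom fun h => ?_) hi
    exact H.π_ι_ne_zero i (h.eq_of_tgt _ _)

/-- `c` acts on the line Hom(Δ l, T) by a scalar, which is nonzero by `hc`. So `c` is not nilpotent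
and Fitting's lemma applies. -/
lemma TiltingMaps.isIso (d : H.TiltingMaps l T) (hT : Indecomposable T) (c : T ⟶ T)
    (hc : d.j ≫ c ≫ d.q ≠ 0) : IsIso c := by
  have := H.finite_hom T T
  refine (isNilpotent_or_isIso 𝕜 hT c).resolve_left ?_
  rintro ⟨n, hn⟩
  obtain ⟨r, hr⟩ := d.eq_smul_j (d.j ≫ c)
  have hr₀ : r ≠ 0 := by
    rintro rfl
    exact hc (by rw [← Category.assoc, hr, zero_smul, zero_comp])
  have h : ∀ n : ℕ, d.j ≫ ((show End T from c) ^ n : End T) = r ^ n • d.j := fun n => by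
    induction n with
    | zero =>
      rw [pow_zero, pow_zero, one_smul]
      exact Category.comp_id _
    | succ n ih =>
      rw [pow_succ', pow_succ', End.mul_def, ← Category.assoc, ih, Linear.smul_comp,
        mul_comm, mul_smul]
      exact congrArg (r ^ n • ·) hr
  have h' := h n
  rw [hn, show d.j ≫ (0 : End T) = 0 from comp_zero] at h'
  refine H.π_ι_ne_zero l ?_
  rw [← d.j_q, (smul_eq_zero_iff_right (pow_ne_zero n hr₀)).1 h'.symm, zero_comp]

variable (H) in
/-- Objects that are `Ext¹`-orthogonal to all standard and costandard objects. -/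
def extOrthogonal : ObjectProperty C := fun X =>
  (∀ i, Subsingleton (ExtGroup (H.Δ i) X 1)) ∧ ∀ i, Subsingleton (ExtGroup X (H.nabla i) 1)

lemma extOrthogonal_of_tilting {X : C} (hX : H.tilting X) : H.extOrthogonal X := by
  obtain ⟨⟨s, hs⟩, ⟨t, ht⟩⟩ := hX
  exact ⟨fun i => subsingleton_ext_filtered_right (S := Set.univ) ⟨t, ht, by simp⟩
    fun k _ => H.ext_one i k, fun i => subsingleton_ext_filtered_left (S := Set.univ)
    ⟨s, hs, by simp⟩ fun k _ => H.ext_one k i⟩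

lemma extOrthogonal_of_retract {X Y : C} (e : Retract X Y) (hY : H.extOrthogonal Y) :
    H.extOrthogonal X :=
  ⟨fun i => subsingleton_ext_of_retract_right e (hY.1 i),
    fun i => subsingleton_ext_of_retract_left e (hY.2 i)⟩

/-- The obstruction lies in Ext¹(cokernel j, X), which vanishes since the cokernel of `j` has a
standard filtration. -/
lemma TiltingMaps.exists_extension (d : H.TiltingMaps l T) {X : C} (hX : H.extOrthogonal X)
    (f : H.Δ l ⟶ X) : ∃ g : T ⟶ X, d.j ≫ g = f := by
  have := d.mono_j
  exact HighestWeight.exists_extension (shortExact_cokernel d.j)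
    (subsingleton_ext_filtered_left d.cokernel_j fun i _ => hX.1 i) f

lemma TiltingMaps.exists_lifting (d : H.TiltingMaps l T) {X : C} (hX : H.extOrthogonal X)
    (f : X ⟶ H.nabla l) : ∃ g : X ⟶ T, g ≫ d.q = f := by
  have := d.epi_q
  exact HighestWeight.exists_lifting (shortExact_kernel d.q)
    (subsingleton_ext_filtered_right d.kernel_q fun i _ => hX.2 i) f

/-- A nonzero composition `Δ l ⟶ X ⟶ nabla l` through a direct summand of a tilting object exhibits
`T l` as a direct summand of `X`. -/
lemma TiltingMaps.exists_retract (d : H.TiltingMaps l T) (hT : Indecomposable T) {X : C}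
    (hX : H.extOrthogonal X) (f : H.Δ l ⟶ X) (g : X ⟶ H.nabla l) (h : f ≫ g ≠ 0) :
    Nonempty (Retract T X) := by
  obtain ⟨a, rfl⟩ := d.exists_extension hX f
  obtain ⟨b, rfl⟩ := d.exists_lifting hX g
  -- The endomorphism `a ≫ b` of `T` is invertible because j ≫ a ≫ b ≫ q is the given nonzero
  -- composite through `X`.
  have := d.isIso hT (a ≫ b) (by simpa using h)
  exact ⟨a, b ≫ inv (a ≫ b), by rw [← Category.assoc, IsIso.hom_inv_id]⟩

variable (H) in
/-- A maximal weight of a nonzero object. -/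
lemma exists_weight {X : C} (hX : ¬ IsZero X) : ∃ l, trunc H.L {k | ¬ l < k} X ∧
    ∃ (f : H.Δ l ⟶ X) (g : X ⟶ H.nabla l), f ≫ g = H.π l ≫ H.ι l := by
  classical
  obtain ⟨s, hs⟩ := H.finiteLength X
  have hne : s.toFinset.Nonempty := by
    rw [List.toFinset_nonempty_iff]
    rintro rfl
    cases hs
    contradiction
  obtain ⟨l, hl, hm⟩ := s.toFinset.exists_maximal hne
  have hs' : ∀ i ∈ s, ¬ l < i := fun i hi hli =>
    hli.not_ge (hm (List.mem_toFinset.2 hi) hli.le)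
  have hX' : trunc H.L {k | ¬ l < k} X := H.trunc_iff.2 ⟨s, hs, hs'⟩
  have h := H.finrank_hom_Δ hs hs'
  have : 0 < Module.finrank 𝕜 (H.Δ l ⟶ X) := by
    rw [h, List.count_pos_iff]
    simpa using hl
  have := Module.nontrivial_of_finrank_pos this
  obtain ⟨f, hf⟩ := exists_ne (0 : H.Δ l ⟶ X)
  exact ⟨l, hX', f, H.exists_to_nabla hX' f hf⟩

lemma TiltingMaps.nonempty_iso (d : H.TiltingMaps l T) (hT : Indecomposable T) {X : C}
    (hX : H.extOrthogonal X) (hX' : Indecomposable X) (f : H.Δ l ⟶ X) (g : X ⟶ H.nabla l)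
    (h : f ≫ g ≠ 0) : Nonempty (X ≅ T) := by
  obtain ⟨e⟩ := d.exists_retract hT hX f g h
  have := isIso_of_retract e hX' hT.1
  exact ⟨asIso e.r⟩

lemma tilting_of_isZero {X : C} (hX : IsZero X) : H.tilting X := ⟨⟨_, .zero hX⟩, ⟨_, .zero hX⟩⟩

lemma tilting_of_iso {X Y : C} (e : X ≅ Y) (hX : H.tilting X) : H.tilting Y :=
  ⟨hX.1.imp fun _ => hasFiltration_of_iso e, hX.2.imp fun _ => hasFiltration_of_iso e⟩

lemma tilting_iff {X : C} : H.tilting X ↔ filtered H.Δ Set.univ X ∧ filtered H.nabla Set.univ X := by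
  simp [HighestWeightCategory.tilting, filtered]

lemma tilting_biprod {X Y : C} (hX : H.tilting X) (hY : H.tilting Y) : H.tilting (X ⊞ Y) := by
  rw [tilting_iff] at *
  exact ⟨filtered_biprod hX.1 hY.1, filtered_biprod hX.2 hY.2⟩

lemma retract_of_biprod_iso {X Y Z : C} (e : X ≅ Y ⊞ Z) :
    Nonempty (Retract Y X) ∧ Nonempty (Retract Z X) :=
  ⟨⟨biprod.inl ≫ e.inv, e.hom ≫ biprod.fst, by simp⟩,
    ⟨biprod.inr ≫ e.inv, e.hom ≫ biprod.snd, by simp⟩⟩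

variable {T : Λ → C} (hT : ∀ l, H.IsIndecomposableTilting l (T l))

/-- A choice of maps for the indecomposable tilting objects. -/
def maps (l : Λ) : H.TiltingMaps l (T l) := (hT l).nonempty_tiltingMaps.some

include hT

/-- The classification of indecomposable tilting objects. -/
lemma exists_iso_T {X : C} (hX : H.extOrthogonal X) (hX' : Indecomposable X) :
    ∃ l, Nonempty (X ≅ T l) := by
  obtain ⟨l, -, f, g, h⟩ := H.exists_weight hX'.1
  exact ⟨l, (maps hT l).nonempty_iso (hT l).indecomposable hX hX' f g
    (by rw [h]; exact H.π_ι_ne_zero l)⟩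

/-- Each indecomposable summand is some `T l`, with `l` a maximal weight of the summand.
Orthogonality visibly passes to direct summands, so this criterion is what closes tilting objects
under summands. -/
lemma tilting_of_extOrthogonal {X : C} (hX : H.extOrthogonal X) : H.tilting X := by
  refine indecomposable_induction (P := fun X => H.extOrthogonal X → H.tilting X) H.finite_hom
    (fun X hX _ => tilting_of_isZero hX) (fun X hX hX' => ?_) (fun X Y Z e hY hZ hX => ?_) X hX
  · obtain ⟨l, ⟨e⟩⟩ := exists_iso_T hT hX' hX
    exact tilting_of_iso e.symm (hT l).tilting
  · obtain ⟨⟨r⟩, ⟨s⟩⟩ := retract_of_biprod_iso e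
    exact tilting_of_iso e.symm (tilting_biprod (hY (extOrthogonal_of_retract r hX))
      (hZ (extOrthogonal_of_retract s hX)))

lemma tilting_of_retract {X Y : C} (e : Retract X Y) (hY : H.tilting Y) : H.tilting X :=
  tilting_of_extOrthogonal hT (extOrthogonal_of_retract e (extOrthogonal_of_tilting hY))

end HighestWeightCategory

/-! ### Yoneda extensions and kernels and cokernels of their morphisms -/

section Extensions

variable {C : Type u} [Category.{v} C] [Abelian C]

lemma shortExact_of_isPushout {S : ShortComplex C} (hS : S.ShortExact) {Y P : C} {a : S.X₁ ⟶ Y}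
    {r : S.X₂ ⟶ P} {b : Y ⟶ P} (h : IsPushout S.f a r b) :
    (ShortComplex.mk b (h.desc S.g 0 (by simp)) (by simp)).ShortExact where
  mono_f := by
    have := hS.mono_f
    exact (MorphismProperty.monomorphisms C).of_isPushout h.flip hS.mono_f
  epi_g := by
    have := hS.epi_g
    exact epi_of_epi_fac (h.inl_desc S.g 0 (by simp))
  exact := by
    have := hS.epi_g
    refine ShortComplex.exact_of_g_is_cokernel _ (CokernelCofork.IsColimit.ofπ _ _
      (fun k hk => hS.exact.desc (r ≫ k) ?_) (fun k hk => ?_) fun k hk m hm => ?_)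
    · dsimp at hk
      rw [reassoc_of% h.w, hk, comp_zero]
    · apply h.hom_ext
      · simp
      · dsimp at hk
        simp [hk]
    · rw [← cancel_epi S.g, hS.exact.g_desc, ← hm]
      simp

lemma shortExact_of_isPullback {S : ShortComplex C} (hS : S.ShortExact) {Y P : C} {c : Y ⟶ S.X₃}
    {r : P ⟶ S.X₂} {b : P ⟶ Y} (h : IsPullback r b S.g c) :
    (ShortComplex.mk (h.lift S.f 0 (by simp)) b (by simp)).ShortExact where
  epi_g := (MorphismProperty.epimorphisms C).of_isPullback h hS.epi_g
  mono_f := by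
    have := hS.mono_f
    exact mono_of_mono_fac (h.lift_fst S.f 0 (by simp))
  exact := by
    have := hS.mono_f
    refine ShortComplex.exact_of_f_is_kernel _ (KernelFork.IsLimit.ofι _ _
      (fun k hk => hS.exact.lift (k ≫ r) ?_) (fun k hk => ?_) fun k hk m hm => ?_)
    · dsimp at hk
      rw [Category.assoc, h.w, reassoc_of% hk, zero_comp]
    · apply h.hom_ext
      · simp
      · dsimp at hk
        simp [hk]
    · rw [← cancel_mono S.f, hS.exact.lift_f, ← hm]
      simp

/-- Every element of `Ext¹` is the class of an extension. -/
lemma exists_extClass_eq {X Y : C} (x : ExtGroup X Y 1) :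
    ∃ (Z : C) (f : Y ⟶ Z) (g : Z ⟶ X) (w : f ≫ g = 0) (hS : (ShortComplex.mk f g w).ShortExact),
      hS.extClass = x := by
  obtain ⟨N, P, i, p, w, hS, y, hy⟩ := exists_extClass_comp x
  obtain ⟨a, rfl⟩ := (Ext.mk₀_bijective _ _).2 y
  -- `x` is the class of `N` → `P` → `X` pushed forward along `a`, hence the class of the pushout
  -- extension.
  have h := IsPushout.of_hasPushout i a
  have hP := shortExact_of_isPushout hS h
  refine ⟨_, _, _, _, hP, ?_⟩
  let φ : ShortComplex.mk i p w ⟶ ShortComplex.mk (pushout.inr i a) (h.desc p 0 (by simp [w]))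
      (by simp) :=
    { τ₁ := a
      τ₂ := pushout.inl i a
      τ₃ := 𝟙 X
      comm₁₂ := h.w.symm
      comm₂₃ := by simp }
  have := ShortComplex.ShortExact.extClass_naturality hS hP φ
  rw [Ext.mk₀_id_comp] at this
  rw [← hy]
  exact this.symm

/-- A compatible pair of maps between the outer terms of two extensions extends to a map of
extensions. -/
lemma exists_hom_of_extClass {S S' : ShortComplex C} (hS : S.ShortExact) (hS' : S'.ShortExact)
    (a : S.X₁ ⟶ S'.X₁) (c : S.X₃ ⟶ S'.X₃)
    (h : hS.extClass.comp (Ext.mk₀ a) (add_zero 1) = (Ext.mk₀ c).comp hS'.extClass (zero_add 1)) :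
    ∃ b : S.X₂ ⟶ S'.X₂, S.f ≫ b = a ≫ S'.f ∧ b ≫ S'.g = S.g ≫ c := by
  have := hS'.mono_f
  obtain ⟨x, hx⟩ := Ext.covariant_sequence_exact₃ S.X₂ hS' (Ext.mk₀ (S.g ≫ c)) (zero_add 1) (by
    rw [← Ext.mk₀_comp_mk₀, Ext.comp_assoc_of_second_deg_zero, ← h, hS.comp_extClass_assoc])
  obtain ⟨b, rfl⟩ := (Ext.mk₀_bijective _ _).2 x
  have hb : b ≫ S'.g = S.g ≫ c := (Ext.mk₀_bijective _ _).1 (by rw [← hx, Ext.mk₀_comp_mk₀])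
  have hn₀ : (S.f ≫ b) ≫ S'.g = 0 := by
    rw [Category.assoc, hb, ← Category.assoc, S.zero, zero_comp]
  -- The lift `b` induces some map `n` on subobjects, possibly different from `a`. The class of `S`
  -- kills `n - a`, so `n - a` extends to a map `t` on `S.X₂`, and subtracting `t ≫ S'.f` corrects
  -- `b`.
  let n := hS'.exact.lift (S.f ≫ b) hn₀
  have hn : n ≫ S'.f = S.f ≫ b := hS'.exact.lift_f _ _
  let φ : S ⟶ S' := { τ₁ := n, τ₂ := b, τ₃ := c, comm₁₂ := hn, comm₂₃ := hb }
  have hφ := ShortComplex.ShortExact.extClass_naturality hS hS' φ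
  obtain ⟨y, hy⟩ := Ext.contravariant_sequence_exact₁ hS S'.X₁ (Ext.mk₀ (n - a)) (add_zero 1) (by
    rw [sub_eq_add_neg, Ext.mk₀_add, Ext.mk₀_neg, Ext.comp_add, Ext.comp_neg, h, ← sub_eq_add_neg,
      sub_eq_zero]
    exact hφ)
  obtain ⟨t, rfl⟩ := (Ext.mk₀_bijective _ _).2 y
  have ht : S.f ≫ t = n - a := (Ext.mk₀_bijective _ _).1 (by rw [← hy, Ext.mk₀_comp_mk₀])
  exact ⟨b - t ≫ S'.f, by rw [Preadditive.comp_sub, reassoc_of% ht, Preadditive.sub_comp, hn]; abel,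
    by rw [Preadditive.sub_comp, hb]; simp⟩

lemma shortExact_kernel_map {S S' : ShortComplex C} (hS : S.ShortExact) (hS' : S'.ShortExact)
    (φ : S ⟶ S') [Epi φ.τ₁] :
    (ShortComplex.mk (kernel.map φ.τ₁ φ.τ₂ S.f S'.f φ.comm₁₂) (kernel.map φ.τ₂ φ.τ₃ S.g S'.g φ.comm₂₃)
      (by rw [← cancel_mono (kernel.ι _)]; simp)).ShortExact where
  mono_f := by
    have := hS.mono_f
    exact mono_of_mono_fac (kernel.lift_ι _ _ _)
  epi_g := by
    have := hS.epi_g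
    rw [epi_iff_surjective_up_to_refinements]
    intro A y
    obtain ⟨A₁, p₁, hp₁, x, hx⟩ := surjective_up_to_refinements_of_epi S.g (y ≫ kernel.ι _)
    obtain ⟨A₂, p₂, hp₂, m, hm⟩ := hS'.exact.exact_up_to_refinements (x ≫ φ.τ₂) (by
      rw [Category.assoc, φ.comm₂₃, ← reassoc_of% hx, kernel.condition, comp_zero, comp_zero])
    obtain ⟨A₃, p₃, hp₃, z, hz⟩ := surjective_up_to_refinements_of_epi φ.τ₁ m
    refine ⟨A₃, p₃ ≫ p₂ ≫ p₁, inferInstance,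
      kernel.lift _ (p₃ ≫ p₂ ≫ x - z ≫ S.f) ?_, ?_⟩
    · rw [Preadditive.sub_comp, Category.assoc, Category.assoc, hm, Category.assoc, ← φ.comm₁₂,
        reassoc_of% hz, sub_self]
    · rw [← cancel_mono (kernel.ι _)]
      simp [hx]
  exact := by
    rw [ShortComplex.exact_iff_exact_up_to_refinements]
    intro A x hx
    have := hS.mono_f
    have := hS'.mono_f
    have h : (x ≫ kernel.ι φ.τ₂) ≫ S.g = 0 := by
      have := hx =≫ kernel.ι φ.τ₃
      simpa using this
    have h' := hS.exact.lift_f _ h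
    refine ⟨A, 𝟙 A, inferInstance, kernel.lift _ (hS.exact.lift _ h) ?_, ?_⟩
    · rw [← cancel_mono S'.f, Category.assoc, φ.comm₁₂, reassoc_of% h', kernel.condition, comp_zero,
        zero_comp]
    · rw [← cancel_mono (kernel.ι φ.τ₂)]
      simp

lemma shortExact_cokernel_map {S S' : ShortComplex C} (hS : S.ShortExact) (hS' : S'.ShortExact)
    (φ : S ⟶ S') [Mono φ.τ₃] :
    (ShortComplex.mk (cokernel.map φ.τ₁ φ.τ₂ S.f S'.f φ.comm₁₂)
      (cokernel.map φ.τ₂ φ.τ₃ S.g S'.g φ.comm₂₃)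
      (by rw [← cancel_epi (cokernel.π _)]; simp)).ShortExact where
  epi_g := by
    have := hS'.epi_g
    exact epi_of_epi_fac (cokernel.π_desc _ _ _)
  mono_f := by
    have := hS'.mono_f
    refine Preadditive.mono_of_cancel_zero _ fun {A} x hx => ?_
    obtain ⟨A₁, p₁, hp₁, y, hy⟩ := surjective_up_to_refinements_of_epi (cokernel.π φ.τ₁) x
    have h : (y ≫ S'.f) ≫ cokernel.π φ.τ₂ = 0 := by
      have := congrArg (fun t => p₁ ≫ t) hx
      simp only [comp_zero, reassoc_of% hy] at this
      simpa using this
    obtain ⟨A₂, p₂, hp₂, z, hz⟩ := (ShortComplex.exact_cokernel φ.τ₂).exact_up_to_refinements _ h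
    dsimp at z hz
    have hz' : z ≫ S.g = 0 := by
      rw [← cancel_mono φ.τ₃, Category.assoc, ← φ.comm₂₃, ← reassoc_of% hz]
      simp
    obtain ⟨A₃, p₃, hp₃, t, ht⟩ := hS.exact.exact_up_to_refinements z hz'
    have h₃ : p₃ ≫ p₂ ≫ y = t ≫ φ.τ₁ := by
      rw [← cancel_mono S'.f, Category.assoc, Category.assoc, hz, reassoc_of% ht, Category.assoc,
        φ.comm₁₂]
    rw [← cancel_epi p₁, ← cancel_epi p₂, ← cancel_epi p₃, hy, ← Category.assoc p₂,
      ← Category.assoc p₃, h₃]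
    simp
  exact := by
    have := hS.epi_g
    have := hS'.epi_g
    have hk' : ∀ {Z : C} (k : cokernel φ.τ₂ ⟶ Z),
        cokernel.map φ.τ₁ φ.τ₂ S.f S'.f φ.comm₁₂ ≫ k = 0 →
        ∃ d : S'.X₃ ⟶ Z, S'.g ≫ d = cokernel.π φ.τ₂ ≫ k ∧ φ.τ₃ ≫ d = 0 := fun k hk => by
      have h : S'.f ≫ cokernel.π φ.τ₂ ≫ k = 0 := by
        have := congrArg (fun t => cokernel.π φ.τ₁ ≫ t) hk
        simpa using this
      have h' := hS'.exact.g_desc _ h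
      refine ⟨_, h', ?_⟩
      rw [← cancel_epi S.g, ← Category.assoc, ← φ.comm₂₃, Category.assoc, h']
      simp
    refine ShortComplex.exact_of_g_is_cokernel _ (CokernelCofork.IsColimit.ofπ _ _
      (fun k hk => cokernel.desc _ (hk' k hk).choose (hk' k hk).choose_spec.2)
      (fun k hk => ?_) fun k hk m hm => ?_)
    · rw [← cancel_epi (cokernel.π φ.τ₂)]
      simpa using (hk' k hk).choose_spec.1
    · rw [← cancel_epi (cokernel.π φ.τ₃), ← cancel_epi S'.g, cokernel.π_desc,
        (hk' k hk).choose_spec.1, ← hm]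
      simp

end Extensions

/-! ### Approximations and vanishing of higher Ext groups -/

namespace HighestWeightCategory

variable {𝕜 : Type v} [Field 𝕜] {C : Type u} [Category.{v} C] [Abelian C] [Linear 𝕜 C]
  {Λ : Type w} [PartialOrder Λ] (H : HighestWeightCategory 𝕜 C Λ)

lemma subsingleton_ext_filtered {n : ℕ} (h : ∀ i j, Subsingleton (ExtGroup (H.Δ i) (H.nabla j) n))
    {S S' : Set Λ} {X Y : C} (hX : filtered H.Δ S X) (hY : filtered H.nabla S' Y) :
    Subsingleton (ExtGroup X Y n) :=
  subsingleton_ext_filtered_left hX fun i _ => subsingleton_ext_filtered_right hY fun j _ => h i j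

/-- `M` is a quotient of an object with a standard filtration by an object with a costandard
filtration. -/
def HasLeftApprox (M : C) : Prop :=
  ∃ (Z : C) (p : Z ⟶ M), Epi p ∧ filtered H.Δ Set.univ Z ∧ filtered H.nabla Set.univ (kernel p)

/-- `M` embeds into an object with a costandard filtration with a quotient that has a standard
filtration. -/
def HasRightApprox (M : C) : Prop :=
  ∃ (B : C) (i : M ⟶ B), Mono i ∧ filtered H.nabla Set.univ B ∧ filtered H.Δ Set.univ (cokernel i)

variable {H}

/-- A horseshoe argument: the class pulled back to Ext¹(Z₃, S.X₁) lifts to Ext¹(Z₃, Z₁), since the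
obstruction lies in Ext²(Z₃, kernel p₁). That group vanishes by the Ext² axiom, as `Z₃` has a
standard and the kernel a costandard filtration. -/
lemma HasLeftApprox.extension {S : ShortComplex C} (hS : S.ShortExact) (h₁ : H.HasLeftApprox S.X₁)
    (h₃ : H.HasLeftApprox S.X₃) : H.HasLeftApprox S.X₂ := by
  obtain ⟨Z₁, p₁, hp₁, hZ₁, hB₁⟩ := h₁
  obtain ⟨Z₃, p₃, hp₃, hZ₃, hB₃⟩ := h₃
  obtain ⟨x, hx⟩ := Ext.covariant_sequence_exact₃ Z₃ (shortExact_kernel p₁)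
    ((Ext.mk₀ p₃).comp hS.extClass (zero_add 1)) (show 1 + 1 = 2 from rfl)
    ((H.subsingleton_ext_filtered H.ext_two hZ₃ hB₁).elim _ _)
  obtain ⟨Z, f, g, w, hZ, rfl⟩ := exists_extClass_eq x
  obtain ⟨b, hb₁, hb₂⟩ := exists_hom_of_extClass hZ hS p₁ p₃ hx
  let φ : ShortComplex.mk f g w ⟶ S :=
    { τ₁ := p₁, τ₂ := b, τ₃ := p₃, comm₁₂ := hb₁.symm, comm₂₃ := hb₂ }
  have : Epi φ.τ₁ := hp₁
  have hb : Epi φ.τ₂ := ShortComplex.epi_of_epi_of_epi_of_epi φ hS.exact hZ.epi_g hp₁ hp₃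
  exact ⟨Z, b, hb, filtered_extension hZ hZ₁ hZ₃,
    filtered_extension (shortExact_kernel_map hZ hS φ) hB₁ hB₃⟩

lemma HasRightApprox.extension {S : ShortComplex C} (hS : S.ShortExact)
    (h₁ : H.HasRightApprox S.X₁) (h₃ : H.HasRightApprox S.X₃) : H.HasRightApprox S.X₂ := by
  obtain ⟨B₁, p₁, hp₁, hB₁, hZ₁⟩ := h₁
  obtain ⟨B₃, p₃, hp₃, hB₃, hZ₃⟩ := h₃
  obtain ⟨x, hx⟩ := Ext.contravariant_sequence_exact₁ (shortExact_cokernel p₃) B₁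
    (hS.extClass.comp (Ext.mk₀ p₁) (add_zero 1)) (show 1 + 1 = 2 from rfl)
    ((H.subsingleton_ext_filtered H.ext_two hZ₃ hB₁).elim _ _)
  obtain ⟨B, f, g, w, hB, rfl⟩ := exists_extClass_eq x
  obtain ⟨b, hb₁, hb₂⟩ := exists_hom_of_extClass hS hB p₁ p₃ hx.symm
  let φ : S ⟶ ShortComplex.mk f g w :=
    { τ₁ := p₁, τ₂ := b, τ₃ := p₃, comm₁₂ := hb₁.symm, comm₂₃ := hb₂ }
  have : Mono φ.τ₃ := hp₃
  have hb : Mono φ.τ₂ :=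
    ShortComplex.mono_of_mono_of_mono_of_mono φ hS.exact hB.mono_f hp₁ hp₃
  exact ⟨B, b, hb, filtered_extension hB hB₁ hB₃,
    filtered_extension (shortExact_cokernel_map hS hB φ) hZ₁ hZ₃⟩

lemma HasLeftApprox.of_iso {X Y : C} (e : X ≅ Y) (h : H.HasLeftApprox X) : H.HasLeftApprox Y := by
  obtain ⟨Z, p, hp, hZ, hB⟩ := h
  exact ⟨Z, p ≫ e.hom, inferInstance, hZ, filtered_of_iso (kernelCompMono p e.hom).symm hB⟩

lemma HasRightApprox.of_iso {X Y : C} (e : X ≅ Y) (h : H.HasRightApprox X) :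
    H.HasRightApprox Y := by
  obtain ⟨Z, p, hp, hZ, hB⟩ := h
  exact ⟨Z, e.inv ≫ p, inferInstance, hZ, filtered_of_iso (cokernelEpiComp e.inv p).symm hB⟩

lemma HasLeftApprox.of_isZero {X : C} (h : IsZero X) : H.HasLeftApprox X :=
  ⟨X, 𝟙 X, inferInstance, filtered_of_isZero _ h, filtered_of_isZero _ (h.of_mono (kernel.ι _))⟩

lemma HasRightApprox.of_isZero {X : C} (h : IsZero X) : H.HasRightApprox X :=
  ⟨X, 𝟙 X, inferInstance, filtered_of_isZero _ h, filtered_of_isZero _ (h.of_epi (cokernel.π _))⟩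

lemma HasLeftApprox.of_filtered {S : Set Λ} {X : C} (hX : filtered H.L S X)
    (h : ∀ i ∈ S, H.HasLeftApprox (H.L i)) : H.HasLeftApprox X :=
  filtered_induction_of_iso (P := H.HasLeftApprox) (fun _ => .of_isZero) (fun _ _ e => .of_iso e)
    (fun _ hT _ _ => .extension hT) h hX

lemma HasRightApprox.of_filtered {S : Set Λ} {X : C} (hX : filtered H.L S X)
    (h : ∀ i ∈ S, H.HasRightApprox (H.L i)) : H.HasRightApprox X :=
  filtered_induction_of_iso (P := H.HasRightApprox) (fun _ => .of_isZero) (fun _ _ e => .of_iso e)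
    (fun _ hT _ _ => .extension hT) h hX

variable (H)

lemma finrank_hom_Δ_Δ (l : Λ) : Module.finrank 𝕜 (H.Δ l ⟶ H.Δ l) = 1 :=
  (finrank_eq_one_iff_of_nonzero' (𝟙 _) fun h => H.π_ne_zero l (by
    rw [← Category.id_comp (H.π l), h, zero_comp])).2 fun f =>
    (H.hom_Δ_Δ_eq_smul f).imp fun _ => Eq.symm

lemma finrank_hom_nabla_nabla (l : Λ) : Module.finrank 𝕜 (H.nabla l ⟶ H.nabla l) = 1 :=
  (finrank_eq_one_iff_of_nonzero' (𝟙 _) fun h => H.π_ι_ne_zero l (by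
    rw [← Category.comp_id (H.ι l), h, comp_zero, comp_zero])).2 fun f =>
    (H.hom_nabla_nabla_eq_smul f).imp fun _ => Eq.symm

/-- The endomorphisms of `Δ l` form a line, already accounted for by Hom(Δ l, L l). Hence Hom(Δ l,
kernel) = 0, and the dimension of this space is the multiplicity of `L l` in the kernel. -/
lemma kernel_π_mem (l : Λ) : filtered H.L (Set.Iio l) (kernel (H.π l)) := by
  classical
  have hmem := (trunc H.L _).prop_of_mono (kernel.ι (H.π l)) (H.Δ_mem l)
  obtain ⟨s, hs, hs'⟩ := H.trunc_iff.1 hmem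
  have := H.finite_hom (H.Δ l) (H.Δ l)
  have h := finrank_hom_of_shortExact_right (𝕜 := 𝕜) (Y := H.Δ l) (shortExact_kernel (H.π l))
    (H.subsingleton_ext_Δ (trunc_mono H.L (Iic_subset_notGT (lt_irrefl l)) hmem))
  dsimp at h
  rw [H.finrank_hom_Δ_Δ, H.finrank_hom_Δ_L, if_pos rfl,
    H.finrank_hom_Δ hs fun i hi => not_lt_of_ge (hs' i hi)] at h
  refine ⟨s, hs, fun i hi => lt_of_le_of_ne (hs' i hi) ?_⟩
  rintro rfl
  have := List.count_pos_iff.2 hi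
  lia

lemma cokernel_ι_mem (l : Λ) : filtered H.L (Set.Iio l) (cokernel (H.ι l)) := by
  classical
  have hmem := (trunc H.L _).prop_of_epi (cokernel.π (H.ι l)) (H.nabla_mem l)
  obtain ⟨s, hs, hs'⟩ := H.trunc_iff.1 hmem
  have := H.finite_hom (H.nabla l) (H.nabla l)
  have h := finrank_hom_of_shortExact_left (𝕜 := 𝕜) (Y := H.nabla l) (shortExact_cokernel (H.ι l))
    (H.subsingleton_ext_nabla (trunc_mono H.L (Iic_subset_notGT (lt_irrefl l)) hmem))
  dsimp at h
  rw [H.finrank_hom_nabla_nabla, H.finrank_hom_L_nabla, if_pos rfl,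
    H.finrank_hom_nabla hs fun i hi => not_lt_of_ge (hs' i hi)] at h
  refine ⟨s, hs, fun i hi => lt_of_le_of_ne (hs' i hi) ?_⟩
  rintro rfl
  have := List.count_pos_iff.2 hi
  lia

include H in
/-- Induction on the weight: every set of weights satisfying a hereditary condition is the whole
weight poset. -/
lemma weight_induction {P : Λ → Prop} (h : ∀ l, (∀ k, k < l → P k) → P l) (l : Λ) : P l := by
  suffices ∀ n l, (Set.Iic l).ncard = n → P l from this _ l rfl
  intro n
  induction n using Nat.strong_induction_on with
  | _ n ih =>
  rintro l rfl
  refine h l fun k hk => ih _ (Set.ncard_lt_ncard ⟨Set.Iic_subset_Iic.2 hk.le, fun h => ?_⟩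
    (H.lowerFinite l)) k rfl
  exact hk.not_ge (h le_rfl)

/-- The two kinds of approximation feed each other. The kernel of `Δ l` → `L l` has smaller weights,
so it embeds in a costandardly filtered `B` with standardly filtered cokernel. The pushout of `Δ l`
along this embedding is an extension of that cokernel by `Δ l`, and it maps onto `L l` with kernel
`B`. The right approximation arises dually from a pullback. -/
lemma hasApprox_L (l : Λ) : H.HasLeftApprox (H.L l) ∧ H.HasRightApprox (H.L l) := by
  induction l using H.weight_induction with
  | h l ih =>
  constructor
  · obtain ⟨B, i, hi, hB, hZ⟩ := HasRightApprox.of_filtered (H.kernel_π_mem l) fun k hk => (ih k hk).2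
    have hP := IsPushout.of_hasPushout (kernel.ι (H.π l)) i
    have h₁ := shortExact_of_isPushout (shortExact_kernel (H.π l)) hP
    have h₂ := shortExact_of_isPushout (shortExact_cokernel i) hP.flip
    obtain ⟨e⟩ := kernelIso_of_shortExact h₁
    have h₃ := filtered_extension h₂ (filtered_single (F := H.Δ) (Set.mem_univ l)) hZ
    exact ⟨_, _, h₁.epi_g, h₃, filtered_of_iso e hB⟩
  · obtain ⟨Z, p, hp, hZ, hB⟩ := HasLeftApprox.of_filtered (H.cokernel_ι_mem l) fun k hk => (ih k hk).1
    have hP := IsPullback.of_hasPullback (cokernel.π (H.ι l)) p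
    have h₁ := shortExact_of_isPullback (shortExact_cokernel (H.ι l)) hP
    have h₂ := shortExact_of_isPullback (shortExact_kernel p) hP.flip
    obtain ⟨e⟩ := cokernelIso_of_shortExact h₁
    have h₃ := filtered_extension h₂ hB (filtered_single (F := H.nabla) (Set.mem_univ l))
    exact ⟨_, _, h₁.mono_f, h₃, filtered_of_iso e hZ⟩

lemma hasLeftApprox (X : C) : H.HasLeftApprox X := by
  obtain ⟨s, hs⟩ := H.finiteLength X
  exact .of_filtered (S := Set.univ) ⟨s, hs, by simp⟩ fun i _ => (H.hasApprox_L i).1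

lemma hasRightApprox (X : C) : H.HasRightApprox X := by
  obtain ⟨s, hs⟩ := H.finiteLength X
  exact .of_filtered (S := Set.univ) ⟨s, hs, by simp⟩ fun i _ => (H.hasApprox_L i).2

/-- The left approximation of `X` splits because its kernel is costandardly filtered, so `X` is a
summand of a standardly filtered object. -/
lemma subsingleton_ext_of_ext_one {n : ℕ}
    (hn : ∀ i j, Subsingleton (ExtGroup (H.Δ i) (H.nabla j) n)) {X : C}
    (hX : ∀ j, Subsingleton (ExtGroup X (H.nabla j) 1)) (j : Λ) :
    Subsingleton (ExtGroup X (H.nabla j) n) := by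
  obtain ⟨Z, p, hp, hZ, hB⟩ := H.hasLeftApprox X
  obtain ⟨s, hs⟩ := exists_lifting (shortExact_kernel p)
    (subsingleton_ext_filtered_right hB fun j _ => hX j) (𝟙 X)
  exact subsingleton_ext_of_retract_left ⟨s, p, hs⟩ (subsingleton_ext_filtered_left hZ fun i _ => hn i j)

/-- Dimension shift: a class of degree n + 2 is effaced by an epimorphism onto `Δ i` from a
standardly filtered object. Its kernel has no Ext¹ into costandard objects, by the Ext¹ and Ext²
axioms, so `subsingleton_ext_of_ext_one` and induction make its Ext groups in degree n + 1 vanish.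
-/
lemma ext_Δ_nabla (n : ℕ) (i j : Λ) : Subsingleton (ExtGroup (H.Δ i) (H.nabla j) (n + 1)) := by
  induction n generalizing i j with
  | zero => exact H.ext_one i j
  | succ n ih =>
    refine subsingleton_of_forall_eq 0 fun x => ?_
    obtain ⟨P, p, hp, h⟩ := exists_epi_comp_eq_zero x
    obtain ⟨Z, q, hq, hZ, -⟩ := H.hasLeftApprox P
    have h' : (Ext.mk₀ (q ≫ p)).comp x (zero_add _) = 0 := by
      rw [← Ext.mk₀_comp_mk₀_assoc, h, Ext.comp_zero]
    have hN : ∀ j, Subsingleton (ExtGroup (kernel (q ≫ p)) (H.nabla j) 1) := fun j =>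
      subsingleton_of_forall_eq 0 fun z => by
        obtain ⟨t, rfl⟩ := Ext.contravariant_sequence_exact₁ (shortExact_kernel (q ≫ p)) _ z
          (show 1 + 1 = 2 from rfl) ((H.ext_two i j).elim _ _)
        rw [(subsingleton_ext_filtered_left hZ fun i _ => H.ext_one i j).elim t 0, Ext.comp_zero]
    obtain ⟨y, rfl⟩ := Ext.contravariant_sequence_exact₃ (shortExact_kernel (q ≫ p)) _ x h'
      (add_comm 1 (n + 1))
    rw [(H.subsingleton_ext_of_ext_one ih hN j).elim y 0, Ext.comp_zero]

end HighestWeightCategory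

/-! ### Realising derived maps by chain maps -/

section Realization

open DerivedCategory Pretriangulated

variable {C : Type u} [Category.{v} C] [Abelian C]

lemma nonempty_iso_obj₁ {D : Type*} [Category* D] [HasZeroObject D] [HasShift D ℤ]
    [Preadditive D] [∀ n : ℤ, (shiftFunctor D n).Additive] [Pretriangulated D]
    {T T' : Triangle D} (hT : T ∈ distTriang D) (hT' : T' ∈ distTriang D)
    (e₂ : T.obj₂ ≅ T'.obj₂) (e₃ : T.obj₃ ≅ T'.obj₃) (h : T.mor₂ ≫ e₃.hom = e₂.hom ≫ T'.mor₂) :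
    Nonempty (T.obj₁ ≅ T'.obj₁) := by
  obtain ⟨a, ha, ha'⟩ := complete_distinguished_triangle_morphism₁ T T' hT hT' e₂.hom e₃.hom h
  have : IsIso a := isIso₁_of_isIso₂₃ (Triangle.homMk T T' a e₂.hom e₃.hom ha h ha') hT hT'
    (show IsIso e₂.hom from inferInstance) (show IsIso e₃.hom from inferInstance)
  exact ⟨asIso a⟩

lemma isIso_of_quasiIso_of_isStrictly {X Y : CochainComplex C ℤ} [X.IsStrictlyGE 0]
    [X.IsStrictlyLE 0] [Y.IsStrictlyGE 0] [Y.IsStrictlyLE 0] (s : X ⟶ Y) [QuasiIso s] :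
    IsIso s := by
  obtain ⟨M, ⟨a⟩⟩ := X.exists_iso_single 0
  obtain ⟨N, ⟨b⟩⟩ := Y.exists_iso_single 0
  obtain ⟨m, hm⟩ := (sg C 0).map_surjective (a.inv ≫ s ≫ b.hom)
  have h₁ : QuasiIso ((sg C 0).map m) := by
    rw [hm]
    infer_instance
  have h₂ : IsIso ((HomologicalComplex.homologyFunctor C (ComplexShape.up ℤ) 0).map
      ((sg C 0).map m)) := (quasiIsoAt_iff_isIso_homologyMap _ 0).1 inferInstance
  have h₃ : IsIso m := (NatIso.isIso_map_iff
    (HomologicalComplex.homologyFunctorSingleIso C (ComplexShape.up ℤ) 0) m).1 h₂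
  have h₄ : s = a.hom ≫ (sg C 0).map m ≫ b.inv := by simp [hm]
  rw [h₄]
  infer_instance

instance isStrictlyGE_sg (X : C) (j : ℤ) :
    CochainComplex.IsStrictlyGE ((sg C j).obj X) j := by
  rw [CochainComplex.isStrictlyGE_iff]
  exact fun i hi => HomologicalComplex.isZero_single_obj_X _ _ _ _ hi.ne

instance isStrictlyLE_sg (X : C) (j : ℤ) :
    CochainComplex.IsStrictlyLE ((sg C j).obj X) j := by
  rw [CochainComplex.isStrictlyLE_iff]
  exact fun i hi => HomologicalComplex.isZero_single_obj_X _ _ _ _ hi.ne'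

/-- The roof can be chosen with its apex in degree zero only, and then its denominator is an
isomorphism. Honest chain maps are needed because cones of tilting complexes are formed termwise. -/
lemma exists_Q_map_eq_from_single {X : C} {K : CochainComplex C ℤ} [K.IsStrictlyGE 0]
    (f : Q.obj ((sg C 0).obj X) ⟶ Q.obj K) : ∃ g : (sg C 0).obj X ⟶ K, Q.map g = f := by
  obtain ⟨X', _, _, s, hs, g, rfl⟩ := right_fac_of_isStrictlyLE_of_isStrictlyGE 0 0 f
  rw [isIso_Q_map_iff_quasiIso] at hs
  have := isIso_of_quasiIso_of_isStrictly s
  exact ⟨inv s ≫ g, by simp⟩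

lemma exists_Q_map_eq_to_single {X : C} {K : CochainComplex C ℤ} [K.IsStrictlyLE 0]
    (f : Q.obj K ⟶ Q.obj ((sg C 0).obj X)) : ∃ g : K ⟶ (sg C 0).obj X, Q.map g = f := by
  obtain ⟨X', _, _, g, s, hs, rfl⟩ := left_fac_of_isStrictlyLE_of_isStrictlyGE 0 0 f
  rw [isIso_Q_map_iff_quasiIso] at hs
  have := isIso_of_quasiIso_of_isStrictly s
  exact ⟨g ≫ inv s, by simp⟩

end Realization

/-! ### Existence of bounded tilting complexes -/

namespace HighestWeightCategory

variable {𝕜 : Type v} [Field 𝕜] {C : Type u} [Category.{v} C] [Abelian C] [Linear 𝕜 C]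
  {Λ : Type w} [PartialOrder Λ] {H : HighestWeightCategory 𝕜 C Λ}

variable (H) in
/-- Bounded complexes of tilting objects, as complexes in the ambient category. -/
structure IsTiltingComplex (K : CochainComplex C ℤ) : Prop where
  tilting : ∀ i, H.tilting (K.X i)
  bounded : IsBoundedComplex K

open CochainComplex

lemma IsTiltingComplex.mappingCone {K L : CochainComplex C ℤ} (hK : H.IsTiltingComplex K)
    (hL : H.IsTiltingComplex L) (φ : K ⟶ L) : H.IsTiltingComplex (mappingCone φ) where
  tilting i := tilting_of_iso (HomologicalComplex.homotopyCofiber.XIsoBiprod φ i (i + 1) rfl).symm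
    (tilting_biprod (hK.tilting _) (hL.tilting _))
  bounded := by
    obtain ⟨a, b, h⟩ := hK.bounded
    obtain ⟨a', b', h'⟩ := hL.bounded
    refine ⟨min (a - 1) a', max b b', fun i hi => ?_⟩
    rw [mappingCone.isZero_X_iff]
    exact ⟨h _ (by grind), h' _ (by grind)⟩

lemma IsTiltingComplex.mappingCocone {K L : CochainComplex C ℤ} (hK : H.IsTiltingComplex K)
    (hL : H.IsTiltingComplex L) (φ : K ⟶ L) : H.IsTiltingComplex (mappingCocone φ) where
  tilting i := (hK.mappingCone hL φ).tilting (i + -1)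
  bounded := by
    obtain ⟨a, b, h⟩ := (hK.mappingCone hL φ).bounded
    exact ⟨a + 1, b + 1, fun i hi => h (i + -1) (by grind)⟩

lemma isTiltingComplex_sg {X : C} (hX : H.tilting X) : H.IsTiltingComplex ((sg C 0).obj X) where
  tilting i := by
    by_cases h : i = 0
    · subst h
      exact tilting_of_iso (HomologicalComplex.singleObjXSelf _ 0 X).symm hX
    · exact tilting_of_isZero (HomologicalComplex.isZero_single_obj_X _ _ _ _ h)
  bounded := ⟨0, 0, fun i hi => HomologicalComplex.isZero_single_obj_X _ _ _ _ (by lia)⟩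

/-- The weights that are smaller than a weight in `S`. -/
def smaller (S : Set Λ) : Set Λ := {k | ∃ s ∈ S, k < s}

section

variable {T : Λ → C} (hT : ∀ l, H.IsIndecomposableTilting l (T l))
include hT

/-- For `Δ l` take the embedding into `T l`. Extensions are treated by a horseshoe, which is
unobstructed since standardly filtered objects have no Ext¹ into tilting objects. That the weights
of the cokernel drop strictly is what makes iterated embeddings terminate. -/
lemma exists_mono_tilting {S : Set Λ} {Z : C} (hZ : filtered H.Δ S Z) :
    ∃ (X : C) (i : Z ⟶ X), Mono i ∧ H.tilting X ∧ filtered H.Δ (smaller S) (cokernel i) := by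
  refine filtered_induction_of_iso (P := fun Z => ∃ (X : C) (i : Z ⟶ X), Mono i ∧ H.tilting X ∧
    filtered H.Δ (smaller S) (cokernel i)) (fun Z hZ => ?_) (fun X Y e h => ?_)
    (fun A hA hA₁ hA₃ h₁ h₃ => ?_) (fun l hl => ?_) hZ
  · exact ⟨Z, 𝟙 Z, inferInstance, tilting_of_isZero hZ, filtered_of_isZero _
      (hZ.of_epi (cokernel.π _))⟩
  · obtain ⟨Z, i, hi, hZ, h⟩ := h
    exact ⟨Z, e.inv ≫ i, inferInstance, hZ, filtered_of_iso (cokernelEpiComp e.inv i).symm h⟩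
  · obtain ⟨X₁, i₁, hi₁, hX₁, hc₁⟩ := h₁
    obtain ⟨X₃, i₃, hi₃, hX₃, hc₃⟩ := h₃
    obtain ⟨b, hb⟩ := exists_extension hA (subsingleton_ext_filtered_left hA₃
      fun l _ => (extOrthogonal_of_tilting hX₁).1 l) i₁
    let φ : A ⟶ ShortComplex.mk (biprod.inl : X₁ ⟶ X₁ ⊞ X₃) biprod.snd (by simp) :=
      { τ₁ := i₁
        τ₂ := biprod.lift b (A.g ≫ i₃)
        τ₃ := i₃
        comm₁₂ := by apply biprod.hom_ext <;> simp [hb]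
        comm₂₃ := by simp }
    have : Mono φ.τ₃ := hi₃
    exact ⟨_, φ.τ₂, ShortComplex.mono_of_mono_of_mono_of_mono φ hA.exact
      (shortExact_biprod X₁ X₃).mono_f hi₁ hi₃, tilting_biprod hX₁ hX₃,
      filtered_extension (shortExact_cokernel_map hA (shortExact_biprod X₁ X₃) φ) hc₁ hc₃⟩
  · exact ⟨T l, (maps hT l).j, (maps hT l).mono_j, (hT l).tilting,
      filtered_mono (show Set.Iio l ⊆ smaller S from fun k hk => ⟨l, hl, hk⟩) (maps hT l).cokernel_j⟩

lemma exists_epi_tilting {S : Set Λ} {B : C} (hB : filtered H.nabla S B) :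
    ∃ (X : C) (p : X ⟶ B), Epi p ∧ H.tilting X ∧ filtered H.nabla (smaller S) (kernel p) := by
  refine filtered_induction_of_iso (P := fun B => ∃ (X : C) (p : X ⟶ B), Epi p ∧ H.tilting X ∧
    filtered H.nabla (smaller S) (kernel p)) (fun Z hZ => ?_) (fun X Y e h => ?_)
    (fun A hA hA₁ hA₃ h₁ h₃ => ?_) (fun l hl => ?_) hB
  · exact ⟨Z, 𝟙 Z, inferInstance, tilting_of_isZero hZ, filtered_of_isZero _
      (hZ.of_mono (kernel.ι _))⟩
  · obtain ⟨Z, i, hi, hZ, h⟩ := h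
    exact ⟨Z, i ≫ e.hom, inferInstance, hZ, filtered_of_iso (kernelCompMono i e.hom).symm h⟩
  · obtain ⟨X₁, i₁, hi₁, hX₁, hc₁⟩ := h₁
    obtain ⟨X₃, i₃, hi₃, hX₃, hc₃⟩ := h₃
    obtain ⟨b, hb⟩ := exists_lifting hA (subsingleton_ext_filtered_right hA₁
      fun l _ => (extOrthogonal_of_tilting hX₃).2 l) i₃
    let φ : ShortComplex.mk (biprod.inl : X₁ ⟶ X₁ ⊞ X₃) biprod.snd (by simp) ⟶ A :=
      { τ₁ := i₁
        τ₂ := biprod.desc (i₁ ≫ A.f) b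
        τ₃ := i₃
        comm₁₂ := by simp
        comm₂₃ := by apply biprod.hom_ext' <;> simp [hb] }
    have : Epi φ.τ₁ := hi₁
    exact ⟨_, φ.τ₂, ShortComplex.epi_of_epi_of_epi_of_epi φ hA.exact
      (shortExact_biprod X₁ X₃).epi_g hi₁ hi₃, tilting_biprod hX₁ hX₃,
      filtered_extension (shortExact_kernel_map (shortExact_biprod X₁ X₃) hA φ) hc₁ hc₃⟩
  · exact ⟨T l, (maps hT l).q, (maps hT l).epi_q, (hT l).tilting,
      filtered_mono (show Set.Iio l ⊆ smaller S from fun k hk => ⟨l, hl, hk⟩) (maps hT l).kernel_q⟩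

end

include H in
variable (H) in
/-- Induction over finite sets of weights, passing from a set to the set of smaller weights. -/
lemma smaller_induction {P : Set Λ → Prop} (h₀ : P ∅) (h : ∀ S, S.Finite → P (smaller S) → P S)
    {S : Set Λ} (hS : S.Finite) : P S := by
  have hfin : ∀ S : Set Λ, S.Finite → (S ∪ smaller S).Finite := fun S hS => by
    refine (hS.biUnion fun s _ => H.lowerFinite s).subset ?_
    rintro k (hk | ⟨s, hs, hk⟩)
    · exact Set.mem_biUnion hk le_rfl
    · exact Set.mem_biUnion hs hk.le
  suffices ∀ n (S : Set Λ), S.Finite → (S ∪ smaller S).ncard = n → P S from this _ S hS rfl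
  intro n
  induction n using Nat.strong_induction_on with
  | _ n ih =>
  rintro S hS rfl
  by_cases hne : S.Nonempty
  -- The measure is the cardinality of `S ∪ smaller S`. It drops because a maximal element of `S` is
  -- lost on passing to `smaller S`.
  · refine h S hS (ih _ (Set.ncard_lt_ncard ⟨?_, fun hsub => ?_⟩ (hfin S hS)) _
      ((hfin S hS).subset Set.subset_union_right) rfl)
    · rintro k (hk | ⟨s, ⟨t, ht, hst⟩, hk⟩)
      · exact Or.inr hk
      · exact Or.inr ⟨t, ht, hk.trans hst⟩
    · obtain ⟨m, hm⟩ := hS.exists_maximal hne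
      rcases hsub (Or.inl hm.prop) with ⟨s, hs, hms⟩ | ⟨s, ⟨t, ht, hst⟩, hms⟩
      · exact hms.not_ge (hm.le_of_ge hs hms.le)
      · exact (hms.trans hst).not_ge (hm.le_of_ge ht (hms.trans hst).le)
  · rw [Set.not_nonempty_iff_eq_empty.1 hne]
    exact h₀

lemma isZero_of_filtered_empty {Λ : Type*} {F : Λ → C} {X : C} (h : filtered F ∅ X) : IsZero X := by
  obtain ⟨s, hs, hs'⟩ := h
  cases hs with
  | zero hX => exact hX
  | step => exact (hs' _ List.mem_cons_self).elim

lemma exists_finite_filtered {Λ : Type*} {F : Λ → C} {X : C} (h : filtered F Set.univ X) :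
    ∃ S : Set Λ, S.Finite ∧ filtered F S X := by
  obtain ⟨s, hs, -⟩ := h
  exact ⟨{i | i ∈ s}, s.finite_toSet, s, hs, fun _ => id⟩

open DerivedCategory Pretriangulated

variable {T : Λ → C} (hT : ∀ l, H.IsIndecomposableTilting l (T l))
include hT

/-- Embed `Z` in a tilting object with standardly filtered cokernel of smaller weights and take the
cocone of the map to a coresolution of that cokernel. The bound on degrees is carried along so that
derived maps into `K` from an object in degree zero come from chain maps. -/
lemma exists_tilting_coresolution {S : Set Λ} (hS : S.Finite) :
    ∀ Z : C, filtered H.Δ S Z → ∃ K : CochainComplex C ℤ, H.IsTiltingComplex K ∧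
      K.IsStrictlyGE 0 ∧ Nonempty (Q.obj ((sg C 0).obj Z) ≅ Q.obj K) := by
  refine H.smaller_induction (P := fun S => ∀ Z : C, filtered H.Δ S Z → ∃ K : CochainComplex C ℤ,
    H.IsTiltingComplex K ∧ K.IsStrictlyGE 0 ∧ Nonempty (Q.obj ((sg C 0).obj Z) ≅ Q.obj K))
    (fun Z hZ => ?_) (fun S _ ih Z hZ => ?_) hS
  · exact ⟨(sg C 0).obj Z, isTiltingComplex_sg (tilting_of_isZero (isZero_of_filtered_empty hZ)),
      inferInstance, ⟨Iso.refl _⟩⟩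
  · obtain ⟨X, i, hi, hX, hc⟩ := exists_mono_tilting hT hZ
    obtain ⟨K, hK, _, ⟨e⟩⟩ := ih _ hc
    obtain ⟨g, hg⟩ := exists_Q_map_eq_from_single e.hom
    let ψ := (sg C 0).map (cokernel.π i) ≫ g
    refine ⟨mappingCocone ψ, (isTiltingComplex_sg hX).mappingCocone hK ψ, ?_, ?_⟩
    · rw [isStrictlyGE_iff]
      intro k hk
      refine (mappingCone.isZero_X_iff ψ (k + -1)).2 ⟨?_, ?_⟩
      · exact HomologicalComplex.isZero_single_obj_X _ _ _ _ (by lia)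
      · exact K.isZero_of_isStrictlyGE 0 _ (by lia)
    · exact nonempty_iso_obj₁ (shortExact_cokernel i).singleTriangle_distinguished
        (mappingCocone_triangle_distinguished ψ) (Iso.refl _) e (by
          change Q.map ((sg C 0).map (cokernel.π i)) ≫ e.hom = 𝟙 _ ≫ Q.map ψ
          rw [Category.id_comp, Q.map_comp, hg])

lemma exists_tilting_resolution {S : Set Λ} (hS : S.Finite) :
    ∀ B : C, filtered H.nabla S B → ∃ K : CochainComplex C ℤ, H.IsTiltingComplex K ∧
      K.IsStrictlyLE 0 ∧ Nonempty (Q.obj K ≅ Q.obj ((sg C 0).obj B)) := by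
  refine H.smaller_induction (P := fun S => ∀ B : C, filtered H.nabla S B →
    ∃ K : CochainComplex C ℤ, H.IsTiltingComplex K ∧ K.IsStrictlyLE 0 ∧
      Nonempty (Q.obj K ≅ Q.obj ((sg C 0).obj B))) (fun Z hZ => ?_) (fun S _ ih B hB => ?_) hS
  · exact ⟨(sg C 0).obj Z, isTiltingComplex_sg (tilting_of_isZero (isZero_of_filtered_empty hZ)),
      inferInstance, ⟨Iso.refl _⟩⟩
  · obtain ⟨X, p, hp, hX, hc⟩ := exists_epi_tilting hT hB
    obtain ⟨K, hK, _, ⟨e⟩⟩ := ih _ hc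
    obtain ⟨g, hg⟩ := exists_Q_map_eq_to_single e.hom
    let ψ := g ≫ (sg C 0).map (kernel.ι p)
    refine ⟨mappingCone ψ, hK.mappingCone (isTiltingComplex_sg hX) ψ, ?_, ?_⟩
    · rw [isStrictlyLE_iff]
      intro k hk
      refine (mappingCone.isZero_X_iff ψ k).2 ⟨?_, ?_⟩
      · exact K.isZero_of_isStrictlyLE 0 _ (by lia)
      · exact HomologicalComplex.isZero_single_obj_X _ _ _ _ (by lia)
    · exact ⟨Triangle.π₃.mapIso (isoTriangleOfIso₁₂ _ _ (mappingCone_triangle_distinguished ψ)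
        (shortExact_kernel p).singleTriangle_distinguished e (Iso.refl _) (by
          change Q.map ψ ≫ 𝟙 _ = e.hom ≫ Q.map ((sg C 0).map (kernel.ι p))
          rw [Category.comp_id, Q.map_comp, hg]))⟩

/-- Every object is isomorphic to a bounded tilting complex in the derived category. -/
lemma exists_tilting_complex (M : C) : ∃ K : CochainComplex C ℤ, H.IsTiltingComplex K ∧
    Nonempty (Q.obj K ≅ Q.obj ((sg C 0).obj M)) := by
  obtain ⟨B, i, hi, hB, hZ⟩ := H.hasRightApprox M
  obtain ⟨S, hS, hB⟩ := exists_finite_filtered hB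
  obtain ⟨S', hS', hZ⟩ := exists_finite_filtered hZ
  obtain ⟨K, hK, _, ⟨e⟩⟩ := exists_tilting_resolution hT hS B hB
  obtain ⟨K', hK', _, ⟨e'⟩⟩ := exists_tilting_coresolution hT hS' _ hZ
  obtain ⟨g, hg⟩ := exists_Q_map_eq_to_single e.hom
  obtain ⟨g', hg'⟩ := exists_Q_map_eq_from_single e'.hom
  -- `M` is the fibre of `B` → `cokernel i`. As `K` models `B` from the left and `K'` models the
  -- cokernel from the right, `ψ` models this map and its cocone models `M`.
  let ψ := g ≫ (sg C 0).map (cokernel.π i) ≫ g'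
  exact ⟨mappingCocone ψ, hK.mappingCocone hK' ψ,
    nonempty_iso_obj₁ (mappingCocone_triangle_distinguished ψ)
      (shortExact_cokernel i).singleTriangle_distinguished e e'.symm (by
        change Q.map ψ ≫ e'.inv = e.hom ≫ Q.map ((sg C 0).map (cokernel.π i))
        rw [Q.map_comp, Q.map_comp, hg, hg', Category.assoc, Category.assoc, Iso.hom_inv_id,
          Category.comp_id])⟩

end HighestWeightCategory

/-! ### Splitting off contractible summands -/

section Splitting

open DerivedCategory

variable {C : Type u} [Category.{v} C] [Abelian C]

/-- The homotopy given by a single map `K.X (i + 1) ⟶ K.X i`. -/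
def singleHomotopy (K : CochainComplex C ℤ) (i : ℤ) (h : K.X (i + 1) ⟶ K.X i) (j k : ℤ)
    (_ : k + 1 = j) : K.X j ⟶ K.X k :=
  if hk : k = i then
    eqToHom (by subst hk; congr 1; symm; assumption) ≫ h ≫ eqToHom (by rw [hk])
  else 0

lemma singleHomotopy_self (K : CochainComplex C ℤ) (i : ℤ) (h : K.X (i + 1) ⟶ K.X i)
    (hr : i + 1 = i + 1) : singleHomotopy K i h (i + 1) i hr = h := by
  simp [singleHomotopy]

lemma singleHomotopy_of_ne (K : CochainComplex C ℤ) (i : ℤ) (h : K.X (i + 1) ⟶ K.X i) {j k : ℤ}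
    (hr : k + 1 = j) (hk : k ≠ i) : singleHomotopy K i h j k hr = 0 := by
  simp [singleHomotopy, hk]

/-- A component of a differential that is an identity can be split off without changing the
complex in the derived category. -/
lemma exists_retract_of_split {K : CochainComplex C ℤ} {i : ℤ} {W : C} (hW : ¬ IsZero W)
    (a : W ⟶ K.X i) (b : K.X (i + 1) ⟶ W) (h : a ≫ K.d i (i + 1) ≫ b = 𝟙 W) :
    ∃ (K' : CochainComplex C ℤ) (r : Retract K' K), Nonempty (Q.obj K' ≅ Q.obj K) ∧
      ¬ IsZero (kernel (r.r.f i)) := by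
  -- The null-homotopic map given by the homotopy `b ≫ a` is idempotent because `a ≫ d ≫ b` is the
  -- identity. It projects onto the contractible summand built from `W`, and the new complex is the
  -- image of 1 - e.
  let e : K ⟶ K := Homotopy.nullHomotopicMap' fun j k hr => singleHomotopy K i (b ≫ a) j k hr
  have he (j : ℤ) : e.f j = K.d j (j + 1) ≫ singleHomotopy K i (b ≫ a) (j + 1) j rfl +
      singleHomotopy K i (b ≫ a) j (j - 1) (sub_add_cancel j 1) ≫ K.d (j - 1) j :=
    Homotopy.nullHomotopicMap'_f (k₀ := j + 1) (k₁ := j) (k₂ := j - 1) (sub_add_cancel j 1) rfl _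
  have h₁ : e.f i = K.d i (i + 1) ≫ b ≫ a := by
    rw [he, singleHomotopy_self, singleHomotopy_of_ne _ _ _ _ (by lia), zero_comp, add_zero]
  have h₂ : ∀ j, j ≠ i → j ≠ i + 1 → e.f j = 0 := fun j hj hj' => by
    rw [he, singleHomotopy_of_ne _ _ _ _ hj, singleHomotopy_of_ne _ _ _ _ (by lia), zero_comp,
      comp_zero, add_zero]
  have h₃ : e.f (i + 1) = b ≫ a ≫ K.d i (i + 1) := by
    rw [he, singleHomotopy_of_ne _ _ _ _ (by lia), comp_zero, zero_add]
    have : ∀ (k : ℤ) (hk : k = i) (hr : k + 1 = i + 1),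
        singleHomotopy K i (b ≫ a) (i + 1) k hr ≫ K.d k (i + 1) = b ≫ a ≫ K.d i (i + 1) := by
      rintro k rfl hr
      rw [singleHomotopy_self, Category.assoc]
    exact this _ (by lia) _
  have hee : e ≫ e = e := by
    ext j
    rw [HomologicalComplex.comp_f]
    by_cases hj : j = i
    · subst hj
      rw [h₁]
      simp only [Category.assoc, reassoc_of% h]
    · by_cases hj' : j = i + 1
      · subst hj'
        rw [h₃]
        simp only [Category.assoc, reassoc_of% h]
      · rw [h₂ j hj hj', zero_comp]
  have hQ : Q.map e = 0 := by
    rw [← Q.map_zero]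
    exact Q_map_eq_of_homotopy _ (Homotopy.nullHomotopy' _)
  have hf : (𝟙 K - e) ≫ (𝟙 K - e) = 𝟙 K - e := by
    simp [Preadditive.sub_comp, Preadditive.comp_sub, hee]
  let r := retractOfIdempotent _ hf
  have hr : r.r ≫ r.i = 𝟙 K - e := Limits.image.fac _
  refine ⟨_, r, ⟨⟨Q.map r.i, Q.map r.r, ?_, ?_⟩⟩, fun hz => ?_⟩
  · rw [← Q.map_comp, r.retract, Q.map_id]
  · rw [← Q.map_comp, hr, Q.map_sub, hQ, sub_zero, Q.map_id]
  -- The retraction kills `a`, so if its kernel in degree `i` were zero then `a` and hence `W` would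
  -- be zero.
  · have h₄ : r.r.f i ≫ r.i.f i = 𝟙 _ - e.f i := by
      rw [← HomologicalComplex.comp_f, hr]
      rfl
    have h₅ : (a ≫ r.r.f i) ≫ r.i.f i = 0 := by
      rw [Category.assoc, h₄, Preadditive.comp_sub, h₁, reassoc_of% h, Category.comp_id, sub_self]
    have h₆ : r.i.f i ≫ r.r.f i = 𝟙 _ := by
      rw [← HomologicalComplex.comp_f, r.retract]
      rfl
    have h₇ : a ≫ r.r.f i = 0 := by
      rw [← Category.comp_id (a ≫ r.r.f i), ← h₆, ← Category.assoc, h₅, zero_comp]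
    have : Mono (r.r.f i) := Preadditive.mono_of_isZero_kernel _ hz
    have h₈ : a = 0 := by rw [← cancel_mono (r.r.f i), h₇, zero_comp]
    rw [h₈, zero_comp] at h
    exact hW ((IsZero.iff_id_eq_zero W).2 h.symm)

/-- A retract of complexes induces retracts in each degree. -/
def retractEval {K' K : CochainComplex C ℤ} (r : Retract K' K) (j : ℤ) : Retract (K'.X j) (K.X j) :=
  r.map (HomologicalComplex.eval C (ComplexShape.up ℤ) j)

lemma exists_retract_of_idempotent {X : C} {e : X ⟶ X} (h : e ≫ e = e) (he : e ≠ 0) :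
    ∃ (W : C) (r : Retract W X), ¬ IsZero W ∧ r.r ≫ r.i = e :=
  ⟨_, retractOfIdempotent e h, not_isZero_image he, Limits.image.fac _⟩

end Splitting

section Radical

lemma isNilpotent_of_forall_mul {R : Type*} [Ring R] {x : R}
    (h : ∀ y, IsNilpotent (y * x)) : x ∈ Ring.jacobson R := by
  rw [← Ideal.jacobson_bot, Ideal.mem_jacobson_iff]
  intro y
  obtain ⟨u, hu⟩ := (h y).isUnit_add_one
  refine ⟨u⁻¹.1, ?_⟩
  have : u⁻¹.1 * (y * x + 1) = 1 := by rw [← hu, Units.inv_mul]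
  rw [mul_add, mul_one, ← mul_assoc] at this
  rw [this, sub_self]
  exact Submodule.zero_mem _

end Radical

/-! ### Minimal tilting complexes: existence -/

namespace HighestWeightCategory

variable {𝕜 : Type v} [Field 𝕜] {C : Type u} [Category.{v} C] [Abelian C] [Linear 𝕜 C]
  {Λ : Type w} [PartialOrder Λ] {H : HighestWeightCategory 𝕜 C Λ}

variable (H) in
lemma finite_hom_tilt (X Y : H.Tilt) : Module.Finite 𝕜 (X ⟶ Y) := by
  have := H.finite_hom X.obj Y.obj
  let e : (X.obj ⟶ Y.obj) →ₗ[𝕜] (X ⟶ Y) :=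
    { toFun := fun f => ObjectProperty.homMk f
      map_add' := fun _ _ => rfl
      map_smul' := fun _ _ => rfl }
  exact Module.Finite.of_surjective e fun f => ⟨f.hom, rfl⟩

/-- A map of tilting objects that does not belong to the radical is an isomorphism on some nonzero
summand. -/
lemma exists_split_of_notMem_radical {X Y : H.Tilt} {f : X ⟶ Y} (hf : f ∉ categoryRadical X Y) :
    ∃ (W : C) (a : W ⟶ X.obj) (b : Y.obj ⟶ W), ¬ IsZero W ∧ a ≫ f.hom ≫ b = 𝟙 W := by
  simp only [categoryRadical, Set.mem_ofPred_eq, not_forall] at hf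
  obtain ⟨Z, a, b, h⟩ := hf
  have : ¬ ∀ y, IsNilpotent (y * (show End Z from a ≫ f ≫ b)) :=
    fun h' => h (isNilpotent_of_forall_mul h')
  simp only [not_forall] at this
  obtain ⟨y, hy⟩ := this
  have : Module.Finite 𝕜 (End Z) := H.finite_hom_tilt Z Z
  -- A non-nilpotent endomorphism of `Z` that factors through `f` divides a nonzero idempotent. The
  -- image of this idempotent is the summand on which `f` is invertible.
  obtain ⟨e, p, he, hee, -, hpc⟩ := (isNilpotent_or_exists_idempotent 𝕜 _).resolve_left hy
  let e' : Z.obj ⟶ Z.obj := (show Z ⟶ Z from e).hom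
  let y' : Z.obj ⟶ Z.obj := (show Z ⟶ Z from y).hom
  let p' : Z.obj ⟶ Z.obj := (show Z ⟶ Z from p).hom
  have he' : e' ≫ e' = e' := congrArg (fun t : Z ⟶ Z => t.hom) hee
  have hp' : ((a.hom ≫ f.hom ≫ b.hom) ≫ y') ≫ p' = e' := congrArg (fun t : Z ⟶ Z => t.hom) hpc
  obtain ⟨W, r, hW, hr⟩ := exists_retract_of_idempotent he' fun h₀ => he
    (ObjectProperty.hom_ext _ h₀)
  refine ⟨W, r.i ≫ a.hom, b.hom ≫ y' ≫ p' ≫ r.r, hW, ?_⟩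
  · have : (r.i ≫ a.hom) ≫ f.hom ≫ b.hom ≫ y' ≫ p' ≫ r.r = r.i ≫ e' ≫ r.r := by
      rw [← hp']
      simp only [Category.assoc]
    rw [this, ← hr, Category.assoc, r.retract, Category.comp_id, r.retract]

/-- A complex of tilting objects, as a complex in the category of tilting objects. -/
def toTilt {K : CochainComplex C ℤ} (hK : ∀ i, H.tilting (K.X i)) : CochainComplex H.Tilt ℤ where
  X i := ⟨K.X i, hK i⟩
  d i j := ObjectProperty.homMk (K.d i j)
  shape i j h := ObjectProperty.hom_ext _ (K.shape i j h)
  d_comp_d' i j k _ _ := ObjectProperty.hom_ext _ (K.d_comp_d i j k)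

def complexOfTiltToTilt {K : CochainComplex C ℤ} (hK : ∀ i, H.tilting (K.X i)) :
    H.complexOfTilt (toTilt hK) ≅ K :=
  HomologicalComplex.Hom.isoOfComponents (fun i => Iso.refl (K.X i)) fun i j _ => by
    change 𝟙 _ ≫ K.d i j = K.d i j ≫ 𝟙 _
    simp

lemma isZero_tilt {X : H.Tilt} (h : IsZero X.obj) : IsZero X :=
  (IsZero.iff_id_eq_zero X).2 (ObjectProperty.hom_ext _ ((IsZero.iff_id_eq_zero _).1 h))

lemma isZero_of_isZero_tilt {X : H.Tilt} (h : IsZero X) : IsZero X.obj :=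
  (IsZero.iff_id_eq_zero _).2 (congrArg (fun t : X ⟶ X => t.hom) ((IsZero.iff_id_eq_zero X).1 h))

open DerivedCategory

variable {T : Λ → C} (hT : ∀ l, H.IsIndecomposableTilting l (T l))
include hT

/-- A differential outside the radical allows a contractible summand to be split off, which
decreases the total dimension of the endomorphism spaces of the terms. -/
lemma exists_minimal_of_isTiltingComplex {M : C} (s : Finset ℤ) (n : ℕ) :
    ∀ K : CochainComplex C ℤ, (∀ i, H.tilting (K.X i)) → (∀ i ∉ s, IsZero (K.X i)) →
      Nonempty (Q.obj K ≅ Q.obj ((sg C 0).obj M)) →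
      ∑ i ∈ s, Module.finrank 𝕜 (K.X i ⟶ K.X i) = n →
      ∃ K : CochainComplex H.Tilt ℤ, (∀ i ∉ s, IsZero (K.X i).obj) ∧ IsMinimalComplex K ∧
        IsoInDerivedCategory (H.complexOfTilt K) M := by
  induction n using Nat.strong_induction_on with
  | _ n ih =>
  rintro K hK hs ⟨e⟩ rfl
  by_cases h : IsMinimalComplex (toTilt hK)
  · exact ⟨toTilt hK, hs, h, ⟨Q.mapIso (complexOfTiltToTilt hK) ≪≫ e⟩⟩
  · simp only [IsMinimalComplex, not_forall] at h
    obtain ⟨i, hi⟩ := h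
    obtain ⟨W, a, b, hW, hab⟩ := exists_split_of_notMem_radical hi
    obtain ⟨K', r, ⟨e'⟩, hz⟩ := exists_retract_of_split hW a b hab
    have hle : ∀ j, Module.finrank 𝕜 (kernel (r.r.f j) ⟶ kernel (r.r.f j)) +
        Module.finrank 𝕜 (K'.X j ⟶ K'.X j) ≤ Module.finrank 𝕜 (K.X j ⟶ K.X j) := fun j => by
      obtain ⟨t⟩ := retractIsoBiprod (retractEval r j)
      exact finrank_end_add_le H.finite_hom t
    have hpos := finrank_end_pos H.finite_hom hz
    have his : i ∈ s := by
      by_contra his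
      exact hz ((hs i his).of_mono (kernel.ι _))
    refine ih _ (Finset.sum_lt_sum (fun j _ => ?_) ⟨i, his, ?_⟩) K'
      (fun j => tilting_of_retract hT (retractEval r j) (hK j)) (fun j hj => ?_) ⟨e' ≪≫ e⟩ rfl
    · have := hle j
      lia
    · have := hle i
      lia
    · have : Mono (retractEval r j).i := SplitMono.mono ⟨_, (retractEval r j).retract⟩
      exact (hs j hj).of_mono (retractEval r j).i

/-- Every object has a minimal tilting complex. -/
lemma exists_isMinimalTiltingComplex (M : C) :
    ∃ K : CochainComplex H.Tilt ℤ, H.IsMinimalTiltingComplex M K := by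
  obtain ⟨K, ⟨hK, a, b, hb⟩, e⟩ := exists_tilting_complex hT M
  obtain ⟨K', h₁, h₂, h₃⟩ := exists_minimal_of_isTiltingComplex hT (Finset.Icc a b) _ K hK
    (fun i hi => hb i (by rw [Finset.mem_Icc] at hi; lia)) e rfl
  exact ⟨K', ⟨a, b, fun i hi => isZero_tilt (h₁ i (by rw [Finset.mem_Icc]; lia))⟩, h₂, h₃⟩

end HighestWeightCategory

/-! ### Weights of minimal tilting complexes -/

namespace HighestWeightCategory

variable {𝕜 : Type v} [Field 𝕜] {C : Type u} [Category.{v} C] [Abelian C] [Linear 𝕜 C]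
  {Λ : Type w} [PartialOrder Λ] {H : HighestWeightCategory 𝕜 C Λ}

open DerivedCategory

/-- Maps from standard objects that are cycles but have no image in homology are boundaries. -/
lemma exists_comp_d_eq {X : CochainComplex C ℤ} {l : Λ} {i j k : ℤ} (hij : i + 1 = j)
    (hjk : j + 1 = k) (hX : trunc H.L {m | ¬ l < m} (X.X i))
    (hH : ∀ f : H.Δ l ⟶ X.homology j, f = 0) (f : H.Δ l ⟶ X.X j) (hf : f ≫ X.d j k = 0) :
    ∃ g : H.Δ l ⟶ X.X i, g ≫ X.d i j = f := by
  let S := ShortComplex.mk (X.toCycles i j) (X.homologyπ j) (X.toCycles_comp_homologyπ i j)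
  have hS : S.Exact := S.exact_of_g_is_cokernel (X.homologyIsCokernel i j (by simp [← hij]))
  have hepi : Epi (kernel.lift S.g S.f S.zero) := S.exact_iff_epi_kernel_lift.1 hS
  let c : H.Δ l ⟶ S.X₂ := X.liftCycles f k (by simp [← hjk]) hf
  have hc : c ≫ S.g = 0 := hH _
  -- `c` dies in homology, so it lands in the boundaries, onto which `X.X i` maps. The kernel of
  -- that map is a subobject of `X.X i`, so no weight above `l` obstructs lifting.
  obtain ⟨g, hg⟩ := exists_lifting (shortExact_kernel (kernel.lift S.g S.f S.zero))
    (H.subsingleton_ext_Δ ((trunc H.L _).prop_of_mono (kernel.ι _) hX)) (kernel.lift S.g c hc)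
  refine ⟨g, ?_⟩
  have h₁ : g ≫ S.f = c := by
    have := congrArg (fun t => t ≫ kernel.ι S.g) hg
    simpa using this
  calc g ≫ X.d i j = (g ≫ S.f) ≫ X.iCycles j := by simp [S]
    _ = f := by rw [h₁]; simp [c]

lemma hom_homology_eq_zero {X : CochainComplex C ℤ} {l m : Λ} (hm : m ≠ l)
    (hX : IsoInDerivedCategory X (H.L l)) (i : ℤ) (f : H.Δ m ⟶ X.homology i) : f = 0 := by
  obtain ⟨e⟩ := hX
  let e' : X.homology i ≅ ((sg C 0).obj (H.L l)).homology i :=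
    ((homologyFunctorFactors C i).app X).symm ≪≫ (homologyFunctor C i).mapIso e ≪≫
      (homologyFunctorFactors C i).app ((sg C 0).obj (H.L l))
  by_cases hi : i = 0
  · subst hi
    let e'' := e' ≪≫ HomologicalComplex.singleObjHomologySelfIso _ 0 (H.L l)
    rw [← cancel_mono e''.hom, zero_comp]
    exact H.hom_Δ_L_eq_zero hm _
  · exact ((HomologicalComplex.isZero_single_obj_homology _ _ _ _ hi).of_iso e').eq_of_tgt _ _

/-- A nonzero composite would extend to an automorphism of `T` factoring through `f`, putting a unit
in the Jacobson radical of End(T). -/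
lemma comp_eq_zero_of_mem_radical {X Y : H.Tilt} {f : X ⟶ Y} (hf : f ∈ categoryRadical X Y)
    {l : Λ} {T : C} (hT : H.IsIndecomposableTilting l T) (a : H.Δ l ⟶ X.obj)
    (b : Y.obj ⟶ H.nabla l) : a ≫ f.hom ≫ b = 0 := by
  by_contra h
  obtain ⟨d⟩ := hT.nonempty_tiltingMaps
  obtain ⟨a, rfl⟩ := d.exists_extension (extOrthogonal_of_tilting X.property) a
  obtain ⟨b, rfl⟩ := d.exists_lifting (extOrthogonal_of_tilting Y.property) b
  have := d.isIso hT.indecomposable (a ≫ f.hom ≫ b) (by simpa using h)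
  let Z : H.Tilt := ⟨T, hT.tilting⟩
  let a' : Z ⟶ X := ObjectProperty.homMk a
  let b' : Y ⟶ Z := ObjectProperty.homMk b
  have hr := hf Z a' b'
  have hu : IsUnit (show End Z from a' ≫ f ≫ b') := by
    let g : Z ⟶ Z := ObjectProperty.homMk (inv (a ≫ f.hom ≫ b))
    refine ⟨⟨a' ≫ f ≫ b', g, ?_, ?_⟩, rfl⟩
    · exact ObjectProperty.hom_ext _ (IsIso.inv_hom_id (a ≫ f.hom ≫ b))
    · exact ObjectProperty.hom_ext _ (IsIso.hom_inv_id (a ≫ f.hom ≫ b))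
  have hn : Nontrivial (End Z) := ⟨0, 1, fun h₀ => hT.indecomposable.1
    ((IsZero.iff_id_eq_zero _).2 (congrArg (fun t : Z ⟶ Z => t.hom) h₀.symm))⟩
  have htop : Ring.jacobson (End Z) = ⊤ := Ideal.eq_top_of_isUnit_mem _ hr hu
  obtain ⟨M, hM⟩ := Ideal.exists_maximal (End Z)
  exact hM.ne_top (top_le_iff.1 (htop ▸ Ring.jacobson_le_of_isMaximal M))

/-- The weights of the minimal tilting complex of `L l` are at most `l`. -/
lemma IsMinimalTiltingComplex.trunc {T : Λ → C} (hT : ∀ l, H.IsIndecomposableTilting l (T l)) {l : Λ}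
    {K : CochainComplex H.Tilt ℤ} (hK : H.IsMinimalTiltingComplex (H.L l) K) (i : ℤ) :
    trunc H.L (Set.Iic l) (K.X i).obj := by
  classical
  choose s hs using fun i => H.finiteLength (K.X i).obj
  have hmem : ∀ (Γ : Set Λ) i, (∀ k ∈ s i, k ∈ Γ) → HighestWeight.trunc H.L Γ (K.X i).obj :=
    fun Γ i h => H.trunc_iff.2 ⟨s i, hs i, h⟩
  refine hmem _ i fun k hk => ?_
  by_contra hkl
  obtain ⟨a, b, hab⟩ := hK.bounded
  let W : Set Λ := {k | ∃ i, k ∈ s i ∧ ¬ k ≤ l}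
  have hW : W.Finite := by
    refine ((Finset.Icc a b).biUnion fun i => (s i).toFinset).finite_toSet.subset ?_
    rintro k ⟨i, hk, -⟩
    simp only [Finset.coe_biUnion, Set.mem_iUnion]
    refine ⟨i, ?_, by simpa using hk⟩
    by_contra hi
    have hz := isZero_of_isZero_tilt (hab i (by simp at hi; lia))
    refine Set.notMem_empty k (H.mem_of_trunc_simple (Γ := ∅) ?_)
    exact prop_of_hasFiltration _ (hs i) (ObjectProperty.prop_of_isZero _ hz) k hk
  -- Let `m` be a maximal offending weight. Radical differentials make every map from `Δ m` to a
  -- term a cycle. The homology `L l` receives no map from `Δ m`, so the cycle is a boundary `g ≫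
  -- d`, which is zero for the same reason. This contradicts the occurrence of `L m`.
  obtain ⟨m, hm⟩ := hW.exists_maximal ⟨k, i, hk, hkl⟩
  obtain ⟨i, hi, hml⟩ := hm.1
  have hnot : ∀ i, ∀ k ∈ s i, ¬ m < k := fun i k hk hmk =>
    hmk.not_ge (hm.2 ⟨i, hk, fun h => hml (hmk.le.trans h)⟩ hmk.le)
  have htr : ∀ i, HighestWeight.trunc H.L {k | ¬ m < k} (K.X i).obj := fun i => hmem _ i (hnot i)
  have hd : ∀ i (f : H.Δ m ⟶ (K.X i).obj), f ≫ (K.d i (i + 1)).hom = 0 := fun i f => by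
    by_contra h
    obtain ⟨g, hg⟩ := H.exists_to_nabla (htr (i + 1)) _ h
    rw [Category.assoc, comp_eq_zero_of_mem_radical (hK.minimal i) (hT m)] at hg
    exact H.π_ι_ne_zero m hg.symm
  have hpos : 0 < Module.finrank 𝕜 (H.Δ m ⟶ (K.X i).obj) := by
    rw [H.finrank_hom_Δ (hs i) (hnot i)]
    exact List.count_pos_iff.2 hi
  have := H.finite_hom (H.Δ m) (K.X i).obj
  obtain ⟨f, hf⟩ := (Module.finrank_pos_iff_exists_ne_zero).1 hpos
  obtain ⟨j, rfl⟩ : ∃ j, i = j + 1 := ⟨i - 1, by lia⟩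
  obtain ⟨g, hg⟩ := exists_comp_d_eq (X := H.complexOfTilt K) (i := j) rfl rfl (htr j)
    (hom_homology_eq_zero (fun h => hml h.le) hK.iso (j + 1)) f (hd _ f)
  exact hf (hg.symm.trans (hd j g))

end HighestWeightCategory

/-! ### The Ringel duality functor -/

namespace HighestWeightCategory

variable {𝕜 : Type v} [Field 𝕜] {C : Type u} [Category.{v} C] [Abelian C] [Linear 𝕜 C]
  {Λ : Type w} [PartialOrder Λ] {H : HighestWeightCategory 𝕜 C Λ}
  {T : Λ → C} (hT : ∀ l, H.IsIndecomposableTilting l (T l)) (Γ : LowerSet Λ) [Finite Γ]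

/-- The direct sum of the tilting objects `T l` for `l` in `Γ`. -/
def tiltingSum : C := (⨁ tiltingTruncated hT Γ).obj

/-- The algebra whose modules form the Ringel dual. -/
abbrev RingelAlg : Type v := ringelAlgebra (tiltingTruncated hT Γ)

variable {Γ}

/-- The inclusion of a summand. -/
def inclT (l : Γ) : T l ⟶ tiltingSum hT Γ := (biproduct.ι (tiltingTruncated hT Γ) l).hom

/-- The projection to a summand. -/
def projT (l : Γ) : tiltingSum hT Γ ⟶ T l := (biproduct.π (tiltingTruncated hT Γ) l).hom

@[simp]
lemma inclT_projT (l : Γ) : inclT hT l ≫ projT hT l = 𝟙 (T l) :=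
  congrArg (fun f => f.hom) (biproduct.ι_π_self (tiltingTruncated hT Γ) l)

variable (Γ)

lemma sum_projT_inclT [Fintype Γ] :
    ∑ l : Γ, projT hT l ≫ inclT hT l = 𝟙 (tiltingSum hT Γ) := by
  have h := IsBilimit.total (biproduct.isBilimit (tiltingTruncated hT Γ))
  have h' := congrArg (fun f => f.hom) h
  refine Eq.trans ?_ h'
  exact (map_sum (ObjectProperty.ι (trunc H.L (Γ : Set Λ))).mapAddHom _ _).symm

variable {Γ}

/-- Endomorphisms of the sum of the tilting objects, as elements of the algebra. -/
def ofHom (f : tiltingSum hT Γ ⟶ tiltingSum hT Γ) : RingelAlg hT Γ :=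
  MulOpposite.op (show ⨁ tiltingTruncated hT Γ ⟶ ⨁ tiltingTruncated hT Γ from ObjectProperty.homMk f)

/-- Elements of the algebra, as endomorphisms of the sum of the tilting objects. -/
def toHom (a : RingelAlg hT Γ) : tiltingSum hT Γ ⟶ tiltingSum hT Γ :=
  (show ⨁ tiltingTruncated hT Γ ⟶ ⨁ tiltingTruncated hT Γ from a.unop).hom

@[simp] lemma toHom_ofHom (f : tiltingSum hT Γ ⟶ tiltingSum hT Γ) : toHom hT (ofHom hT f) = f := rfl

@[simp]
lemma inclT_projT_assoc (l : Γ) {X : C} (f : T l ⟶ X) :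
    inclT hT l ≫ projT hT l ≫ f = f := by
  rw [← Category.assoc, inclT_projT, Category.id_comp]

variable (Γ)

/-- The dual of `Hom(X, T)`, where `T` is the sum of the tilting objects. -/
abbrev DualSpace (X : C) : Type v := Module.Dual 𝕜 (X ⟶ tiltingSum hT Γ)

/-- The action of `dualHomModule`, but for all objects of `C`, so that Hom(-, T)^* becomes a functor
on `C` and can be applied to complexes there. -/
instance (X : C) : Module (RingelAlg hT Γ) (DualSpace hT Γ X) where
  smul a φ := φ.comp (Linear.rightComp 𝕜 X (toHom hT a))
  one_smul φ := LinearMap.ext fun g => congrArg φ (Category.comp_id g)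
  mul_smul a b φ := LinearMap.ext fun g =>
    congrArg φ (Category.assoc g (toHom hT a) (toHom hT b)).symm
  smul_zero _ := rfl
  smul_add _ _ _ := rfl
  add_smul a b φ := LinearMap.ext fun g =>
    (congrArg φ (Preadditive.comp_add _ _ _ g (toHom hT a) (toHom hT b))).trans (map_add φ _ _)
  zero_smul φ := LinearMap.ext fun g =>
    (congrArg φ (comp_zero : g ≫ (0 : tiltingSum hT Γ ⟶ _) = 0)).trans (map_zero φ)

variable {Γ}

@[simp]
lemma smul_dualSpace_apply {X : C} (a : RingelAlg hT Γ) (φ : DualSpace hT Γ X)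
    (g : X ⟶ tiltingSum hT Γ) : (a • φ) g = φ (g ≫ toHom hT a) := rfl

variable (Γ)

/-- The contravariant functor `Hom(-, T)`, followed by the duality. -/
def dualFunctor : C ⥤ TruncatedRingelDual hT Γ where
  obj X :=
    { obj := ModuleCat.of (RingelAlg hT Γ) (DualSpace hT Γ X)
      property := by
        have := H.finite_hom X (tiltingSum hT Γ)
        exact fdModules_of_addMonoidHom (V := DualSpace hT Γ X) (AddMonoidHom.id _)
          Function.surjective_id fun r φ => LinearMap.ext fun g => by
            change r • φ g = φ (g ≫ (r • 𝟙 (tiltingSum hT Γ)))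
            simp }
  map f := ObjectProperty.homMk (ModuleCat.ofHom
    { toFun := fun φ => φ.comp (Linear.leftComp 𝕜 (tiltingSum hT Γ) f)
      map_add' := fun _ _ => rfl
      map_smul' := fun a φ => LinearMap.ext fun g => by simp })
  map_id X := ObjectProperty.hom_ext _ (ModuleCat.hom_ext (LinearMap.ext fun φ =>
    LinearMap.ext fun g => congrArg (show DualSpace hT Γ X from φ) (Category.id_comp g)))
  map_comp {X _ _} f g := ObjectProperty.hom_ext _ (ModuleCat.hom_ext (LinearMap.ext fun φ =>
    LinearMap.ext fun h => congrArg (show DualSpace hT Γ X from φ) (Category.assoc f g h)))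

variable {Γ}

/-- Maps in the Ringel dual, as functions. -/
abbrev toFun {M N : TruncatedRingelDual hT Γ} (f : M ⟶ N) : M.obj →ₗ[RingelAlg hT Γ] N.obj := f.hom.hom

instance : (dualFunctor hT Γ).Additive where
  map_add {X Y f g} := by
    ext φ
    let φ' : DualSpace hT Γ X := φ
    exact LinearMap.ext fun h => (congrArg φ' (Preadditive.add_comp _ _ _ f g h)).trans
      (map_add φ' _ _)

/-- Hom(-, T) is exact on `S` because Ext¹(S.X₃, T) = 0, and duality of vector spaces is exact. -/
lemma shortExact_dualFunctor {S : ShortComplex C} (hS : S.ShortExact)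
    (h : Subsingleton (ExtGroup S.X₃ (tiltingSum hT Γ) 1)) :
    (S.map (dualFunctor hT Γ)).ShortExact := by
  have := hS.epi_g
  let i := Linear.leftComp 𝕜 (tiltingSum hT Γ) S.g
  let p := Linear.leftComp 𝕜 (tiltingSum hT Γ) S.f
  have hi : Function.Injective i := fun a b hab => (cancel_epi S.g).1 hab
  have hp : Function.Surjective p := exists_extension hS h
  have hip : Function.Exact i p := fun g =>
    ⟨fun hg => ⟨hS.exact.desc g hg, hS.exact.g_desc g hg⟩, by
      rintro ⟨a, rfl⟩
      change S.f ≫ S.g ≫ a = 0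
      simp⟩
  apply CategoryTheory.ShortExact.reflects_shortExact_of_faithful
    (ObjectProperty.ι (fdModules 𝕜 (RingelAlg hT Γ)))
  refine { exact := ?_, mono_f := ?_, epi_g := ?_ }
  · rw [ShortComplex.ShortExact.moduleCat_exact_iff_function_exact]
    change Function.Exact p.dualMap i.dualMap
    rw [LinearMap.exact_iff, LinearMap.ker_dualMap_eq_dualAnnihilator_range,
      LinearMap.range_dualMap_eq_dualAnnihilator_ker, LinearMap.exact_iff.1 hip]
  · rw [ModuleCat.mono_iff_injective]
    exact LinearMap.dualMap_injective_of_surjective hp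
  · rw [ModuleCat.epi_iff_surjective]
    exact LinearMap.dualMap_surjective_of_injective hi

lemma injective_toFun {M N : TruncatedRingelDual hT Γ} (f : M ⟶ N) [Mono f] :
    Function.Injective (toFun hT f) := by
  have := (fdModules 𝕜 (RingelAlg hT Γ)).preservesMonomorphisms_ι_of_isNormalEpiCategory
  exact (ModuleCat.mono_iff_injective f.hom).1
    (inferInstanceAs (Mono ((ObjectProperty.ι (fdModules 𝕜 (RingelAlg hT Γ))).map f)))

open scoped ModuleCat in
lemma injective_dualFunctor_T (l : Γ) : Injective ((dualFunctor hT Γ).obj (T l)) where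
  factors {Y Z} f i _ := by
    let f' : Y.obj →ₗ[RingelAlg hT Γ] DualSpace hT Γ (T l) := toFun hT f
    -- A linear map over the algebra into Hom(T l, T)^* is determined by its values at the inclusion
    -- of `T l`. This functional extends along the injection by linear algebra, and acting by `projT
    -- ≫ g` before evaluating recovers a module map.
    let F₀ : Y.obj →ₗ[𝕜] 𝕜 :=
      { toFun := fun y => f' y (inclT hT l)
        map_add' := fun x y => by rw [map_add]; rfl
        map_smul' := fun r y => by
          change f' ((algebraMap 𝕜 (RingelAlg hT Γ) r) • y) _ = r • f' y _
          rw [map_smul]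
          change f' y (_ ≫ (r • 𝟙 (tiltingSum hT Γ))) = _
          simp }
    obtain ⟨s, hs⟩ := LinearMap.exists_leftInverse_of_injective
      ((toFun hT i).restrictScalars 𝕜) (LinearMap.ker_eq_bot.2 (injective_toFun hT i))
    have hs' : ∀ y, s (toFun hT i y) = y := fun y => LinearMap.congr_fun hs y
    let F : Z.obj →ₗ[𝕜] 𝕜 := F₀ ∘ₗ s
    let k : Z.obj →ₗ[RingelAlg hT Γ] DualSpace hT Γ (T l) :=
      { toFun := fun z =>
          { toFun := fun g => F (ofHom hT (projT hT l ≫ g) • z)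
            map_add' := fun g g' => by
              rw [← map_add, ← add_smul, Preadditive.comp_add]
              rfl
            map_smul' := fun r g => by
              rw [RingHom.id_apply, ← map_smul, ← smul_assoc, Linear.comp_smul]
              rfl }
        map_add' := fun x y => LinearMap.ext fun g => by
          change F (_ • (x + y)) = F (_ • x) + F (_ • y)
          rw [smul_add, map_add]
        map_smul' := fun a z => LinearMap.ext fun g => by
          change F (_ • a • z) = F (ofHom hT (projT hT l ≫ g ≫ toHom hT a) • z)
          rw [← mul_smul, ← Category.assoc]
          rfl }
    refine ⟨ObjectProperty.homMk (ModuleCat.ofHom k), ?_⟩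
    ext y
    refine LinearMap.ext fun g => ?_
    change F (ofHom hT (projT hT l ≫ g) • toFun hT i y) = f' y g
    rw [← map_smul]
    change F₀ (s (toFun hT i _)) = _
    rw [hs']
    change f' _ _ = _
    rw [map_smul, smul_dualSpace_apply, toHom_ofHom, inclT_projT_assoc]

end HighestWeightCategory

/-- The radical of a local module. -/
lemma jacobson_eq_of_forall_exists_smul {R M : Type*} [Ring R] [AddCommGroup M] [Module R M]
    (N : Submodule R M) (hN : N ≠ ⊤) (h : ∀ x ∉ N, ∀ y, ∃ a : R, a • x = y) :
    Module.jacobson R M = N := by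
  have key : ∀ P : Submodule R M, ¬ P ≤ N → P = ⊤ := fun P hP => by
    obtain ⟨x, hx, hxN⟩ := SetLike.not_le_iff_exists.1 hP
    refine eq_top_iff.2 fun y _ => ?_
    obtain ⟨a, rfl⟩ := h x hxN y
    exact P.smul_mem a hx
  have hco : IsCoatom N := ⟨hN, fun P hP => key P hP.not_ge⟩
  refine le_antisymm (sInf_le hco) (le_sInf fun P hP => ?_)
  have hPN : P ≤ N := by
    by_contra h
    exact hP.1 (key P h)
  exact (hP.le_iff.1 hPN).elim (fun h => (hN h).elim) fun h => h.le

open scoped ModuleCat in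
lemma finite_hom_fdModules {𝕜 : Type v} [Field 𝕜] {A : Type v} [Ring A] [Algebra 𝕜 A]
    (M N : (fdModules 𝕜 A).FullSubcategory) : Module.Finite 𝕜 (M ⟶ N) := by
  have : Module.Finite 𝕜 M.obj := M.property
  have : Module.Finite 𝕜 N.obj := N.property
  let e : (M ⟶ N) →ₗ[𝕜] (M.obj →ₗ[𝕜] N.obj) :=
    { toFun := fun f => f.hom.hom.restrictScalars 𝕜
      map_add' := fun _ _ => rfl
      map_smul' := fun _ _ => rfl }
  refine Module.Finite.of_injective e fun f g h => ?_
  ext x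
  exact LinearMap.congr_fun h x

/-! ### Simple objects of the Ringel dual and their maps to injectives -/

namespace HighestWeightCategory

variable {𝕜 : Type v} [Field 𝕜] {C : Type u} [Category.{v} C] [Abelian C] [Linear 𝕜 C]
  {Λ : Type w} [PartialOrder Λ] {H : HighestWeightCategory 𝕜 C Λ}
  {T : Λ → C} (hT : ∀ l, H.IsIndecomposableTilting l (T l)) {Γ : LowerSet Λ} [Finite Γ]

/-- The costandard object of the Ringel dual is the image of a standard object. -/
def dualNablaIso (l : Γ) : dualNabla hT l ≅ (dualFunctor hT Γ).obj (H.Δ l) := by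
  letI := dualHomModule 𝕜 (tiltingTruncated hT Γ) (H.toTruncated l (H.Δ_mem l))
  let e : (H.toTruncated l (H.Δ_mem l) ⟶ ⨁ tiltingTruncated hT Γ) ≃ₗ[𝕜]
      (H.Δ l ⟶ tiltingSum hT Γ) :=
    { toFun := fun f => f.hom
      invFun := fun f => ObjectProperty.homMk f
      map_add' := fun _ _ => rfl
      map_smul' := fun _ _ => rfl
      left_inv := fun _ => rfl
      right_inv := fun _ => rfl }
  let e' : Module.Dual 𝕜 (H.toTruncated l (H.Δ_mem l) ⟶ ⨁ tiltingTruncated hT Γ)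
      ≃ₗ[RingelAlg hT Γ] DualSpace hT Γ (H.Δ l) :=
    { e.symm.dualMap with
      map_smul' := fun _ _ => rfl }
  exact (ObjectProperty.fullyFaithfulι _).preimageIso (LinearEquiv.toModuleIso e')

variable (mu : Γ)

/-- Maps from the sum of the tilting objects to a costandard object, as elements of a standard
object of the Ringel dual. -/
def toDualΔ : (tiltingSum hT Γ ⟶ H.nabla mu) ≃+ (dualΔ hT mu).obj where
  toFun f := show (⨁ tiltingTruncated hT Γ) ⟶ H.toTruncated mu (H.nabla_mem mu) from
    ObjectProperty.homMk f
  invFun f := (show (⨁ tiltingTruncated hT Γ) ⟶ H.toTruncated mu (H.nabla_mem mu) from f).hom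
  left_inv _ := rfl
  right_inv _ := rfl
  map_add' _ _ := rfl

lemma smul_toDualΔ (a : RingelAlg hT Γ) (h : tiltingSum hT Γ ⟶ H.nabla mu) :
    a • toDualΔ hT mu h = toDualΔ hT mu (toHom hT a ≫ h) := rfl

/-- The maps to a costandard object that vanish on all images of the standard object. -/
def dualΔRadical : Submodule (RingelAlg hT Γ) (dualΔ hT mu).obj where
  carrier := {h | ∀ f : H.Δ mu ⟶ tiltingSum hT Γ, f ≫ (toDualΔ hT mu).symm h = 0}
  zero_mem' f := by rw [map_zero, comp_zero]
  add_mem' ha hb f := by rw [map_add, Preadditive.comp_add, ha, hb, add_zero]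
  smul_mem' a h hh f := (Category.assoc _ _ _).symm.trans (hh (f ≫ toHom hT a))

lemma mem_dualΔRadical {h : tiltingSum hT Γ ⟶ H.nabla mu} :
    toDualΔ hT mu h ∈ dualΔRadical hT mu ↔ ∀ f : H.Δ mu ⟶ tiltingSum hT Γ, f ≫ h = 0 := Iff.rfl

/-- The sum is formed in the truncation, so its Ext groups in `C` are controlled through the
inclusions and projections. -/
lemma extOrthogonal_tiltingSum : H.extOrthogonal (tiltingSum hT Γ) := by
  have := Fintype.ofFinite Γ
  refine ⟨fun i => subsingleton_of_forall_eq 0 fun x => ?_,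
    fun i => subsingleton_of_forall_eq 0 fun x => ?_⟩
  · rw [← x.comp_mk₀_id, ← sum_projT_inclT, Ext.mk₀_sum, Ext.comp_sum]
    refine Finset.sum_eq_zero fun l _ => ?_
    rw [← Ext.mk₀_comp_mk₀, ← Ext.comp_assoc_of_third_deg_zero]
    have := (extOrthogonal_of_tilting (hT l).tilting).1 i
    rw [Subsingleton.elim (x.comp (Ext.mk₀ (projT hT l)) (add_zero 1)) 0, Ext.zero_comp]
  · rw [← x.mk₀_id_comp, ← sum_projT_inclT, Ext.mk₀_sum, Ext.sum_comp]
    refine Finset.sum_eq_zero fun l _ => ?_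
    rw [← Ext.mk₀_comp_mk₀, Ext.comp_assoc_of_second_deg_zero]
    have := (extOrthogonal_of_tilting (hT l).tilting).2 i
    rw [Subsingleton.elim ((Ext.mk₀ (inclT hT l)).comp x (zero_add 1)) 0, Ext.comp_zero]

/-- If `f ≫ h` is nonzero for some `f` from the standard object, then the extension of `f` to `T mu`
followed by `h` is a nonzero multiple of `q`. Every map to the costandard object lifts through `q`,
so `h` generates the whole module. Hence the submodule of the remaining elements is the unique
maximal one. -/
lemma jacobson_dualΔ : Module.jacobson (RingelAlg hT Γ) (dualΔ hT mu).obj = dualΔRadical hT mu := by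
  let d := maps hT (mu : Λ)
  have hjq : d.j ≫ d.q ≠ 0 := by
    rw [d.j_q]
    exact H.π_ι_ne_zero _
  refine jacobson_eq_of_forall_exists_smul _ (fun h => hjq ?_) fun x hx y => ?_
  · have h' : toDualΔ hT mu (projT hT mu ≫ d.q) ∈ dualΔRadical hT mu := h ▸ Submodule.mem_top
    have := (mem_dualΔRadical hT mu).1 h' (d.j ≫ inclT hT mu)
    rwa [Category.assoc, inclT_projT_assoc] at this
  · obtain ⟨h, rfl⟩ := (toDualΔ hT mu).surjective x
    obtain ⟨g, rfl⟩ := (toDualΔ hT mu).surjective y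
    rw [mem_dualΔRadical, not_forall] at hx
    obtain ⟨f, hf⟩ := hx
    obtain ⟨f, rfl⟩ := d.exists_extension (extOrthogonal_tiltingSum hT) f
    obtain ⟨g, rfl⟩ := d.exists_lifting (extOrthogonal_tiltingSum hT) g
    obtain ⟨r, hr⟩ := d.eq_smul_q (f ≫ h)
    have hr₀ : r ≠ 0 := by
      rintro rfl
      rw [Category.assoc, hr, zero_smul, comp_zero] at hf
      exact hf rfl
    refine ⟨ofHom hT (r⁻¹ • (g ≫ f)), ?_⟩
    rw [smul_toDualΔ, toHom_ofHom, Linear.smul_comp, Category.assoc, hr, Linear.comp_smul,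
      smul_smul, inv_mul_cancel₀ hr₀, one_smul]

/-- Maps from the sum of the tilting objects to a costandard object, as elements of a simple
object of the Ringel dual. -/
def toDualL : (tiltingSum hT Γ ⟶ H.nabla mu) →+ (dualL hT mu).obj :=
  ((Module.jacobson (RingelAlg hT Γ) (dualΔ hT mu).obj).mkQ.toAddMonoidHom).comp
    (toDualΔ hT mu).toAddMonoidHom

lemma toDualL_surjective : Function.Surjective (toDualL hT mu) :=
  (Submodule.mkQ_surjective _).comp (toDualΔ hT mu).surjective

lemma toDualL_eq_zero {h : tiltingSum hT Γ ⟶ H.nabla mu}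
    (hh : ∀ f : H.Δ mu ⟶ tiltingSum hT Γ, f ≫ h = 0) : toDualL hT mu h = 0 := by
  refine (Submodule.Quotient.mk_eq_zero _).2 ?_
  rw [jacobson_dualΔ]
  exact hh

variable {mu} in
/-- The pairing defined by a map from a simple object of the Ringel dual. -/
def pairing {X : C} (ψ : dualL hT mu ⟶ (dualFunctor hT Γ).obj X)
    (h : tiltingSum hT Γ ⟶ H.nabla mu) (g : X ⟶ tiltingSum hT Γ) : 𝕜 :=
  (show DualSpace hT Γ X from toFun hT ψ (toDualL hT mu h)) g

section

variable {mu} {hT} {X : C}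

lemma ext_pairing {ψ ψ' : dualL hT mu ⟶ (dualFunctor hT Γ).obj X}
    (h : ∀ f g, pairing hT ψ f g = pairing hT ψ' f g) : ψ = ψ' := by
  refine ObjectProperty.hom_ext _ (ModuleCat.hom_ext (LinearMap.ext fun x => ?_))
  obtain ⟨f, rfl⟩ := toDualL_surjective hT mu x
  exact LinearMap.ext fun g => h f g

variable (ψ : dualL hT mu ⟶ (dualFunctor hT Γ).obj X)

/-- Linearity over the algebra lets endomorphisms of `T` move from one argument to the other.
Combined with `pairing_eq_zero`, this evaluates maps out of the simple module. -/
lemma pairing_comp (h : tiltingSum hT Γ ⟶ H.nabla mu) (g : X ⟶ tiltingSum hT Γ)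
    (a : tiltingSum hT Γ ⟶ tiltingSum hT Γ) :
    pairing hT ψ h (g ≫ a) = pairing hT ψ (a ≫ h) g := by
  have h₁ : toFun hT ψ (ofHom hT a • toDualL hT mu h) = ofHom hT a • toFun hT ψ (toDualL hT mu h) :=
    map_smul _ _ _
  exact (congrArg (fun φ : DualSpace hT Γ X => φ g) h₁).symm

lemma pairing_eq_zero {h : tiltingSum hT Γ ⟶ H.nabla mu}
    (hh : ∀ f : H.Δ mu ⟶ tiltingSum hT Γ, f ≫ h = 0) (g : X ⟶ tiltingSum hT Γ) :
    pairing hT ψ h g = 0 := by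
  rw [pairing, toDualL_eq_zero hT mu hh, map_zero]
  rfl

lemma pairing_comp_map {Y : C} (d : X ⟶ Y) (h : tiltingSum hT Γ ⟶ H.nabla mu)
    (g : Y ⟶ tiltingSum hT Γ) :
    pairing hT (ψ ≫ (dualFunctor hT Γ).map d) h g = pairing hT ψ h (d ≫ g) := rfl

lemma pairing_smul_left (r : 𝕜) (h : tiltingSum hT Γ ⟶ H.nabla mu) (g : X ⟶ tiltingSum hT Γ) :
    pairing hT ψ (r • h) g = r * pairing hT ψ h g := by
  have := pairing_comp ψ h g (r • 𝟙 _)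
  rw [Linear.comp_smul, Category.comp_id, Linear.smul_comp, Category.id_comp] at this
  rw [← this]
  exact map_smul (show DualSpace hT Γ X from toFun hT ψ (toDualL hT mu h)) r g

lemma pairing_smul (r : 𝕜) (h : tiltingSum hT Γ ⟶ H.nabla mu) (g : X ⟶ tiltingSum hT Γ) :
    pairing hT (r • ψ) h g = r * pairing hT ψ h g := by
  rw [← pairing_smul_left]
  have := pairing_comp ψ h g (r • 𝟙 _)
  rw [Linear.smul_comp, Category.id_comp] at this
  rw [← this]
  rfl

end

section

omit [Finite Γ] in
include hT in
lemma mem_of_iso_T {X : C} {l : Λ} (e : X ≅ T l) (hX : trunc H.L (Γ : Set Λ) X) : l ∈ Γ := by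
  have := (maps hT l).mono_j
  exact H.mem_of_trunc_Δ ((trunc H.L (Γ : Set Λ)).prop_of_mono (maps hT l).j
    ((trunc H.L (Γ : Set Λ)).prop_of_iso e hX))

omit [Finite Γ] in
include hT in
/-- Induction on tilting objects in a truncated category. -/
lemma tilting_induction {P : C → Prop} (h₀ : ∀ X, IsZero X → P X)
    (h₁ : ∀ (l : Γ) (X : C), (X ≅ T l) → P X)
    (h₂ : ∀ X Y Z, (X ≅ Y ⊞ Z) → P Y → P Z → P X) {X : C} (hX : H.tilting X)
    (hX' : trunc H.L (Γ : Set Λ) X) : P X := by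
  refine indecomposable_induction (P := fun X => H.tilting X → trunc H.L (Γ : Set Λ) X → P X)
    H.finite_hom (fun X hX _ _ => h₀ X hX) (fun X hX ht htr => ?_)
    (fun X Y Z e hY hZ ht htr => ?_) X hX hX'
  · obtain ⟨l, ⟨e⟩⟩ := exists_iso_T hT (extOrthogonal_of_tilting ht) hX
    exact h₁ ⟨l, mem_of_iso_T hT e htr⟩ X e
  · obtain ⟨⟨r⟩, ⟨s⟩⟩ := retract_of_biprod_iso e
    have : Mono r.i := SplitMono.mono ⟨_, r.retract⟩
    have : Mono s.i := SplitMono.mono ⟨_, s.retract⟩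
    exact h₂ X Y Z e (hY (tilting_of_retract hT r ht) ((trunc H.L (Γ : Set Λ)).prop_of_mono r.i htr))
      (hZ (tilting_of_retract hT s ht) ((trunc H.L (Γ : Set Λ)).prop_of_mono s.i htr))

lemma injective_dualFunctor {X : C} (hX : H.tilting X) (hX' : trunc H.L (Γ : Set Λ) X) :
    Injective ((dualFunctor hT Γ).obj X) := by
  refine tilting_induction hT (P := fun X => Injective ((dualFunctor hT Γ).obj X))
    (fun X hX => ((dualFunctor hT Γ).map_isZero hX).injective)
    (fun l X e => ?_) (fun X Y Z e hY hZ => ?_) hX hX'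
  · have := injective_dualFunctor_T hT l
    exact Injective.of_iso ((dualFunctor hT Γ).mapIso e.symm) this
  · have := preservesBinaryBiproducts_of_preservesBiproducts (dualFunctor hT Γ)
    exact Injective.of_iso ((dualFunctor hT Γ).mapIso e ≪≫ (dualFunctor hT Γ).mapBiprod Y Z).symm
      inferInstance

variable {hT mu}

/-- For `X = T l`, the map `d ≫ g` is the inclusion followed by an endomorphism of `T`. Moved across
the pairing onto `h`, that endomorphism gives a map that kills all images of `Δ mu` by `hd`. Direct
sums reduce to this case. -/
lemma comp_dualFunctor_map_eq_zero {X Y : C} (hX : H.tilting X)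
    (hX' : trunc H.L (Γ : Set Λ) X) (d : X ⟶ Y)
    (hd : ∀ (a : H.Δ mu ⟶ X) (b : Y ⟶ H.nabla mu), a ≫ d ≫ b = 0)
    (ψ : dualL hT mu ⟶ (dualFunctor hT Γ).obj X) : ψ ≫ (dualFunctor hT Γ).map d = 0 := by
  refine tilting_induction hT (P := fun X => ∀ (d : X ⟶ Y)
    (_ : ∀ (a : H.Δ mu ⟶ X) (b : Y ⟶ H.nabla mu), a ≫ d ≫ b = 0)
    (ψ : dualL hT mu ⟶ (dualFunctor hT Γ).obj X), ψ ≫ (dualFunctor hT Γ).map d = 0)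
    (fun X hX d _ ψ => ?_) (fun l X e d hd ψ => ?_) (fun X Y' Z e hY hZ d hd ψ => ?_) hX hX' d hd ψ
  · exact (((dualFunctor hT Γ).map_isZero hX).eq_of_tgt ψ 0) ▸ zero_comp
  · refine ext_pairing fun h g => ?_
    have h₁ : d ≫ g = (e.hom ≫ inclT hT l) ≫ (projT hT l ≫ e.inv ≫ d ≫ g) := by simp
    rw [pairing_comp_map, h₁, pairing_comp, pairing_eq_zero]
    · rfl
    · intro f
      simpa using hd (f ≫ projT hT l ≫ e.inv) (g ≫ h)
  · have h₁ : d = (e.hom ≫ biprod.fst) ≫ (biprod.inl ≫ e.inv ≫ d) +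
        (e.hom ≫ biprod.snd) ≫ (biprod.inr ≫ e.inv ≫ d) := by
      rw [← cancel_epi e.inv]
      apply biprod.hom_ext' <;> simp
    rw [h₁, Functor.map_add, Preadditive.comp_add,
      (dualFunctor hT Γ).map_comp (e.hom ≫ biprod.fst), (dualFunctor hT Γ).map_comp (e.hom ≫ biprod.snd),
      ← Category.assoc, hY, zero_add, ← Category.assoc, hZ]
    · intro a b
      simpa using hd (a ≫ biprod.inr ≫ e.inv) b
    · intro a b
      simpa using hd (a ≫ biprod.inl ≫ e.inv) b

lemma eq_of_iso_T {l m : Λ} (hT : ∀ l, H.IsIndecomposableTilting l (T l)) (e : T l ≅ T m) : l = m := by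
  have key : ∀ {l m : Λ}, (T l ≅ T m) → l ≤ m := fun {l m} e => by
    have := (maps hT l).mono_j
    have := (trunc H.L (Set.Iic m)).prop_of_mono ((maps hT l).j ≫ e.hom) (hT m).mem
    exact Set.mem_Iic.1 (H.mem_of_trunc_Δ this)
  exact (key e).antisymm (key e.symm)

/-- A nonzero value of the pairing would come from a nonzero composite `Δ mu` → `T l` → `nabla mu`,
making `T mu` a summand of `T l`. -/
lemma hom_dualL_T_eq_zero {l : Γ} (hl : l ≠ mu)
    (ψ : dualL hT mu ⟶ (dualFunctor hT Γ).obj (T l)) : ψ = 0 := by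
  refine ext_pairing fun h g => ?_
  have h₁ : g = inclT hT l ≫ (projT hT l ≫ g) := by simp
  rw [h₁, pairing_comp, pairing_eq_zero]
  · rfl
  · intro f
    by_contra hf
    obtain ⟨r⟩ := (maps hT (mu : Λ)).exists_retract (hT mu).indecomposable
      (extOrthogonal_of_tilting (hT l).tilting) (f ≫ projT hT l) (g ≫ h) (by simpa using hf)
    have := isIso_of_retract r (hT l).indecomposable (hT mu).indecomposable.1
    exact hl (Subtype.ext (eq_of_iso_T hT (asIso r.r)))

variable (hT mu) in
/-- The embedding of a simple object of the Ringel dual into its injective hull. -/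
def dualLToT : dualL hT mu ⟶ (dualFunctor hT Γ).obj (T mu) :=
  let c : (H.Δ mu ⟶ H.nabla mu) ≃ₗ[𝕜] 𝕜 := (H.hom_Δ_nabla mu).some
  let k : (dualΔ hT mu).obj →ₗ[RingelAlg hT Γ] DualSpace hT Γ (T mu) :=
    { toFun := fun h => c.toLinearMap ∘ₗ Linear.leftComp 𝕜 _ (maps hT (mu : Λ)).j ∘ₗ
        Linear.rightComp 𝕜 _ ((toDualΔ hT mu).symm h)
      map_add' := fun h h' => LinearMap.ext fun g => by
        change c (_ ≫ g ≫ (toDualΔ hT mu).symm (h + h')) = c (_ ≫ g ≫ _) + c (_ ≫ g ≫ _)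
        rw [map_add, Preadditive.comp_add, Preadditive.comp_add, map_add]
      map_smul' := fun a h => LinearMap.ext fun g => by
        change c (_ ≫ g ≫ toHom hT a ≫ (toDualΔ hT mu).symm h) = c (_ ≫ (g ≫ toHom hT a) ≫ _)
        rw [Category.assoc] }
  ObjectProperty.homMk (ModuleCat.ofHom (Submodule.liftQ _ k (by
    rw [jacobson_dualΔ]
    intro h hh
    refine LinearMap.ext fun g => ?_
    change c (_ ≫ g ≫ _) = 0
    rw [← Category.assoc, show (_ ≫ g) ≫ (toDualΔ hT mu).symm h = 0 from hh _, map_zero])))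

lemma pairing_dualLToT (h : tiltingSum hT Γ ⟶ H.nabla mu) (g : T mu ⟶ tiltingSum hT Γ) :
    pairing hT (dualLToT hT mu) h g = (H.hom_Δ_nabla mu).some ((maps hT (mu : Λ)).j ≫ g ≫ h) := rfl

/-- The composite `g ≫ h` is a multiple of `q`, and the pairing of `h` with `g` depends only on that
multiple. So a map is determined by a single scalar, and `dualLToT` shows that it can be nonzero. -/
lemma finrank_hom_dualL_T :
    Module.finrank 𝕜 (dualL hT mu ⟶ (dualFunctor hT Γ).obj (T mu)) = 1 := by
  let d := maps hT (mu : Λ)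
  let c := (H.hom_Δ_nabla (mu : Λ)).some
  have hc : c (d.j ≫ d.q) ≠ 0 := fun h => by
    rw [d.j_q] at h
    exact H.π_ι_ne_zero _ (c.injective (h.trans (map_zero c).symm))
  have key : ∀ (ψ : dualL hT mu ⟶ (dualFunctor hT Γ).obj (T mu)) (h : tiltingSum hT Γ ⟶ H.nabla mu)
      (g : T mu ⟶ tiltingSum hT Γ) (r : 𝕜), g ≫ h = r • d.q →
        pairing hT ψ h g = r * pairing hT ψ (projT hT mu ≫ d.q) (inclT hT mu) := by
    intro ψ h g r hr
    have h₁ : g = inclT hT mu ≫ (projT hT mu ≫ g) := by simp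
    conv_lhs => rw [h₁]
    rw [pairing_comp, Category.assoc, hr, Linear.comp_smul, pairing_smul_left]
  have hφ : pairing hT (dualLToT hT mu) (projT hT mu ≫ d.q) (inclT hT mu) = c (d.j ≫ d.q) := by
    rw [pairing_dualLToT, inclT_projT_assoc]
  refine (finrank_eq_one_iff_of_nonzero' (dualLToT hT mu) fun h₀ => hc ?_).2 fun ψ =>
    ⟨pairing hT ψ (projT hT mu ≫ d.q) (inclT hT mu) / c (d.j ≫ d.q), ext_pairing fun h g => ?_⟩
  · rw [← hφ, h₀]
    rfl
  · obtain ⟨r, hr⟩ := d.eq_smul_q (g ≫ h)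
    rw [pairing_smul, key _ h g r hr, key _ h g r hr, hφ]
    field_simp

end

end HighestWeightCategory

/-! ### Finiteness of Ext and derived maps into injectives -/

section

variable {C : Type u} [Category.{v} C] [Abelian C] {𝕜 : Type v} [Field 𝕜] [Linear 𝕜 C]

lemma extFinite_X₂ {X : C} {S : ShortComplex C} (hS : S.ShortExact) (h₁ : ExtFinite 𝕜 X S.X₁)
    (h₃ : ExtFinite 𝕜 X S.X₃) : ExtFinite 𝕜 X S.X₂ := by
  refine ⟨fun n => ?_, (h₁.2.union h₃.2).subset fun n hn => ?_⟩
  · have := h₁.1 n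
    have := h₃.1 n
    have : IsNoetherian 𝕜 (ExtGroup X S.X₂ n) := isNoetherian_of_range_eq_ker
      ((Ext.mk₀ S.f).postcompOfLinear 𝕜 X (add_zero n))
      ((Ext.mk₀ S.g).postcompOfLinear 𝕜 X (add_zero n)) (by
        ext x
        constructor
        · rintro ⟨y, rfl⟩
          change (Ext.comp y (Ext.mk₀ S.f) (add_zero n)).comp (Ext.mk₀ S.g) (add_zero n) = 0
          rw [Ext.comp_assoc_of_third_deg_zero, Ext.mk₀_comp_mk₀, S.zero, Ext.mk₀_zero, Ext.comp_zero]
        · intro hx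
          exact Ext.covariant_sequence_exact₂ _ hS x hx)
    infer_instance
  · by_contra h
    simp only [Set.mem_union, Set.mem_ofPred_eq, not_or, not_nontrivial_iff_subsingleton] at h
    obtain ⟨h₁, h₃⟩ := h
    refine not_subsingleton_iff_nontrivial.2 hn (subsingleton_of_forall_eq 0 fun x => ?_)
    obtain ⟨y, rfl⟩ := Ext.covariant_sequence_exact₂ _ hS x (h₃.elim _ _)
    rw [h₁.elim y 0, Ext.zero_comp]

/-- Dimension shift: by injectivity of `S.X₂`, each Ext group of positive degree into `S.X₁` is a
quotient of the previous one into `S.X₃`. Degree zero is covered by `h₀`. -/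
lemma extFinite_X₁ {X : C} {S : ShortComplex C} (hS : S.ShortExact)
    (h₀ : Module.Finite 𝕜 (X ⟶ S.X₁)) (h₂ : Injective S.X₂)
    (h₃ : ExtFinite 𝕜 X S.X₃) : ExtFinite 𝕜 X S.X₁ := by
  have key : ∀ n, Function.Surjective (hS.extClass.postcompOfLinear 𝕜 X (rfl : n + 1 = n + 1)) :=
    fun n x => Ext.covariant_sequence_exact₁ X hS x (Ext.eq_zero_of_injective _) rfl
  refine ⟨fun n => ?_, ((h₃.2.image Nat.succ).union (Set.finite_singleton 0)).subset fun n hn => ?_⟩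
  · cases n with
    | zero => exact Module.Finite.equiv (Ext.linearEquiv₀ (R := 𝕜)).symm
    | succ n =>
      have := h₃.1 n
      exact Module.Finite.of_surjective _ (key n)
  · cases n with
    | zero => exact Or.inr rfl
    | succ n =>
      refine Or.inl ⟨n, ?_, rfl⟩
      have : Nontrivial (ExtGroup X S.X₁ (n + 1)) := hn
      exact (key n).nontrivial

lemma extFinite_of_isZero {X Y : C} (hY : IsZero Y) : ExtFinite 𝕜 X Y := by
  have : ∀ n, Subsingleton (ExtGroup X Y n) := fun n => subsingleton_of_forall_eq 0 fun x => by
    rw [← x.comp_mk₀_id, hY.eq_of_src (𝟙 Y) 0, Ext.mk₀_zero, Ext.comp_zero]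
  refine ⟨fun n => inferInstance, ?_⟩
  convert Set.finite_empty
  exact Set.eq_empty_of_forall_notMem fun n hn => not_subsingleton_iff_nontrivial.2 hn (this n)

lemma extFinite_of_iso {X Y Y' : C} (e : Y ≅ Y') (hY : ExtFinite 𝕜 X Y) : ExtFinite 𝕜 X Y' := by
  have key : ∀ n, Function.Surjective ((Ext.mk₀ e.hom).postcompOfLinear 𝕜 X (add_zero n)) :=
    fun n x => ⟨x.comp (Ext.mk₀ e.inv) (add_zero n), by
      change (x.comp (Ext.mk₀ e.inv) (add_zero n)).comp (Ext.mk₀ e.hom) (add_zero n) = x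
      rw [Ext.comp_assoc_of_third_deg_zero, Ext.mk₀_comp_mk₀, e.inv_hom_id, Ext.comp_mk₀_id]⟩
  refine ⟨fun n => ?_, hY.2.subset fun n hn => ?_⟩
  · have := hY.1 n
    exact Module.Finite.of_surjective _ (key n)
  · have : Nontrivial (ExtGroup X Y' n) := hn
    exact (key n).nontrivial

open DerivedCategory

/-- `Ext`-groups as spaces of morphisms between single complexes in arbitrary degrees. -/
def extEquivSingle (X Y : C) (b : ℕ) {n m : ℤ} (h : b + m = n) :
    ExtGroup X Y b ≃ₗ[𝕜] (Q.obj ((sg C n).obj X) ⟶ Q.obj ((sg C m).obj Y)) :=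
  (extEquiv 𝕜 X Y b (-b) (by lia)).trans (LinearEquiv.symm <|
    (LinearEquiv.ofBijective (Functor.mapLinearMap 𝕜 (shiftFunctor (DerivedCategory C) n)
      (X := Q.obj ((sg C n).obj X)) (Y := Q.obj ((sg C m).obj Y)))
      ⟨(shiftFunctor (DerivedCategory C) n).map_injective,
        (shiftFunctor (DerivedCategory C) n).map_surjective⟩).trans
    (Linear.homCongr 𝕜 (((singleFunctors C).shiftIso n 0 n (add_zero n)).app X)
      (((singleFunctors C).shiftIso n (-b) m (by lia)).app Y)))

lemma hom_single_eq_zero {X Y : C} {n m : ℤ} (h : n < m)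
    (f : Q.obj ((sg C n).obj X) ⟶ Q.obj ((sg C m).obj Y)) : f = 0 := by
  have := subsingleton_hom_of_isStrictlyLE_of_isStrictlyGE ((sg C n).obj X) ((sg C m).obj Y) n m h
  exact Subsingleton.elim _ _

lemma finite_hom_of_extFinite {X Y : C} (h : ExtFinite 𝕜 X Y) (n m : ℤ) :
    Module.Finite 𝕜 (Q.obj ((sg C n).obj X) ⟶ Q.obj ((sg C m).obj Y)) := by
  rcases lt_or_ge n m with hnm | hnm
  · have : Subsingleton (Q.obj ((sg C n).obj X) ⟶ Q.obj ((sg C m).obj Y)) :=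
      subsingleton_of_forall_eq 0 (hom_single_eq_zero hnm)
    infer_instance
  · have := h.1 (n - m).toNat
    exact Module.Finite.equiv (extEquivSingle (𝕜 := 𝕜) X Y (n - m).toNat (n := n) (m := m) (by lia))

/-- Maps in the derived category to a complex of injective objects whose differentials vanish on
the given object. -/
lemma finrank_hom_single_of_injective {X : C} {J : CochainComplex C ℤ} (a : ℤ) [J.IsStrictlyGE a]
    (hJ : ∀ i, Injective (J.X i)) (hd : ∀ (i j : ℤ) (f : X ⟶ J.X i), f ≫ J.d i j = 0) (n : ℤ) :
    Module.finrank 𝕜 (Q.obj ((sg C n).obj X) ⟶ Q.obj J) = Module.finrank 𝕜 (X ⟶ J.X n) := by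
  have : J.IsKInjective := CochainComplex.isKInjective_of_injective J a
  let e : (X ⟶ J.X n) →ₗ[𝕜] (Q.obj ((sg C n).obj X) ⟶ Q.obj J) :=
    { toFun := fun f => Q.map (HomologicalComplex.mkHomFromSingle f fun j _ => hd n j f)
      map_add' := fun f g => by
        rw [← Functor.map_add]
        congr 1
        apply HomologicalComplex.from_single_hom_ext
        simp
      map_smul' := fun r f => by
        rw [RingHom.id_apply, ← Functor.map_smul]
        congr 1
        apply HomologicalComplex.from_single_hom_ext
        simp }
  have hbij := CochainComplex.IsKInjective.Qh_map_bijective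
    ((HomotopyCategory.quotient _ _).obj ((sg C n).obj X)) J
  refine (LinearEquiv.finrank_eq (LinearEquiv.ofBijective e ⟨?_, fun f => ?_⟩)).symm
  · rw [injective_iff_map_eq_zero]
    intro f hf
    let φ : (sg C n).obj X ⟶ J := HomologicalComplex.mkHomFromSingle f fun j _ => hd n j f
    have h₁ : (HomotopyCategory.quotient _ _).map φ = 0 := hbij.injective (by
      rw [Functor.map_zero]
      exact hf)
    have h := HomotopyCategory.homotopyOfEq φ 0 (by rw [h₁, Functor.map_zero])
    have h₂ := h.comm n
    rw [dNext_eq h.hom (show (ComplexShape.up ℤ).Rel n (n + 1) by simp),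
      prevD_eq h.hom (show (ComplexShape.up ℤ).Rel (n - 1) n by simp),
      HomologicalComplex.zero_f, add_zero, HomologicalComplex.single_obj_d, zero_comp, zero_add,
      HomologicalComplex.mkHomFromSingle_f] at h₂
    -- The only surviving term of a null-homotopy is a map into degree n - 1 followed by the
    -- differential, which `hd` makes zero. Thus distinct maps stay distinct up to homotopy.
    have h₃ := hd (n - 1) n ((HomologicalComplex.singleObjXSelf (ComplexShape.up ℤ) n X).inv ≫
      h.hom n (n - 1))
    rw [Category.assoc, ← h₂, Iso.inv_hom_id_assoc] at h₃
    exact h₃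
  · obtain ⟨g, hg⟩ := hbij.surjective f
    obtain ⟨φ, rfl⟩ := (HomotopyCategory.quotient _ _).map_surjective g
    refine ⟨(HomologicalComplex.singleObjXSelf (ComplexShape.up ℤ) n X).inv ≫ φ.f n, ?_⟩
    refine Eq.trans ?_ hg
    change Q.map _ = Q.map φ
    congr 1
    apply HomologicalComplex.from_single_hom_ext
    simp

end

/-! ### Multiplicities as dimensions in the Ringel dual -/

namespace HighestWeightCategory

variable {𝕜 : Type v} [Field 𝕜] {C : Type u} [Category.{v} C] [Abelian C] [Linear 𝕜 C]
  {Λ : Type w} [PartialOrder Λ] {H : HighestWeightCategory 𝕜 C Λ}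
  {T : Λ → C} (hT : ∀ l, H.IsIndecomposableTilting l (T l)) {Γ : LowerSet Λ} [Finite Γ]
  (mu : Γ)

lemma extFinite_dualL_of_filtered {S : Set Λ} {X : C} (hX : filtered H.Δ S X)
    (h : ∀ i ∈ S, ExtFinite 𝕜 (dualL hT mu) ((dualFunctor hT Γ).obj (H.Δ i))) :
    ExtFinite 𝕜 (dualL hT mu) ((dualFunctor hT Γ).obj X) := by
  refine filtered_induction_of_iso
    (P := fun X => ExtFinite 𝕜 (dualL hT mu) ((dualFunctor hT Γ).obj X))
    (fun X hX => extFinite_of_isZero ((dualFunctor hT Γ).map_isZero hX))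
    (fun X Y e => extFinite_of_iso ((dualFunctor hT Γ).mapIso e))
    (fun A hA hA₁ hA₃ h₁ h₃ => ?_) h hX
  exact extFinite_X₂ (shortExact_dualFunctor hT hA (subsingleton_ext_filtered_left hA₃ fun i _ =>
    (extOrthogonal_tiltingSum hT).1 i)) h₁ h₃

/-- Induction on the weight: the image of `Δ l` embeds in the injective image of `T l`, with
quotient the image of `cokernel j`, which is filtered by standard objects of smaller weight. -/
lemma extFinite_dualL_Δ (l : Λ) (hl : l ∈ Γ) :
    ExtFinite 𝕜 (dualL hT mu) ((dualFunctor hT Γ).obj (H.Δ l)) := by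
  induction l using H.weight_induction with
  | h l ih =>
  have := (maps hT l).mono_j
  refine extFinite_X₁ (shortExact_dualFunctor hT (shortExact_cokernel (maps hT l).j)
    (subsingleton_ext_filtered_left (maps hT l).cokernel_j fun i _ =>
      (extOrthogonal_tiltingSum hT).1 i)) (finite_hom_fdModules _ _)
    (injective_dualFunctor_T hT ⟨l, hl⟩)
    (extFinite_dualL_of_filtered hT mu (maps hT l).cokernel_j fun i hi =>
      ih i hi (Γ.lower (le_of_lt hi) hl))

lemma extFinite_dualL_dualNabla (l : Γ) : ExtFinite 𝕜 (dualL hT mu) (dualNabla hT l) :=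
  extFinite_of_iso (dualNablaIso hT l).symm (extFinite_dualL_Δ hT mu l l.2)

variable {hT mu}

open Classical in
lemma finrank_hom_dualL_of_iso_T {X : C} (l : Γ) (e : X ≅ T l) :
    Module.finrank 𝕜 (dualL hT mu ⟶ (dualFunctor hT Γ).obj X) =
      if Nonempty (X ≅ T mu) then 1 else 0 := by
  rw [(Linear.homCongr 𝕜 (Iso.refl _) ((dualFunctor hT Γ).mapIso e)).finrank_eq]
  split_ifs with h
  · obtain ⟨e'⟩ := h
    obtain rfl : l = mu := Subtype.ext (eq_of_iso_T hT (e.symm ≪≫ e'))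
    exact finrank_hom_dualL_T
  · have hl : l ≠ mu := by
      rintro rfl
      exact h ⟨e⟩
    have : Subsingleton (dualL hT mu ⟶ (dualFunctor hT Γ).obj (T l)) :=
      subsingleton_of_forall_eq 0 (hom_dualL_T_eq_zero hl)
    exact Module.finrank_zero_of_subsingleton

lemma finrank_hom_dualL {X : C} (hX : H.tilting X) (hX' : trunc H.L (Γ : Set Λ) X) :
    Module.finrank 𝕜 (dualL hT mu ⟶ (dualFunctor hT Γ).obj X) = multiplicity X (T mu) := by
  classical
  have h := nonempty_krullSchmidtDecomposition H.finite_hom X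
  rw [multiplicity, dif_pos h]
  generalize h.some = D
  let F := dualFunctor hT Γ
  have e : (dualL hT mu ⟶ F.obj (⨁ D.X)) ≃ₗ[𝕜] (∀ i, dualL hT mu ⟶ F.obj (D.X i)) :=
    { toFun := fun f i => f ≫ F.map (biproduct.π D.X i)
      invFun := fun f => ∑ i, f i ≫ F.map (biproduct.ι D.X i)
      map_add' := fun f g => funext fun i => Preadditive.add_comp _ _ _ _ _ _
      map_smul' := fun r f => funext fun i => Linear.smul_comp _ _ _ _ _ _
      left_inv := fun f => by
        simp only [Category.assoc, ← F.map_comp]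
        rw [← Preadditive.comp_sum, ← F.map_sum, biproduct.total, F.map_id, Category.comp_id]
      right_inv := fun f => funext fun i => by
        change (∑ i, f i ≫ F.map (biproduct.ι D.X i)) ≫ F.map (biproduct.π D.X i) = f i
        rw [Preadditive.sum_comp, Finset.sum_eq_single i]
        · rw [Category.assoc, ← F.map_comp, biproduct.ι_π_self, F.map_id, Category.comp_id]
        · intro j _ hj
          rw [Category.assoc, ← F.map_comp, biproduct.ι_π_ne _ hj, F.map_zero, comp_zero]
        · simp }
  have := fun i => finite_hom_fdModules (dualL hT mu) (F.obj (D.X i))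
  rw [(Linear.homCongr 𝕜 (Iso.refl _) (F.mapIso D.iso)).finrank_eq, e.finrank_eq,
    Module.finrank_pi_fintype, Nat.card_eq_fintype_card, Fintype.card_subtype,
    Finset.card_filter]
  refine Finset.sum_congr rfl fun i _ => ?_
  let r : Retract (D.X i) X := ⟨biproduct.ι D.X i ≫ D.iso.inv, D.iso.hom ≫ biproduct.π D.X i, by simp⟩
  have : Mono r.i := SplitMono.mono ⟨_, r.retract⟩
  have htr := (trunc H.L (Γ : Set Λ)).prop_of_mono r.i hX'
  obtain ⟨l, ⟨e⟩⟩ := exists_iso_T hT (extOrthogonal_of_tilting (tilting_of_retract hT r hX))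
    (D.indecomposable i)
  exact finrank_hom_dualL_of_iso_T ⟨l, mem_of_iso_T hT e htr⟩ e

end HighestWeightCategory

section

variable {𝕜 : Type*} [Field 𝕜]

lemma finite_and_finrank_of_exact {U V W : Type*} [AddCommGroup U] [AddCommGroup V] [AddCommGroup W]
    [Module 𝕜 U] [Module 𝕜 V] [Module 𝕜 W] [Module.Finite 𝕜 U] [Module.Finite 𝕜 W] (f : U →ₗ[𝕜] V)
    (g : V →ₗ[𝕜] W) (hf : Function.Injective f) (hg : Function.Surjective g)
    (h : Function.Exact f g) :
    Module.Finite 𝕜 V ∧ Module.finrank 𝕜 V = Module.finrank 𝕜 U + Module.finrank 𝕜 W := by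
  have : IsNoetherian 𝕜 V := isNoetherian_of_range_eq_ker f g (LinearMap.exact_iff.1 h).symm
  have : Module.Finite 𝕜 V := inferInstance
  exact ⟨this, finrank_of_exact f g hf hg h⟩

end

/-! ### Additivity of dimensions in triangles -/

section

open DerivedCategory Pretriangulated

variable {𝕜 : Type*} [Field 𝕜] {C : Type u} [Category.{v} C] [Abelian C] [Linear 𝕜 C]
  {T : Triangle (DerivedCategory C)} (hT : T ∈ distTriang (DerivedCategory C)) {X : C}

include hT

/-- The shift of a single complex. -/
def sgShiftIso (X : C) (n : ℤ) :
    (Q.obj ((sg C (n + 1)).obj X))⟦(1 : ℤ)⟧ ≅ Q.obj ((sg C n).obj X) :=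
  ((singleFunctors C).shiftIso 1 n (n + 1) (add_comm 1 n)).app X

/-- `h₃` kills the connecting map arriving in degree `n` of the long exact sequence, and `h₁` the
one leaving it. -/
lemma finrank_hom_single_add {n : ℤ}
    (h₁ : ∀ f : Q.obj ((sg C (n + 1)).obj X) ⟶ T.obj₁, f = 0)
    (h₃ : ∀ f : Q.obj ((sg C (n - 1)).obj X) ⟶ T.obj₃, f = 0)
    (hf₁ : Module.Finite 𝕜 (Q.obj ((sg C n).obj X) ⟶ T.obj₁))
    (hf₃ : Module.Finite 𝕜 (Q.obj ((sg C n).obj X) ⟶ T.obj₃)) :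
    Module.Finite 𝕜 (Q.obj ((sg C n).obj X) ⟶ T.obj₂) ∧
      Module.finrank 𝕜 (Q.obj ((sg C n).obj X) ⟶ T.obj₂) =
        Module.finrank 𝕜 (Q.obj ((sg C n).obj X) ⟶ T.obj₁) +
          Module.finrank 𝕜 (Q.obj ((sg C n).obj X) ⟶ T.obj₃) := by
  refine finite_and_finrank_of_exact (Linear.rightComp 𝕜 _ T.mor₁) (Linear.rightComp 𝕜 _ T.mor₂)
    ?_ (fun f => ?_) fun f => ⟨fun hf => ?_, ?_⟩
  · rw [injective_iff_map_eq_zero]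
    intro f hf
    have hf' : f⟦(1 : ℤ)⟧' ≫ T.mor₁⟦(1 : ℤ)⟧' = 0 := by
      rw [← Functor.map_comp, show f ≫ T.mor₁ = 0 from hf, Functor.map_zero]
    obtain ⟨g, hg⟩ := T.coyoneda_exact₁ hT _ hf'
    obtain ⟨m, rfl⟩ : ∃ m, n = m + 1 := ⟨n - 1, by lia⟩
    rw [add_sub_cancel_right] at h₃
    have hg₀ : g = 0 := by
      rw [← cancel_epi (sgShiftIso X m).inv, comp_zero]
      exact h₃ _
    rw [hg₀, zero_comp] at hg
    exact (shiftFunctor (DerivedCategory C) (1 : ℤ)).map_injective (by rw [hg, Functor.map_zero])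
  · obtain ⟨g, hg⟩ := T.coyoneda_exact₃ hT f (by
      obtain ⟨g, hg⟩ := (shiftFunctor (DerivedCategory C) (1 : ℤ)).map_surjective
        ((sgShiftIso X n).hom ≫ f ≫ T.mor₃)
      rw [← cancel_epi (sgShiftIso X n).hom, ← hg, h₁ g, Functor.map_zero, comp_zero])
    exact ⟨g, hg.symm⟩
  · obtain ⟨g, hg⟩ := T.coyoneda_exact₂ hT f hf
    exact ⟨g, hg.symm⟩
  · rintro ⟨g, rfl⟩
    change (g ≫ T.mor₁) ≫ T.mor₂ = 0
    rw [Category.assoc, comp_distTriang_mor_zero₁₂ _ hT, comp_zero]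

/-- The extension property is needed in all degrees: in degree m it gives surjectivity of
restriction, and in degree m + 1 it kills the connecting map, which gives injectivity. -/
lemma finrank_hom_to_single_add
    (h : ∀ (m : ℤ) (f : T.obj₁ ⟶ Q.obj ((sg C m).obj X)), ∃ g, T.mor₁ ≫ g = f) {m : ℤ}
    (hf₁ : Module.Finite 𝕜 (T.obj₁ ⟶ Q.obj ((sg C m).obj X)))
    (hf₃ : Module.Finite 𝕜 (T.obj₃ ⟶ Q.obj ((sg C m).obj X))) :
    Module.Finite 𝕜 (T.obj₂ ⟶ Q.obj ((sg C m).obj X)) ∧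
      Module.finrank 𝕜 (T.obj₂ ⟶ Q.obj ((sg C m).obj X)) =
        Module.finrank 𝕜 (T.obj₃ ⟶ Q.obj ((sg C m).obj X)) +
          Module.finrank 𝕜 (T.obj₁ ⟶ Q.obj ((sg C m).obj X)) := by
  refine finite_and_finrank_of_exact (Linear.leftComp 𝕜 _ T.mor₂) (Linear.leftComp 𝕜 _ T.mor₁)
    ?_ (h m) fun f => ⟨fun hf => ?_, ?_⟩
  · rw [injective_iff_map_eq_zero]
    intro f hf
    obtain ⟨g, rfl⟩ := T.yoneda_exact₃ hT f hf
    obtain ⟨g', hg'⟩ := (shiftFunctor (DerivedCategory C) (1 : ℤ)).map_surjective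
      (g ≫ (sgShiftIso X m).inv)
    obtain ⟨k, rfl⟩ := h _ g'
    rw [← cancel_mono (sgShiftIso X m).inv, zero_comp, Category.assoc, ← hg', Functor.map_comp,
      ← Category.assoc, comp_distTriang_mor_zero₃₁ _ hT, zero_comp]
  · obtain ⟨g, hg⟩ := T.yoneda_exact₂ hT f hf
    exact ⟨g, hg.symm⟩
  · rintro ⟨g, rfl⟩
    change T.mor₁ ≫ T.mor₂ ≫ g = 0
    rw [← Category.assoc, comp_distTriang_mor_zero₁₂ _ hT, zero_comp]

omit hT

lemma isIso_Q_map_of_shortExact {S : ShortComplex (CochainComplex C ℤ)} (hS : S.ShortExact)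
    (h : IsZero (Q.obj S.X₁)) : IsIso (Q.map S.g) :=
  (Triangle.isZero₁_iff_isIso₂ _ (triangleOfSES_distinguished hS)).1 h

/-- A complex with one isomorphism as its only differential is zero in the derived category. -/
lemma isZero_Q_of_isIso_d {P : CochainComplex C ℤ} {i : ℤ} (hi : IsIso (P.d i (i + 1)))
    (hP : ∀ j, j ≠ i → j ≠ i + 1 → IsZero (P.X j)) : IsZero (Q.obj P) := by
  let h := inv (P.d i (i + 1))
  have hd : P.d i (i + 1) ≫ h = 𝟙 _ := IsIso.hom_inv_id _
  have hd' : h ≫ P.d i (i + 1) = 𝟙 _ := IsIso.inv_hom_id _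
  let e : P ⟶ P := Homotopy.nullHomotopicMap' fun j k hr => singleHomotopy P i h j k hr
  have he (j : ℤ) : e.f j = P.d j (j + 1) ≫ singleHomotopy P i h (j + 1) j rfl +
      singleHomotopy P i h j (j - 1) (sub_add_cancel j 1) ≫ P.d (j - 1) j :=
    Homotopy.nullHomotopicMap'_f (k₀ := j + 1) (k₁ := j) (k₂ := j - 1) (sub_add_cancel j 1) rfl _
  have hid : e = 𝟙 P := by
    ext j
    by_cases hj : j = i
    · subst hj
      rw [he, singleHomotopy_self, singleHomotopy_of_ne _ _ _ _ (by lia), zero_comp, add_zero]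
      exact hd
    · by_cases hj' : j = i + 1
      · subst hj'
        rw [he, singleHomotopy_of_ne _ _ _ _ (by lia), comp_zero, zero_add]
        have : ∀ (k : ℤ) (hk : k = i) (hr : k + 1 = i + 1),
            singleHomotopy P i h (i + 1) k hr ≫ P.d k (i + 1) = 𝟙 _ := by
          rintro k rfl hr
          rw [singleHomotopy_self]
          exact hd'
        exact this _ (by lia) _
      · exact (hP j hj hj').eq_of_src _ _
  rw [IsZero.iff_id_eq_zero, ← Q.map_id, ← hid, ← Q.map_zero]
  exact Q_map_eq_of_homotopy _ (Homotopy.nullHomotopy' _)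

lemma isZero_of_forall_isZero_X {P : CochainComplex C ℤ} (hP : ∀ j, IsZero (P.X j)) : IsZero P :=
  (IsZero.iff_id_eq_zero _).2 (by
    ext j
    exact (hP j).eq_of_src _ _)

end

/-! ### Dévissage of complexes with standard filtrations -/

namespace HighestWeightCategory

open DerivedCategory Pretriangulated

variable {𝕜 : Type v} [Field 𝕜] {C : Type u} [Category.{v} C] [Abelian C] [Linear 𝕜 C]
  {Λ : Type w} [PartialOrder Λ] {H : HighestWeightCategory 𝕜 C Λ}

/-- The short complex of a morphism and its cokernel. -/
abbrev cokernelComplex {D : Type*} [Category* D] [Abelian D] {X Y : D} (f : X ⟶ Y) :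
    ShortComplex D :=
  ShortComplex.mk f (cokernel.π f) (cokernel.condition f)

lemma not_isZero_Δ (l : Λ) : ¬ IsZero (H.Δ l) := fun h => H.π_ne_zero l (h.eq_of_src _ _)

/-- The quotient of an object with a standard filtration by a standard subobject of maximal
weight. -/
lemma exists_filtration_quotient {l : Λ} {S : ShortComplex C} (hS : S.ShortExact) {s : List Λ}
    (hs : HasFiltration H.Δ S.X₂ s) (hl : ∀ i ∈ s, ¬ l < i)
    (h : IsZero S.X₁ ∨ Nonempty (S.X₁ ≅ H.Δ l)) :
    ∃ t, HasFiltration H.Δ S.X₃ t ∧ t ⊆ s ∧ t.length ≤ s.length ∧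
      (¬ IsZero S.X₁ → t.length < s.length) := by
  have := hS.mono_f
  rcases h with h | ⟨⟨e⟩⟩
  · have := hS.exact.mono_g (h.eq_of_src _ _)
    have := hS.epi_g
    have : IsIso S.g := isIso_of_mono_of_epi _
    exact ⟨s, hasFiltration_of_iso (asIso S.g) hs, fun _ => id, le_rfl, fun h' => (h' h).elim⟩
  · have hne : e.inv ≫ S.f ≠ 0 := fun h₀ => not_isZero_Δ (H := H) l
      ((IsZero.iff_id_eq_zero _).2 (by rw [← cancel_mono (e.inv ≫ S.f), h₀, comp_zero, zero_comp]))
    obtain ⟨-, t, ht, hp⟩ := H.mono_of_hom_Δ hs hl _ hne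
    obtain ⟨e'⟩ := cokernelIso_of_shortExact hS
    refine ⟨t, hasFiltration_of_iso (cokernelEpiComp e.inv S.f ≪≫ e'.symm) ht,
      fun i hi => hp.mem_iff.2 (List.mem_cons_of_mem _ hi), ?_, fun _ => ?_⟩ <;>
      simp [hp.length_eq]

variable {Γ : LowerSet Λ}

lemma hom_single_Δ_nabla_eq_zero {l k : Λ} {i j : ℤ} (h : (l, i) ≠ (k, j))
    (f : Q.obj ((sg C i).obj (H.Δ l)) ⟶ Q.obj ((sg C j).obj (H.nabla k))) : f = 0 := by
  rcases lt_trichotomy i j with hij | rfl | hij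
  · exact hom_single_eq_zero hij f
  · obtain ⟨g, rfl⟩ := (singleFunctor C i).map_surjective f
    rw [H.hom_Δ_nabla_eq_zero (fun hlk => h (by rw [hlk])) g]
    exact (singleFunctor C i).map_zero _ _
  · have := H.ext_Δ_nabla (i - j - 1).toNat l k
    exact (extEquivSingle (𝕜 := 𝕜) (H.Δ l) (H.nabla k) ((i - j - 1).toNat + 1) (n := i) (m := j)
      (by lia)).symm.subsingleton.elim _ _

open Classical in
lemma finrank_hom_single_Δ_nabla (l k : Λ) (i j : ℤ) :
    Module.Finite 𝕜 (Q.obj ((sg C i).obj (H.Δ l)) ⟶ Q.obj ((sg C j).obj (H.nabla k))) ∧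
    Module.finrank 𝕜 (Q.obj ((sg C i).obj (H.Δ l)) ⟶ Q.obj ((sg C j).obj (H.nabla k))) =
      if (l, i) = (k, j) then 1 else 0 := by
  split_ifs with h
  · obtain ⟨rfl, rfl⟩ := Prod.mk.inj h
    have e := (Ext.linearEquiv₀ (R := 𝕜)).symm.trans
      (extEquivSingle (𝕜 := 𝕜) (H.Δ l) (H.nabla l) 0 (n := i) (m := i) (by simp))
    obtain ⟨e'⟩ := H.hom_Δ_nabla l
    have e'' := e'.symm.trans e
    exact ⟨Module.Finite.equiv e'', by rw [← e''.finrank_eq, Module.finrank_self]⟩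
  · have : Subsingleton (Q.obj ((sg C i).obj (H.Δ l)) ⟶ Q.obj ((sg C j).obj (H.nabla k))) :=
      subsingleton_of_forall_eq 0 (hom_single_Δ_nabla_eq_zero h)
    exact ⟨inferInstance, Module.finrank_zero_of_subsingleton⟩

/-- Maps to costandard objects extend from a standard subcomplex of maximal weight consisting of
cycles. -/
lemma exists_extension_single {X : CochainComplex C ℤ} {l : Λ} {j : ℤ}
    (hX : ∀ i, trunc H.L {k | ¬ l < k} (X.X i))
    (hd : ∀ i k (f : H.Δ l ⟶ X.X i), f ≫ X.d i k = 0) {f : H.Δ l ⟶ X.X j} (hf : f ≠ 0) (k : Λ)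
    (m : ℤ) (g : Q.obj ((sg C j).obj (H.Δ l)) ⟶ Q.obj ((sg C m).obj (H.nabla k))) :
    ∃ g' : Q.obj X ⟶ Q.obj ((sg C m).obj (H.nabla k)),
      Q.map (HomologicalComplex.mkHomFromSingle f fun k _ => hd j k f) ≫ g' = g := by
  by_cases h : (l, j) = (k, m)
  · obtain ⟨rfl, rfl⟩ := Prod.mk.inj h
    obtain ⟨g, rfl⟩ := (singleFunctor C j).map_surjective g
    obtain ⟨r, rfl⟩ := H.hom_Δ_nabla_eq_smul g
    obtain ⟨p, hp⟩ := H.exists_to_nabla (hX j) f hf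
    -- If `p` were nonzero on boundaries, nondegeneracy of the pairing at the maximal weight `l`
    -- would give a map from `Δ l` that is not a cycle. Hence `p` is a chain map to a single
    -- complex.
    have hdp : ∀ i, X.d i j ≫ p = 0 := fun i => by
      by_contra h₀
      obtain ⟨a, ha⟩ := H.exists_from_Δ (hX i) _ h₀
      rw [← Category.assoc, hd, zero_comp] at ha
      exact H.π_ι_ne_zero l ha.symm
    refine ⟨r • Q.map (HomologicalComplex.mkHomToSingle p fun i _ => hdp i), ?_⟩
    have h₁ : HomologicalComplex.mkHomFromSingle f (fun k _ => hd j k f) ≫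
        HomologicalComplex.mkHomToSingle p (fun i _ => hdp i) =
          (sg C j).map (H.π l ≫ H.ι l) := by
      apply HomologicalComplex.from_single_hom_ext
      rw [HomologicalComplex.single_map_f_self]
      simp [← hp]
    rw [Linear.comp_smul, ← Q.map_comp, h₁]
    exact ((singleFunctor C j).map_smul r _).symm
  · exact ⟨0, by rw [comp_zero, hom_single_Δ_nabla_eq_zero h g]⟩

section

universe u'

variable {E : Type u'} [Category.{v} E] [Abelian E] [Linear 𝕜 E] (F : C ⥤ E) [F.Additive]
  (M : E)

/-- The list `t` records the multiplicities of the standard objects, in all degrees, in a complex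
`X`, as seen by the maps to costandard objects. -/
def IsCharacter (X : CochainComplex C ℤ) (t : List (Λ × ℤ)) : Prop :=
  open Classical in
  ∀ k m, Module.Finite 𝕜 (Q.obj X ⟶ Q.obj ((sg C m).obj (H.nabla k))) ∧
    Module.finrank 𝕜 (Q.obj X ⟶ Q.obj ((sg C m).obj (H.nabla k))) = t.count (k, m)

/-- The maps from `M` to the standard objects in the list `t` are concentrated in degrees of the same
parity as `p`. -/
def ParityVanishing (H : HighestWeightCategory 𝕜 C Λ) (t : List (Λ × ℤ)) (p : ℤ) : Prop :=
  ∀ x ∈ t, ∀ n, ¬ Even (n - p) → ∀ f : Q.obj ((sg E n).obj M) ⟶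
    Q.obj ((sg E x.2).obj (F.obj (H.Δ x.1))), f = 0

/-- The maps from `M` to `F(X)` behave as if `X` were the direct sum of the standard objects in the
list `t`. -/
def IsAdditive (H : HighestWeightCategory 𝕜 C Λ) (X : CochainComplex C ℤ) (t : List (Λ × ℤ)) : Prop :=
  ∀ p, ParityVanishing F M H t p → ∀ n,
    Module.Finite 𝕜 (Q.obj ((sg E n).obj M) ⟶
      Q.obj ((F.mapHomologicalComplex (ComplexShape.up ℤ)).obj X)) ∧
    Module.finrank 𝕜 (Q.obj ((sg E n).obj M) ⟶
      Q.obj ((F.mapHomologicalComplex (ComplexShape.up ℤ)).obj X)) =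
      (t.map fun x => Module.finrank 𝕜 (Q.obj ((sg E n).obj M) ⟶
        Q.obj ((sg E x.2).obj (F.obj (H.Δ x.1))))).sum

lemma shortExact_mapHomologicalComplex {S : ShortComplex (CochainComplex C ℤ)}
    (hF : ∀ i, ((S.map (HomologicalComplex.eval C (ComplexShape.up ℤ) i)).map F).ShortExact) :
    (S.map (F.mapHomologicalComplex (ComplexShape.up ℤ))).ShortExact :=
  HomologicalComplex.shortExact_of_degreewise_shortExact _ hF

variable {F M}

lemma isCharacter_of_iso {X X' : CochainComplex C ℤ} (e : Q.obj X ≅ Q.obj X') {t : List (Λ × ℤ)}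
    (h : H.IsCharacter X' t) : H.IsCharacter X t := fun k m => by
  obtain ⟨h₁, h₂⟩ := h k m
  let e' := Linear.homCongr 𝕜 e (Iso.refl (Q.obj ((sg C m).obj (H.nabla k))))
  exact ⟨Module.Finite.equiv e'.symm, by rw [e'.finrank_eq, h₂]⟩

lemma isAdditive_of_iso {X X' : CochainComplex C ℤ}
    (e : Q.obj ((F.mapHomologicalComplex (ComplexShape.up ℤ)).obj X) ≅
      Q.obj ((F.mapHomologicalComplex (ComplexShape.up ℤ)).obj X')) {t : List (Λ × ℤ)}
    (h : IsAdditive F M H X' t) : IsAdditive F M H X t := fun p hp n => by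
  obtain ⟨h₁, h₂⟩ := h p hp n
  let e' := Linear.homCongr 𝕜 (Iso.refl (Q.obj ((sg E n).obj M))) e
  exact ⟨Module.Finite.equiv e'.symm, by rw [e'.finrank_eq, h₂]⟩

/-- In degrees of the right parity, the adjacent degrees carry no maps to the outer terms, so
dimensions add along the triangle; in the others all three spaces vanish. Parity stays a condition
inside `IsAdditive` because it can be checked only once the list is linked to Ext groups. -/
lemma IsAdditive.cons {S : ShortComplex (CochainComplex C ℤ)}
    (hS : (S.map (F.mapHomologicalComplex (ComplexShape.up ℤ))).ShortExact) {l : Λ} {j : ℤ}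
    (e : S.X₁ ≅ (sg C j).obj (H.Δ l)) (hM : ExtFinite 𝕜 M (F.obj (H.Δ l))) {t : List (Λ × ℤ)}
    (h : IsAdditive F M H S.X₃ t) : IsAdditive F M H S.X₂ ((l, j) :: t) := by
  intro p hp n
  have hT := triangleOfSES_distinguished hS
  have h' := h p fun x hx => hp x (List.mem_cons_of_mem _ hx)
  let e₁ : Q.obj ((F.mapHomologicalComplex (ComplexShape.up ℤ)).obj S.X₁) ≅
      Q.obj ((sg E j).obj (F.obj (H.Δ l))) :=
    Q.mapIso ((F.mapHomologicalComplex (ComplexShape.up ℤ)).mapIso e ≪≫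
      (HomologicalComplex.singleMapHomologicalComplex F (ComplexShape.up ℤ) j).app _)
  have h₁ : ∀ n, ¬ Even (n - p) → ∀ f : Q.obj ((sg E n).obj M) ⟶
      Q.obj ((F.mapHomologicalComplex (ComplexShape.up ℤ)).obj S.X₁), f = 0 := fun n hn f => by
    rw [← cancel_mono e₁.hom, zero_comp]
    exact hp (l, j) List.mem_cons_self n hn _
  have h₃ : ∀ n, ¬ Even (n - p) → ∀ f : Q.obj ((sg E n).obj M) ⟶
      Q.obj ((F.mapHomologicalComplex (ComplexShape.up ℤ)).obj S.X₃), f = 0 := fun n hn f => by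
    obtain ⟨h₄, h₅⟩ := h' n
    have : Subsingleton (Q.obj ((sg E n).obj M) ⟶
        Q.obj ((F.mapHomologicalComplex (ComplexShape.up ℤ)).obj S.X₃)) := by
      refine Module.finrank_zero_iff.1 (h₅.trans ?_)
      refine List.sum_eq_zero fun y hy => ?_
      obtain ⟨x, hx, rfl⟩ := List.mem_map.1 hy
      have : Subsingleton (Q.obj ((sg E n).obj M) ⟶ Q.obj ((sg E x.2).obj (F.obj (H.Δ x.1)))) :=
        subsingleton_of_forall_eq 0 (hp x (List.mem_cons_of_mem _ hx) n hn)
      exact Module.finrank_zero_of_subsingleton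
    exact Subsingleton.elim _ _
  let e₂ := Linear.homCongr 𝕜 (Iso.refl (Q.obj ((sg E n).obj M))) e₁
  have hf := finite_hom_of_extFinite hM n j
  rw [List.map_cons, List.sum_cons, ← (h' n).2]
  change _ ∧ _ = Module.finrank 𝕜 (Q.obj ((sg E n).obj M) ⟶
    Q.obj ((sg E j).obj (F.obj (H.Δ l)))) + _
  rw [← e₂.finrank_eq]
  by_cases hn : Even (n - p)
  · exact finrank_hom_single_add hT (h₁ _ (by grind)) (h₃ _ (by grind))
      (Module.Finite.equiv e₂.symm) (h' n).1
  · have s₁ := subsingleton_of_forall_eq 0 (h₁ n hn)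
    have s₃ := subsingleton_of_forall_eq 0 (h₃ n hn)
    have : Subsingleton (Q.obj ((sg E n).obj M) ⟶
        Q.obj ((F.mapHomologicalComplex (ComplexShape.up ℤ)).obj S.X₂)) :=
      subsingleton_of_forall_eq 0 fun f => by
        obtain ⟨g, hg⟩ := Triangle.coyoneda_exact₂ _ hT f (h₃ n hn _)
        rw [hg, h₁ n hn g]
        exact zero_comp
    refine ⟨inferInstance, ?_⟩
    rw [Module.finrank_zero_of_subsingleton, Module.finrank_zero_of_subsingleton,
      Module.finrank_zero_of_subsingleton]

/-- By `hext` dimensions add, and the subcomplex contributes exactly its own entry because maps from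
`Δ l` in degree `j` to `nabla k` in degree `m` form a line if the pairs agree and vanish otherwise.
-/
lemma IsCharacter.cons {S : ShortComplex (CochainComplex C ℤ)} (hS : S.ShortExact) {l : Λ} {j : ℤ}
    (e : S.X₁ ≅ (sg C j).obj (H.Δ l))
    (hext : ∀ (k : Λ) (m : ℤ) (g : Q.obj S.X₁ ⟶ Q.obj ((sg C m).obj (H.nabla k))),
      ∃ g', Q.map S.f ≫ g' = g) {t : List (Λ × ℤ)}
    (h : H.IsCharacter S.X₃ t) : H.IsCharacter S.X₂ ((l, j) :: t) := by
  classical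
  intro k m
  obtain ⟨h₁, h₂⟩ := H.finrank_hom_single_Δ_nabla l k j m
  obtain ⟨h₃, h₄⟩ := h k m
  let e' := Linear.homCongr 𝕜 (Q.mapIso e) (Iso.refl (Q.obj ((sg C m).obj (H.nabla k))))
  obtain ⟨h₅, h₆⟩ := finrank_hom_to_single_add (𝕜 := 𝕜) (triangleOfSES_distinguished hS)
    (fun m g => hext k m g) (Module.Finite.equiv e'.symm) h₃
  have h₆' : Module.finrank 𝕜 (Q.obj S.X₂ ⟶ Q.obj ((sg C m).obj (H.nabla k))) =
      Module.finrank 𝕜 (Q.obj S.X₃ ⟶ Q.obj ((sg C m).obj (H.nabla k))) +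
        Module.finrank 𝕜 (Q.obj S.X₁ ⟶ Q.obj ((sg C m).obj (H.nabla k))) := h₆
  have h₇ : Module.finrank 𝕜 (Q.obj S.X₁ ⟶ Q.obj ((sg C m).obj (H.nabla k))) =
      if (l, j) = (k, m) then 1 else 0 := e'.finrank_eq.trans h₂
  refine ⟨h₅, h₆'.trans ?_⟩
  rw [h₄, h₇, List.count_cons]
  simp

variable (F M) in
/-- The dévissage of a bounded complex of objects with standard filtrations. -/
lemma exists_character
    (hF : ∀ S : ShortComplex C, S.ShortExact → filtered H.Δ Set.univ S.X₃ → (S.map F).ShortExact)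
    {Γ : Set Λ} (hM : ∀ k ∈ Γ, ExtFinite 𝕜 M (F.obj (H.Δ k))) (I : Finset ℤ) (n : ℕ) :
    ∀ (X : CochainComplex C ℤ) (s : ℤ → List Λ), (∀ i, HasFiltration H.Δ (X.X i) (s i)) →
      (∀ i, ∀ k ∈ s i, k ∈ Γ) → (∀ i ∉ I, s i = []) → ∑ i ∈ I, (s i).length = n →
      ∃ t : List (Λ × ℤ), (∀ x ∈ t, x.1 ∈ Γ) ∧ H.IsCharacter X t ∧ IsAdditive F M H X t := by
  classical
  induction n using Nat.strong_induction_on with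
  | _ n ih =>
  rintro X s hs hΓ hI rfl
  by_cases hall : ∀ i, s i = []
  · have hz : IsZero X := isZero_of_forall_isZero_X fun i => by
      have := hs i
      rw [hall] at this
      exact isZero_of_filtered_empty ⟨_, this, by simp⟩
    have hz₁ := Q.map_isZero hz
    have hz₂ := Q.map_isZero ((F.mapHomologicalComplex (ComplexShape.up ℤ)).map_isZero hz)
    refine ⟨[], by simp, fun k m => ?_, fun p _ n => ?_⟩
    · have : Subsingleton (Q.obj X ⟶ Q.obj ((sg C m).obj (H.nabla k))) :=
        ⟨fun f g => hz₁.eq_of_src f g⟩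
      exact ⟨inferInstance, Module.finrank_zero_of_subsingleton⟩
    · have : Subsingleton (Q.obj ((sg E n).obj M) ⟶
          Q.obj ((F.mapHomologicalComplex (ComplexShape.up ℤ)).obj X)) :=
        ⟨fun f g => hz₂.eq_of_tgt f g⟩
      exact ⟨inferInstance, Module.finrank_zero_of_subsingleton⟩
  -- A weight maximal among the factors in all degrees: every nonzero map from `Δ l` to a term is
  -- then a monomorphism with standardly filtered cokernel.
  obtain ⟨l, ⟨i₀, hl⟩, hmax⟩ : ∃ l, (∃ i, l ∈ s i) ∧ ∀ i, ∀ k ∈ s i, ¬ l < k := by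
    let W : Set Λ := {k | ∃ i, k ∈ s i}
    have hW : W.Finite := by
      refine (I.biUnion fun i => (s i).toFinset).finite_toSet.subset ?_
      rintro k ⟨i, hk⟩
      simp only [Finset.coe_biUnion, Set.mem_iUnion]
      refine ⟨i, ?_, by simpa using hk⟩
      by_contra hi
      rw [hI i hi] at hk
      simp at hk
    have hne : W.Nonempty := by
      simp only [not_forall] at hall
      obtain ⟨i, hi⟩ := hall
      obtain ⟨k, hk⟩ := List.exists_mem_of_ne_nil _ hi
      exact ⟨k, i, hk⟩
    obtain ⟨l, hl⟩ := hW.exists_maximal hne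
    exact ⟨l, hl.1, fun i k hk hlk => hlk.not_ge (hl.2 ⟨i, hk⟩ hlk.le)⟩
  have htr : ∀ i, trunc H.L {k | ¬ l < k} (X.X i) := fun i =>
    H.trunc_of_filtered_Δ (Γ := {k | ¬ l < k}) (fun _ => Iic_subset_notGT) ⟨s i, hs i, hmax i⟩
  -- Dividing out a nonzero subcomplex with terms `Δ l` or zero keeps the terms standardly filtered
  -- and shortens the filtrations, so induction applies to the quotient. `F` remains exact on this
  -- sequence.
  have step : ∀ (P : CochainComplex C ℤ) (φ : P ⟶ X) (_ : ∀ i, Mono (φ.f i))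
      (_ : ∀ i, IsZero (P.X i) ∨ Nonempty (P.X i ≅ H.Δ l)) (_ : ∃ i, ¬ IsZero (P.X i)),
      (cokernelComplex φ).ShortExact ∧
        ((cokernelComplex φ).map (F.mapHomologicalComplex (ComplexShape.up ℤ))).ShortExact ∧
        ∃ t : List (Λ × ℤ), (∀ x ∈ t, x.1 ∈ Γ) ∧ H.IsCharacter (cokernel φ) t ∧
          IsAdditive F M H (cokernel φ) t := by
    intro P φ hφ hP hP'
    have := HomologicalComplex.mono_of_mono_f φ hφ
    let S := cokernelComplex φ
    have hS : S.ShortExact := shortExact_cokernel φ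
    have hSi : ∀ i, (S.map (HomologicalComplex.eval C (ComplexShape.up ℤ) i)).ShortExact :=
      HomologicalComplex.shortExact_iff_degreewise_shortExact S |>.1 hS
    choose s' hs' hsub hle hlt using fun i => exists_filtration_quotient (hSi i) (hs i) (hmax i) (hP i)
    have hlen : ∑ i ∈ I, (s' i).length < ∑ i ∈ I, (s i).length := by
      obtain ⟨i, hi⟩ := hP'
      refine Finset.sum_lt_sum (fun i _ => hle i) ⟨i, ?_, hlt i hi⟩
      by_contra hiI
      have := hlt i hi
      rw [hI i hiI] at this
      simp at this
    obtain ⟨t, ht₁, ht₂, ht₃⟩ := ih _ hlen S.X₃ s' hs' (fun i k hk => hΓ i k (hsub i hk))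
      (fun i hi => List.eq_nil_of_subset_nil (hI i hi ▸ hsub i)) rfl
    exact ⟨hS, shortExact_mapHomologicalComplex F fun i => hF _ (hSi i) ⟨s' i, hs' i, by simp⟩,
      t, ht₁, ht₂, ht₃⟩
  -- If all maps from `Δ l` are cycles, one copy of `Δ l` is a subcomplex in a single degree and
  -- yields an entry. Otherwise `f` and `f ≫ d` embed the contractible complex `Δ l` = `Δ l`;
  -- dividing it out changes neither the complex nor its image under `F` in the derived category.
  by_cases hd : ∀ i k (f : H.Δ l ⟶ X.X i), f ≫ X.d i k = 0
  · obtain ⟨f, hf⟩ : ∃ f : H.Δ l ⟶ X.X i₀, f ≠ 0 := by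
      by_contra! h₀
      have : Subsingleton (H.Δ l ⟶ X.X i₀) := subsingleton_of_forall_eq 0 h₀
      have h₁ := finrank_hom_filtration_right H.finite_hom (hs i₀) (Y := H.Δ l) fun k hk =>
        H.subsingleton_ext_Δ (trunc_mono H.L (Iic_subset_notGT (hmax i₀ k hk)) (H.Δ_mem k))
      rw [Module.finrank_zero_of_subsingleton] at h₁
      have h₂ := List.sum_eq_zero_iff.1 h₁.symm _ (List.mem_map_of_mem hl)
      rw [H.finrank_hom_Δ_Δ] at h₂
      exact one_ne_zero h₂
    have hmono := (H.mono_of_hom_Δ (hs i₀) (hmax i₀) f hf).1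
    have key := step ((sg C i₀).obj (H.Δ l))
      (HomologicalComplex.mkHomFromSingle f fun k _ => hd i₀ k f) (fun i => ?_) (fun i => ?_)
      ⟨i₀, fun h => not_isZero_Δ (H := H) l
        (h.of_iso (HomologicalComplex.singleObjXSelf _ i₀ (H.Δ l)).symm)⟩
    · obtain ⟨h₁, h₂, t, ht, hc, ha⟩ := key
      refine ⟨(l, i₀) :: t, ?_, ?_, ?_⟩
      · rintro x (_ | ⟨_, hx⟩)
        · exact hΓ i₀ l hl
        · exact ht x hx
      · exact hc.cons h₁ (Iso.refl _) (exists_extension_single htr hd hf)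
      · exact ha.cons h₂ (Iso.refl _) (hM l (hΓ i₀ l hl))
    · by_cases hi : i = i₀
      · subst hi
        rw [HomologicalComplex.mkHomFromSingle_f]
        infer_instance
      · exact (HomologicalComplex.isZero_single_obj_X _ i₀ _ i hi).mono _
    · by_cases hi : i = i₀
      · subst hi
        exact Or.inr ⟨HomologicalComplex.singleObjXSelf _ i (H.Δ l)⟩
      · exact Or.inl (HomologicalComplex.isZero_single_obj_X _ i₀ _ i hi)
  · push Not at hd
    obtain ⟨i, k, f, hf⟩ := hd
    obtain rfl : i + 1 = k := by
      by_contra h₀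
      exact hf (by rw [X.shape _ _ h₀, comp_zero])
    have hne : i ≠ i + 1 := by simp
    have hf₀ : f ≠ 0 := fun h => hf (by rw [h, zero_comp])
    have hm₀ := (H.mono_of_hom_Δ (hs i) (hmax i) f hf₀).1
    have hm₁ := (H.mono_of_hom_Δ (hs (i + 1)) (hmax (i + 1)) _ hf).1
    have hrel : (ComplexShape.up ℤ).Rel i (i + 1) := rfl
    let P := HomologicalComplex.double (𝟙 (H.Δ l)) hrel
    have hP : ∀ j, j ≠ i → j ≠ i + 1 → IsZero (P.X j) :=
      HomologicalComplex.isZero_double_X _ hrel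
    have hPd : IsIso (P.d i (i + 1)) := by
      rw [HomologicalComplex.double_d _ _ hne]
      infer_instance
    have key := step P
      (HomologicalComplex.mkHomFromDouble hrel hne f (f ≫ X.d i (i + 1)) (by simp) (by simp))
      (fun j => ?_) (fun j => ?_)
      ⟨i, fun h => not_isZero_Δ (H := H) l
        (h.of_iso (HomologicalComplex.doubleXIso₀ _ hrel).symm)⟩
    · obtain ⟨h₁, h₂, t, ht, hc, ha⟩ := key
      have hi₁ := isIso_Q_map_of_shortExact h₁ (isZero_Q_of_isIso_d hPd hP)
      have hi₂ := isIso_Q_map_of_shortExact h₂ (isZero_Q_of_isIso_d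
        (P := (F.mapHomologicalComplex (ComplexShape.up ℤ)).obj P) (i := i)
        (inferInstanceAs (IsIso (F.map (P.d i (i + 1))))) fun j hj hj' => F.map_isZero (hP j hj hj'))
      refine ⟨t, ht, isCharacter_of_iso (@asIso _ _ _ _ _ hi₁) hc,
        isAdditive_of_iso (@asIso _ _ _ _ _ hi₂) ha⟩
    · by_cases hj : j = i
      · subst hj
        rw [HomologicalComplex.mkHomFromDouble_f₀]
        infer_instance
      · by_cases hj' : j = i + 1
        · subst hj'
          rw [HomologicalComplex.mkHomFromDouble_f₁]
          infer_instance
        · exact (hP j hj hj').mono _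
    · by_cases hj : j = i
      · subst hj
        exact Or.inr ⟨HomologicalComplex.doubleXIso₀ _ hrel⟩
      · by_cases hj' : j = i + 1
        · subst hj'
          exact Or.inr ⟨HomologicalComplex.doubleXIso₁ _ hrel hne⟩
        · exact Or.inl (hP j hj hj')

end

end HighestWeightCategory

/-! ### Coefficients of Laurent polynomials -/

section

open LaurentPolynomial

/-- The coefficient of a Laurent polynomial, as an additive map. -/
def coeffHom (i : ℤ) : ℤ[T;T⁻¹] →+ ℤ :=
  (Finsupp.applyAddHom i).comp AddMonoidAlgebra.coeffAddEquiv.toAddMonoidHom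

lemma coeffHom_apply (i : ℤ) (p : ℤ[T;T⁻¹]) : coeffHom i p = p.coeff i := rfl

lemma coeff_finsum_smul_T {ι : Type*} {f : ι → ℤ} (hf : f.support.Finite) {e : ι → ℤ}
    (he : Function.Injective e) (i : ι) :
    (∑ᶠ j, f j • (T (e j) : ℤ[T;T⁻¹])).coeff (e i) = f i := by
  rw [← coeffHom_apply, AddMonoidHom.map_finsum _ (hf.subset fun j hj h => hj (by simp [h])),
    finsum_eq_single _ i fun j hj => ?_]
  · rw [map_zsmul, coeffHom_apply, T_apply, if_pos rfl, smul_eq_mul, mul_one]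
  · rw [map_zsmul, coeffHom_apply, T_apply, if_neg (he.ne hj), smul_zero]

lemma coeff_finsum_smul_T_of_notMem {ι : Type*} {f : ι → ℤ} (hf : f.support.Finite) {e : ι → ℤ}
    {i : ℤ} (hi : ∀ j, e j ≠ i) : (∑ᶠ j, f j • (T (e j) : ℤ[T;T⁻¹])).coeff i = 0 := by
  rw [← coeffHom_apply, AddMonoidHom.map_finsum _ (hf.subset fun j hj h => hj (by simp [h]))]
  exact finsum_eq_zero_of_forall_eq_zero fun j => by
    rw [map_zsmul, coeffHom_apply, T_apply, if_neg (hi j), smul_zero]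

lemma coeff_mul_T (p : ℤ[T;T⁻¹]) (n i : ℤ) : (p * T n).coeff i = p.coeff (i - n) := by
  induction p using LaurentPolynomial.induction_on' with
  | add p q hp hq =>
    rw [add_mul]
    exact congrArg₂ (· + ·) hp hq
  | C_mul_T m r =>
    rw [mul_assoc, ← T_add, ← single_eq_C_mul_T, ← single_eq_C_mul_T, AddMonoidAlgebra.coeff_single,
      AddMonoidAlgebra.coeff_single, Finsupp.single_apply, Finsupp.single_apply]
    simp only [eq_sub_iff_add_eq]

/-- The ring ℤ[v², v⁻²] lies in the image of the substitution v ↦ v², so only even exponents occur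
in it. -/
lemma HasParity.coeff_eq_zero {p : ℤ[T;T⁻¹]} {n : ℤ} (hp : HasParity p n) {i : ℤ}
    (hi : ¬ Even (i - n)) : p.coeff i = 0 := by
  obtain ⟨q, hq, rfl⟩ := hp
  have h : evenSubring ≤
      (AddMonoidAlgebra.mapDomainRingHom ℤ (AddMonoidHom.mulLeft (2 : ℤ))).range := by
    refine Subring.closure_le.2 ?_
    rintro _ (rfl | rfl)
    · exact ⟨T 1, AddMonoidAlgebra.mapDomain_single⟩
    · exact ⟨T (-1), AddMonoidAlgebra.mapDomain_single.trans
        (congrArg T (by norm_num : (2 : ℤ) * -1 = -2))⟩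
  obtain ⟨q, rfl⟩ := h hq
  rw [T_mul, coeff_mul_T]
  refine Finsupp.mapDomain_of_notMem_range _ _ fun ⟨j, hj⟩ => hi ⟨j, ?_⟩
  change 2 * j = i - n at hj
  lia

open Classical in
lemma coeff_list_sum {α : Type*} (t : List (α × ℤ)) (a : α) (i : ℤ) :
    (t.map fun x => if x.1 = a then (T x.2 : ℤ[T;T⁻¹]) else 0).sum.coeff i = t.count (a, i) := by
  induction t with
  | nil => simp
  | cons x t ih =>
    rw [List.map_cons, List.sum_cons, AddMonoidAlgebra.coeff_add, Finsupp.add_apply, ih,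
      List.count_cons]
    obtain ⟨b, j⟩ := x
    by_cases h : b = a <;> by_cases h' : j = i <;> simp [h, h', add_comm]

open Classical in
lemma list_sum_eq_finset_sum {α : Type*} (t : List (α × ℤ)) (g : α → ℤ[T;T⁻¹]) (s : Finset α)
    (hs : ∀ x ∈ t, x.1 ∈ s) :
    (t.map fun x => T x.2 * g x.1).sum =
      ∑ a ∈ s, (t.map fun x => if x.1 = a then (T x.2 : ℤ[T;T⁻¹]) else 0).sum * g a := by
  induction t with
  | nil => simp
  | cons x t ih =>
    have hx := hs x List.mem_cons_self
    simp only [List.map_cons, List.sum_cons, add_mul, Finset.sum_add_distrib]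
    rw [ih fun y hy => hs y (List.mem_cons_of_mem _ hy)]
    simp [ite_mul, Finset.sum_ite_eq, hx]

end

/-! ### Ext polynomials -/

section

open DerivedCategory

variable {𝕜 : Type v} [Field 𝕜] {C : Type u} [Category.{v} C] [Abelian C] [Linear 𝕜 C]

/-- Indexing by two degrees matches maps between objects placed in degrees n and m; for n < m both
sides are zero. -/
lemma coeff_extPoly {X Y : C} (h : ExtFinite 𝕜 X Y) (n m : ℤ) :
    (extPoly 𝕜 X Y).coeff (n - m) =
      Module.finrank 𝕜 (Q.obj ((sg C n).obj X) ⟶ Q.obj ((sg C m).obj Y)) := by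
  have hf : (Function.support fun n : ℕ => (extDim 𝕜 X Y n : ℤ)).Finite := by
    refine h.2.subset fun n hn => ?_
    by_contra h₀
    have : Subsingleton (ExtGroup X Y n) := not_nontrivial_iff_subsingleton.1 h₀
    exact hn (Nat.cast_eq_zero.2 (Module.finrank_zero_of_subsingleton (R := 𝕜)))
  by_cases hnm : ∃ b : ℕ, (b : ℤ) = n - m
  · obtain ⟨b, hb⟩ := hnm
    rw [← hb]
    refine (coeff_finsum_smul_T hf Nat.cast_injective b).trans ?_
    exact congrArg Nat.cast (extEquivSingle (𝕜 := 𝕜) X Y b (n := n) (m := m) (by lia)).finrank_eq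
  · push Not at hnm
    have hlt : n < m := by
      by_contra h₀
      exact hnm (n - m).toNat (by lia)
    have : Subsingleton (Q.obj ((sg C n).obj X) ⟶ Q.obj ((sg C m).obj Y)) :=
      subsingleton_of_forall_eq 0 (hom_single_eq_zero hlt)
    rw [Module.finrank_zero_of_subsingleton]
    exact coeff_finsum_smul_T_of_notMem hf hnm

lemma extPoly_of_iso {X Y Y' : C} (e : Y ≅ Y') (h : ExtFinite 𝕜 X Y) :
    extPoly 𝕜 X Y = extPoly 𝕜 X Y' := by
  ext i
  have h₁ := coeff_extPoly h i 0
  have h₂ := coeff_extPoly (extFinite_of_iso e h) i 0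
  rw [sub_zero] at h₁ h₂
  rw [h₁, h₂]
  exact congrArg Nat.cast (Linear.homCongr 𝕜 (Iso.refl (Q.obj ((sg C i).obj X)))
    (Q.mapIso ((sg C 0).mapIso e))).finrank_eq

end

/-! ### The two computations for a minimal complex -/

namespace HighestWeightCategory

open DerivedCategory Pretriangulated

variable {𝕜 : Type v} [Field 𝕜] {C : Type u} [Category.{v} C] [Abelian C] [Linear 𝕜 C]
  {Λ : Type w} [PartialOrder Λ] {H : HighestWeightCategory 𝕜 C Λ}

-- An object in degree m is its shift by -m, so the entry (k, m) counts classes in Ext^{-m}(M, nabla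
-- k). This sign is the source of the bar involution. Finiteness of the Ext groups follows from that
-- of the list.
open Classical in
lemma IsCharacter.extFinite {X : CochainComplex C ℤ} {t : List (Λ × ℤ)} (h : H.IsCharacter X t)
    {M : C} (e : Q.obj X ≅ Q.obj ((sg C 0).obj M)) (k : Λ) :
    ExtFinite 𝕜 M (H.nabla k) ∧ ∀ m : ℤ, (extPoly 𝕜 M (H.nabla k)).coeff (-m) = t.count (k, m) := by
  let e₁ (m : ℤ) := Linear.homCongr 𝕜 e (Iso.refl (Q.obj ((sg C m).obj (H.nabla k))))
  let e₂ (b : ℕ) := extEquivSingle (𝕜 := 𝕜) M (H.nabla k) b (n := 0) (m := -b) (by lia)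
  have hf : ExtFinite 𝕜 M (H.nabla k) := by
    refine ⟨fun b => ?_, ?_⟩
    · have := (h k (-b)).1
      exact Module.Finite.equiv ((e₁ (-b)).trans (e₂ b).symm)
    · refine (t.toFinset.finite_toSet.preimage (f := fun b : ℕ => (k, -(b : ℤ))) ?_).subset ?_
      · intro b _ c _ hbc
        simpa using hbc
      · intro b hb
        have hb' : Nontrivial (ExtGroup M (H.nabla k) b) := hb
        have := (h k (-b)).1
        have : Nontrivial (Q.obj X ⟶ Q.obj ((sg C (-b)).obj (H.nabla k))) :=
          ((e₁ (-b)).trans (e₂ b).symm).symm.injective.nontrivial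
        have := Module.finrank_pos (R := 𝕜) (M := (Q.obj X ⟶ Q.obj ((sg C (-b)).obj (H.nabla k))))
        rw [(h k (-b)).2] at this
        simpa using List.count_pos_iff.1 this
  refine ⟨hf, fun m => ?_⟩
  rw [← zero_sub, coeff_extPoly hf 0 m, ← (e₁ m).finrank_eq, (h k m).2]

variable {T : Λ → C} (hT : ∀ l, H.IsIndecomposableTilting l (T l)) {Γ : LowerSet Λ} [Finite Γ]

lemma IsMinimalTiltingComplex.exists_character {lam : Λ} (hlam : lam ∈ Γ) (mu : Γ)
    {K : CochainComplex H.Tilt ℤ} (hK : H.IsMinimalTiltingComplex (H.L lam) K) :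
    ∃ t : List (Λ × ℤ), (∀ x ∈ t, x.1 ≤ lam) ∧ H.IsCharacter (H.complexOfTilt K) t ∧
      IsAdditive (dualFunctor hT Γ) (dualL hT mu) H (H.complexOfTilt K) t := by
  obtain ⟨a, b, hab⟩ := hK.bounded
  have hz : ∀ i, (i < a ∨ b < i) → IsZero (K.X i).obj := fun i hi =>
    H.tilting.ι.map_isZero (hab i hi)
  have hs : ∀ i, ∃ s, HasFiltration H.Δ (K.X i).obj s ∧ (i ∉ Finset.Icc a b → s = []) := fun i => by
    by_cases hi : i ∈ Finset.Icc a b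
    · obtain ⟨s, hs⟩ := (K.X i).property.1
      exact ⟨s, hs, fun h => (h hi).elim⟩
    · exact ⟨[], .zero (hz i (by rw [Finset.mem_Icc] at hi; lia)), fun _ => rfl⟩
  choose s hs hI using hs
  exact HighestWeightCategory.exists_character (dualFunctor hT Γ) (dualL hT mu)
    (fun S hS h => shortExact_dualFunctor hT hS (subsingleton_ext_filtered_left h fun i _ =>
      (extOrthogonal_tiltingSum hT).1 i)) (Γ := Set.Iic lam)
    (fun k hk => extFinite_dualL_Δ hT mu k (Γ.lower hk hlam)) (Finset.Icc a b) _
    (H.complexOfTilt K) s hs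
    (fun i k hk => H.mem_of_hasFiltration_Δ (hs i) (hK.trunc hT i) hk) hI rfl

/-- The image of `K` is a bounded below complex of injectives, and minimality makes its
differentials annihilate maps from the simple module. So derived maps in degree `n` are plain maps
into the n-th term. -/
lemma IsMinimalTiltingComplex.finrank_hom {lam : Λ} (hlam : lam ∈ Γ) (mu : Γ)
    {K : CochainComplex H.Tilt ℤ} (hK : H.IsMinimalTiltingComplex (H.L lam) K) (n : ℤ) :
    Module.finrank 𝕜 (Q.obj ((sg _ n).obj (dualL hT mu)) ⟶
      Q.obj (((dualFunctor hT Γ).mapHomologicalComplex (ComplexShape.up ℤ)).obj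
        (H.complexOfTilt K))) = multiplicity (K.X n).obj (T mu) := by
  obtain ⟨a, b, hab⟩ := hK.bounded
  have htr : ∀ i, HighestWeight.trunc H.L (Γ : Set Λ) (K.X i).obj := fun i =>
    trunc_mono H.L (fun _ hk => Γ.lower hk hlam) (hK.trunc hT i)
  let J : CochainComplex (TruncatedRingelDual hT Γ) ℤ :=
    ((dualFunctor hT Γ).mapHomologicalComplex (ComplexShape.up ℤ)).obj (H.complexOfTilt K)
  have : J.IsStrictlyGE a := (CochainComplex.isStrictlyGE_iff _ _).2 fun i hi =>
    (dualFunctor hT Γ).map_isZero (H.tilting.ι.map_isZero (hab i (Or.inl hi)))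
  rw [finrank_hom_single_of_injective (J := J) a
    (fun i => injective_dualFunctor hT (K.X i).property (htr i)) (fun i j f => ?_)]
  · exact finrank_hom_dualL (K.X n).property (htr n)
  · by_cases hij : i + 1 = j
    · subst hij
      exact comp_dualFunctor_map_eq_zero (K.X i).property (htr i) _
        (fun a b => comp_eq_zero_of_mem_radical (hK.minimal i) (hT mu) a b) f
    · rw [J.shape _ _ hij, comp_zero]

lemma IsAdditive.finsum_eq {t : List (Λ × ℤ)} {lam : Λ} (hlam : lam ∈ Γ) {mu : Γ}
    {K : CochainComplex H.Tilt ℤ} (hK : H.IsMinimalTiltingComplex (H.L lam) K)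
    (ht : IsAdditive (dualFunctor hT Γ) (dualL hT mu) H (H.complexOfTilt K) t)
    (hle : ∀ x ∈ t, x.1 ≤ lam) {p : ℤ}
    (hp : ParityVanishing (dualFunctor hT Γ) (dualL hT mu) H t p) :
    ∑ᶠ i : ℤ, (multiplicity (K.X i).obj (T mu) : ℤ) • (LaurentPolynomial.T i : ℤ[T;T⁻¹]) =
      (t.map fun x => LaurentPolynomial.T x.2 *
        extPoly 𝕜 (dualL hT mu) ((dualFunctor hT Γ).obj (H.Δ x.1))).sum := by
  have hf : (Function.support fun i : ℤ => (multiplicity (K.X i).obj (T mu) : ℤ)).Finite := by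
    obtain ⟨a, b, hab⟩ := hK.bounded
    refine (Finset.Icc a b).finite_toSet.subset fun i hi => ?_
    by_contra h
    rw [Finset.coe_Icc, Set.mem_Icc] at h
    have hz : IsZero ((dualFunctor hT Γ).obj (K.X i).obj) :=
      (dualFunctor hT Γ).map_isZero (H.tilting.ι.map_isZero (hab i (by lia)))
    have : Subsingleton (dualL hT mu ⟶ (dualFunctor hT Γ).obj (K.X i).obj) :=
      ⟨fun f g => hz.eq_of_tgt f g⟩
    refine hi (Nat.cast_eq_zero.2 ?_)
    rw [← finrank_hom_dualL (K.X i).property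
      (trunc_mono H.L (fun _ hk => Γ.lower hk hlam) (hK.trunc hT i))]
    exact Module.finrank_zero_of_subsingleton
  ext n
  refine (coeff_finsum_smul_T hf Function.injective_id n).trans ?_
  rw [← hK.finrank_hom hT hlam mu n, (ht p hp n).2, ← coeffHom_apply, map_list_sum, List.map_map,
    ← Nat.coe_castAddMonoidHom, map_list_sum, List.map_map]
  congr 1
  refine List.map_congr_left fun x hx => ?_
  change _ = coeffHom n (_ * _)
  rw [LaurentPolynomial.T_mul, coeffHom_apply, coeff_mul_T,
    coeff_extPoly (extFinite_dualL_Δ hT mu x.1 (Γ.lower (hle x hx) hlam))]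
  rfl

end HighestWeightCategory

end

end HighestWeight

/-! ### The multiplicity formula -/

theorem mainTheorem6 {𝕜 : Type v} [Field 𝕜] {C : Type u} [Category.{v} C] [Abelian C]
    [Linear 𝕜 C] {Λ : Type w} [PartialOrder Λ] (H : HighestWeightCategory 𝕜 C Λ)
    {T : Λ → C} (hT : ∀ l, H.IsIndecomposableTilting l (T l))
    (Γ : LowerSet Λ) [Finite Γ] (lam mu : Γ) (ell : Γ → ℤ)
    (hp : ∀ nu : Γ, HasParity (extPoly 𝕜 (H.L lam) (H.nabla nu)) (ell lam - ell nu))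
    (hp' : ∀ nu : Γ, HasParity
      (extPoly 𝕜 (HighestWeightCategory.dualL hT mu) (HighestWeightCategory.dualNabla hT nu))
      (ell mu - ell nu)) :
    (∀ nu : Γ, ExtFinite 𝕜 (H.L lam) (H.nabla nu) ∧
      ExtFinite 𝕜 (HighestWeightCategory.dualL hT mu) (HighestWeightCategory.dualNabla hT nu)) ∧
    (∃ K : CochainComplex H.Tilt ℤ, H.IsMinimalTiltingComplex (H.L lam) K) ∧
    ∀ K : CochainComplex H.Tilt ℤ, H.IsMinimalTiltingComplex (H.L lam) K →
      ∑ᶠ i : ℤ, (multiplicity (K.X i).obj (T mu) : ℤ) • (LaurentPolynomial.T i : ℤ[T;T⁻¹]) =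
        ∑ᶠ nu ∈ {nu : Γ | nu ≤ lam},
          LaurentPolynomial.invert (extPoly 𝕜 (H.L lam) (H.nabla nu)) *
            extPoly 𝕜 (HighestWeightCategory.dualL hT mu)
              (HighestWeightCategory.dualNabla hT nu) := by
  classical
  have := Fintype.ofFinite Γ
  have hfin (nu : Γ) := HighestWeightCategory.extFinite_dualL_dualNabla hT mu nu
  have hpoly (nu : Γ) := extPoly_of_iso (HighestWeightCategory.dualNablaIso hT nu) (hfin nu)
  obtain ⟨K₀, hK₀⟩ := H.exists_isMinimalTiltingComplex hT (H.L lam)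
  refine ⟨fun nu => ⟨?_, hfin nu⟩, ⟨K₀, hK₀⟩, fun K hK => ?_⟩
  · obtain ⟨t, -, hc, -⟩ := hK₀.exists_character hT lam.2 mu
    exact (hc.extFinite hK₀.iso.some nu).1
  obtain ⟨t, hle, hc, ha⟩ := hK.exists_character hT lam.2 mu
  have hcoeff (nu : Λ) := (hc.extFinite hK.iso.some nu).2
  -- For (ν, m) in `t`, the monomial v^{-m} occurs in p_{ν,λ}, so -m ≡ ℓ(λ) - ℓ(ν). A nonzero map in
  -- degree n gives n - m ≡ ℓ(μ) - ℓ(ν). Together n ≡ ℓ(μ) - ℓ(λ) mod 2, independently of ν.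
  have hvanish : HighestWeightCategory.ParityVanishing (HighestWeightCategory.dualFunctor hT Γ)
      (HighestWeightCategory.dualL hT mu) H t (ell mu - ell lam) := by
    intro x hx n hn
    let nu : Γ := ⟨x.1, Γ.lower (hle x hx) lam.2⟩
    by_contra! hne
    obtain ⟨f, hf⟩ := hne
    have h₁ : Even (-x.2 - (ell lam - ell nu)) := by
      by_contra h
      have h₀ := (hp nu).coeff_eq_zero h
      rw [hcoeff nu x.2, Nat.cast_eq_zero] at h₀
      exact List.count_eq_zero.1 h₀ hx
    have h₂ : Even (n - x.2 - (ell mu - ell nu)) := by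
      by_contra h
      have h₀ := (hp' nu).coeff_eq_zero h
      have hx' := HighestWeightCategory.extFinite_dualL_Δ hT mu nu nu.2
      have := finite_hom_of_extFinite hx' n x.2
      rw [hpoly, coeff_extPoly hx', Nat.cast_eq_zero] at h₀
      exact hf ((Module.finrank_zero_iff.1 h₀).elim _ _)
    exact hn (by grind)
  -- Grouping the entries of `t` by weight turns the sum over `t` into a sum over ν ≤ λ, in which
  -- the coefficient of p'_{ν,μ} is the sum of v^m over the entries (ν, m), that is, the conjugate
  -- of p_{ν,λ}.
  rw [ha.finsum_eq hT lam.2 hK hle hvanish, list_sum_eq_finset_sum t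
    (fun k => extPoly 𝕜 (HighestWeightCategory.dualL hT mu)
      ((HighestWeightCategory.dualFunctor hT Γ).obj (H.Δ k))) (H.lowerFinite lam).toFinset
    (fun x hx => by simpa using hle x hx), ← finsum_mem_eq_finite_toFinset_sum]
  have himage : Set.Iic (lam : Λ) = Subtype.val '' {nu : Γ | nu ≤ lam} := by
    ext k
    exact ⟨fun hk => ⟨⟨k, Γ.lower hk lam.2⟩, hk, rfl⟩, fun ⟨nu, hnu, h⟩ => h ▸ hnu⟩
  rw [himage, finsum_mem_image Subtype.val_injective.injOn]
  refine finsum_mem_congr rfl fun nu _ => ?_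
  rw [hpoly]
  congr 1
  ext m
  rw [coeff_list_sum, LaurentPolynomial.invert_apply, hcoeff]
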